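/- Max Rainbow Matching is the following problem: given a finite simple graph $G$ with an (arbitrary, not necessarily proper) edge coloring, output a largest rainbow matching of $G$, that is, a matching whose edges have pairwise distinct colors and which has as many edges as possible. Let $P_7$ denote the path with $7$ vertices. The model of computation is the random access machine with unit-cost addition, subtraction and comparison; the input graph is given by its number of vertices and the list of its edges (each once, in arbitrary order, with its two ends and its color, vertices and colors being natural numbers). There is one algorithm for Max Rainbow Matching on forests which do not contain $P_7$ as a subgraph such that: (i) There is a constant $C$ such that for every forest $F$ with $n\ge 1$ vertices and $k$ components, containing no $P_7$ as a subgraph and satisfying $n\ge 2k$ (for instance, every such forest without isolated vertices), for every edge coloring of $F$ and every edge list, it outputs a largest rainbow matching after at most $$C\cdot\frac{n^{(4k+3)/2}}{2^k\,k^{2k}}$$ steps. The constant $C$ depends neither on $n$ nor on $k$. (ii) For every $K$ it solves the problem in polynomial time on the non-empty forests which do not contain $P_7$ as a subgraph and have at most $K$ components (with or without isolated vertices): there is a constant $C_K$ such that it outputs a largest rainbow matching after at most $C_K\, n^{(4K+3)/2}$ steps. (iii) In particular, on trees which do not contain $P_7$ as a subgraph it outputs a largest rainbow matching after $O(n^{7/2})$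 steps. -/

import Mathlib

/-! ### A unit-cost random access machine

Programs are structured (`while` programs) and work on natural numbers. A program uses finitely many
registers and finitely many arrays, and every array has cells indexed by all of `ℕ`, which are
addressed indirectly. The arithmetic operations are addition and truncated subtraction; there is no
multiplication. Every constant, register access, array access, arithmetic operation, assignment and
test costs one step. Up to constant factors this is the classical uniform-cost random access machine
with addition and subtraction: the finitely many registers and arrays can be interleaved in one
memory, and `if` and `while` are conditional jumps. -/

namespace RAM

/-- A memory state: the registers, and for every array name the cells of that array. -/
@[ext]
structure State where
  reg : ℕ → ℕ
  mem : ℕ → ℕ → ℕ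

namespace State

/-- Overwrite register `i` with `x`. -/
def setReg (s : State) (i x : ℕ) : State where
  reg := Function.update s.reg i x
  mem := s.mem

/-- Overwrite cell `j` of array `a` with `x`. -/
def setMem (s : State) (a j x : ℕ) : State where
  reg := s.reg
  mem := Function.update s.mem a (Function.update (s.mem a) j x)

end State

/-- Arithmetic expressions; in `read a e` the array name `a` is fixed by the program, and the index
is the value of `e`. -/
inductive Expr where
  | lit (c : ℕ)
  | reg (i : ℕ)
  | read (a : ℕ) (e : Expr)
  | add (e₁ e₂ : Expr)
  | sub (e₁ e₂ : Expr)

namespace Expr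

/-- The value of an expression in a state. -/
def eval (s : State) : Expr → ℕ
  | lit c => c
  | reg i => s.reg i
  | read a e => s.mem a (e.eval s)
  | add e₁ e₂ => e₁.eval s + e₂.eval s
  | sub e₁ e₂ => e₁.eval s - e₂.eval s

/-- The number of steps needed to evaluate an expression: one for each node. -/
def cost : Expr → ℕ
  | lit _ => 1
  | reg _ => 1
  | read _ e => e.cost + 1
  | add e₁ e₂ => e₁.cost + e₂.cost + 1
  | sub e₁ e₂ => e₁.cost + e₂.cost + 1

end Expr

/-- Programs. The tests of `ite` and `loop` are of the form `e₁ < e₂`. -/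
inductive Prog where
  | skip
  | assign (i : ℕ) (e : Expr)
  | write (a : ℕ) (e₁ e₂ : Expr)
  | seq (p q : Prog)
  | ite (e₁ e₂ : Expr) (p q : Prog)
  | loop (e₁ e₂ : Expr) (p : Prog)

/-- `Exec p s t s'`: started in the state `s`, the program `p` halts after exactly `t` steps in the
state `s'`. -/
inductive Exec : Prog → State → ℕ → State → Prop where
  | skip (s : State) : Exec Prog.skip s 1 s
  | assign (i : ℕ) (e : Expr) (s : State) :
      Exec (Prog.assign i e) s (e.cost + 1) (s.setReg i (e.eval s))
  | write (a : ℕ) (e₁ e₂ : Expr) (s : State) :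
      Exec (Prog.write a e₁ e₂) s (e₁.cost + e₂.cost + 1) (s.setMem a (e₁.eval s) (e₂.eval s))
  | seq {p q : Prog} {s s' s'' : State} {t t' : ℕ} :
      Exec p s t s' → Exec q s' t' s'' → Exec (Prog.seq p q) s (t + t') s''
  | ite_true {e₁ e₂ : Expr} {p q : Prog} {s s' : State} {t : ℕ} :
      e₁.eval s < e₂.eval s → Exec p s t s' →
        Exec (Prog.ite e₁ e₂ p q) s (e₁.cost + e₂.cost + 1 + t) s'
  | ite_false {e₁ e₂ : Expr} {p q : Prog} {s s' : State} {t : ℕ} :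
      ¬ e₁.eval s < e₂.eval s → Exec q s t s' →
        Exec (Prog.ite e₁ e₂ p q) s (e₁.cost + e₂.cost + 1 + t) s'
  | loop_true {e₁ e₂ : Expr} {p : Prog} {s s' s'' : State} {t t' : ℕ} :
      e₁.eval s < e₂.eval s → Exec p s t s' → Exec (Prog.loop e₁ e₂ p) s' t' s'' →
        Exec (Prog.loop e₁ e₂ p) s (e₁.cost + e₂.cost + 1 + t + t') s''
  | loop_false {e₁ e₂ : Expr} {p : Prog} {s : State} :
      ¬ e₁.eval s < e₂.eval s → Exec (Prog.loop e₁ e₂ p) s (e₁.cost + e₂.cost + 1) s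

/-- The machine is deterministic: the final state and the number of steps of a halting run are
determined by the program and the initial state. -/
theorem Exec.deterministic {p : Prog} {s s₁ s₂ : State} {t₁ t₂ : ℕ}
    (h₁ : Exec p s t₁ s₁) (h₂ : Exec p s t₂ s₂) : t₁ = t₂ ∧ s₁ = s₂ := by
  induction h₁ generalizing t₂ s₂ with
  | skip => cases h₂; exact ⟨rfl, rfl⟩
  | assign => cases h₂; exact ⟨rfl, rfl⟩
  | write => cases h₂; exact ⟨rfl, rfl⟩
  | seq _ _ ih ih' =>
    cases h₂ with
    | seq k k' =>
      obtain ⟨rfl, rfl⟩ := ih k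
      obtain ⟨rfl, rfl⟩ := ih' k'
      exact ⟨rfl, rfl⟩
  | ite_true c _ ih =>
    cases h₂ with
    | ite_true _ k =>
      obtain ⟨rfl, rfl⟩ := ih k
      exact ⟨rfl, rfl⟩
    | ite_false c' _ => exact absurd c c'
  | ite_false c _ ih =>
    cases h₂ with
    | ite_true c' _ => exact absurd c' c
    | ite_false _ k =>
      obtain ⟨rfl, rfl⟩ := ih k
      exact ⟨rfl, rfl⟩
  | loop_true c _ _ ih ih' =>
    cases h₂ with
    | loop_true _ k k' =>
      obtain ⟨rfl, rfl⟩ := ih k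
      obtain ⟨rfl, rfl⟩ := ih' k'
      exact ⟨rfl, rfl⟩
    | loop_false c' => exact absurd c c'
  | loop_false c =>
    cases h₂ with
    | loop_true c' _ _ => exact absurd c' c
    | loop_false _ => exact ⟨rfl, rfl⟩

end RAM

/-! ### Maximum rainbow matchings

An edge coloring of `G` with natural numbers as colors is a `φ : G.EdgeLabeling ℕ`, that is, a
function `G.edgeSet → ℕ`; it need not be proper. -/

namespace RainbowMatching

/-- A rainbow matching: a matching of `G` whose edges have pairwise distinct colors. -/
def IsRainbowMatching {V : Type*} {G : SimpleGraph V} (φ : G.EdgeLabeling ℕ)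
    (M : G.Subgraph) : Prop :=
  M.IsMatching ∧
    ∀ e f : G.edgeSet, (e : Sym2 V) ∈ M.edgeSet → (f : Sym2 V) ∈ M.edgeSet → φ e = φ f → e = f

/-- A rainbow matching with the largest possible number of edges. -/
def IsMaxRainbowMatching {V : Type*} {G : SimpleGraph V} (φ : G.EdgeLabeling ℕ)
    (M : G.Subgraph) : Prop :=
  IsRainbowMatching φ M ∧
    ∀ M' : G.Subgraph, IsRainbowMatching φ M' → M'.edgeSet.ncard ≤ M.edgeSet.ncard

/-- A listing of the edges of a graph on `{0, …, n - 1}`: every edge occurs exactly once, in an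
arbitrary order, and is given by its two ends, in either order. -/
structure EdgeList {n : ℕ} (G : SimpleGraph (Fin n)) where
  m : ℕ
  edge : Fin m ≃ G.edgeSet
  src : Fin m → Fin n
  dst : Fin m → Fin n
  edge_eq : ∀ i, (edge i : Sym2 (Fin n)) = s(src i, dst i)

/-- The initial memory: the number of vertices in register `0`, the number of edges in register `1`,
and, for the `i`-th edge, its ends in cell `i` of the arrays `0` and `1` and its color in cell `i` of
the array `2`. All other cells contain `0`. -/
def input {n : ℕ} {G : SimpleGraph (Fin n)} (φ : G.EdgeLabeling ℕ) (L : EdgeList G) :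
    RAM.State where
  reg j := if j = 0 then n else if j = 1 then L.m else 0
  mem a i :=
    if h : i < L.m then
      if a = 0 then (L.src ⟨i, h⟩ : ℕ)
      else if a = 1 then (L.dst ⟨i, h⟩ : ℕ)
      else if a = 2 then φ (L.edge ⟨i, h⟩)
      else 0
    else 0

/-- The set of edges that a final memory describes: the `i`-th edge belongs to it if and only if
cell `i` of the array `3` is nonzero. -/
def output {n : ℕ} {G : SimpleGraph (Fin n)} (L : EdgeList G) (s : RAM.State) :
    Set (Sym2 (Fin n)) :=
  {e | ∃ i : Fin L.m, s.mem 3 i ≠ 0 ∧ e = L.edge i}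

/-- On the edge-colored graph `(G, φ)`, given by the edge list `L`, the program `p` halts after at
most `b` steps and outputs a largest rainbow matching. -/
def SolvesWithin (p : RAM.Prog) {n : ℕ} {G : SimpleGraph (Fin n)} (φ : G.EdgeLabeling ℕ)
    (L : EdgeList G) (b : ℝ) : Prop :=
  ∃ (t : ℕ) (s : RAM.State) (M : G.Subgraph),
    RAM.Exec p (input φ L) t s ∧ (t : ℝ) ≤ b ∧
      IsMaxRainbowMatching φ M ∧ M.edgeSet = output L s

end RainbowMatching

/-! ### Total correctness of programs with a time bound -/

namespace RAM

/-! Call an edge pendant if one of its ends has degree less than two, and inner otherwise. A pendant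
edge meets other edges in at most one vertex, and that vertex is made its owner. Pendant edges
therefore form a rainbow matching as soon as no two share an owner or a color, i.e. if they form a
matching in a bipartite graph between owners and colors. Once the inner edges are chosen, their ends
and colors are blocked, and the best completion is a maximum bipartite matching, found by augmenting
paths. The program enumerates the choices of inner edges and keeps the best result. This is correct
on every graph (`solvesWithin_main`); the forest structure only bounds the time.

The enumeration is short because of where the owners of inner edges lie. An inner edge is given to
an end with two nonleaf neighbors if there is one; otherwise it is the only inner edge of its tree.
Two vertices with two nonleaf neighbors each, at distance at least two, would give a path on seven
vertices, by adding two edges at both ends of the path between them. So the owners in a component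
are pairwise adjacent, and as a forest has no triangle there are at most two (`card_ownersIn_le`).
With at most one inner edge per owner, a component of order `o` has at most `((o + 1) / 2) ^ 2`
choices by AM-GM (`four_mul_choicesIn_le`).

A choice is cheap because its matching is not computed afresh. A maximum matching with nothing
blocked is found once; `s` chosen edges destroy at most `3 * s` of its edges
(`Matching.size_le_restrict`), so at most `3 * s` augmentations of linear cost restore the optimum
(`runs_maximize`).

It remains to bound a product over the components, whose orders add up to `n`. The number of owners
is absorbed into a slightly larger factor, `weight` (`prod_add_one_mul_le`). With `x = n / k ≥ 2`,
the logarithm of `weight` lies below a line which has height `log (x ^ 2 / 2)` at `x`, so the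
product is at most `(x ^ 2 / 2) ^ k` (`exists_weight_le`, `prod_weight_le_pow`). -/

@[simp] theorem State.setReg_reg (s : State) (i x j : ℕ) :
    (s.setReg i x).reg j = if j = i then x else s.reg j := by
  simp [State.setReg, Function.update_apply]

@[simp] theorem State.setReg_mem (s : State) (i x a : ℕ) : (s.setReg i x).mem a = s.mem a := rfl

@[simp] theorem State.setMem_reg (s : State) (a j x : ℕ) : (s.setMem a j x).reg = s.reg := rfl

theorem State.setMem_mem (s : State) (a j x b : ℕ) :
    (s.setMem a j x).mem b = if b = a then Function.update (s.mem a) j x else s.mem b := by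
  simp [State.setMem, Function.update_apply]

@[simp] theorem State.setMem_mem_apply (s : State) (a j x b y : ℕ) :
    (s.setMem a j x).mem b y = if b = a ∧ y = j then x else s.mem b y := by
  by_cases h : b = a
  · subst h; simp [State.setMem, Function.update_apply]
  · simp [State.setMem, h]

namespace Prog

/-- Does the program assign to register `r`? -/
def setsReg : Prog → ℕ → Bool
  | skip, _ => false
  -- A Boolean computation: that a concrete program leaves a register or an array alone is then
  -- proved by `rfl`.
  | assign i _, r => Nat.beq i r
  | write _ _ _, _ => false
  | seq p q, r => p.setsReg r || q.setsReg r
  | ite _ _ p q, r => p.setsReg r || q.setsReg r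
  | loop _ _ p, r => p.setsReg r

/-- Does the program write to array `a`? -/
def setsMem : Prog → ℕ → Bool
  | skip, _ => false
  | assign _ _, _ => false
  | write b _ _, a => Nat.beq b a
  | seq p q, a => p.setsMem a || q.setsMem a
  | ite _ _ p q, a => p.setsMem a || q.setsMem a
  | loop _ _ p, a => p.setsMem a

/-- Programs without loops. -/
def straight : Prog → Bool
  | skip => true
  | assign _ _ => true
  | write _ _ _ => true
  | seq p q => p.straight && q.straight
  | ite _ _ p q => p.straight && q.straight
  | loop _ _ _ => false

/-- The final state of a program without loops. -/
def run : Prog → State → State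
  | skip, s => s
  | assign i e, s => s.setReg i (e.eval s)
  | write a e₁ e₂, s => s.setMem a (e₁.eval s) (e₂.eval s)
  | seq p q, s => q.run (p.run s)
  | ite e₁ e₂ p q, s => if e₁.eval s < e₂.eval s then p.run s else q.run s
  | loop _ _ _, s => s

/-- A bound for the number of steps of a program without loops. -/
def time : Prog → ℕ
  | skip => 1
  | assign _ e => e.cost + 1
  | write _ e₁ e₂ => e₁.cost + e₂.cost + 1
  | seq p q => p.time + q.time
  -- The sum over both branches is a crude but convenient bound. The value for loops is a dummy,
  -- excluded by `straight`.
  | ite e₁ e₂ p q => e₁.cost + e₂.cost + 1 + (p.time + q.time)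
  | loop _ _ _ => 0

end Prog

/-- `s'` agrees with `s` on all registers and arrays to which `p` does not write. -/
structure Frame (p : Prog) (s s' : State) : Prop where
  reg : ∀ r, p.setsReg r = false → s'.reg r = s.reg r
  mem : ∀ a, p.setsMem a = false → s'.mem a = s.mem a

theorem Frame.refl (p : Prog) (s : State) : Frame p s s := ⟨fun _ _ => rfl, fun _ _ => rfl⟩

theorem Frame.trans {p : Prog} {s s' s'' : State} (h : Frame p s s') (h' : Frame p s' s'') :
    Frame p s s'' :=
  ⟨fun r hr => (h'.reg r hr).trans (h.reg r hr), fun a ha => (h'.mem a ha).trans (h.mem a ha)⟩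

theorem Exec.frame {p : Prog} {s s' : State} {t : ℕ} (h : Exec p s t s') : Frame p s s' := by
  induction h with
  | skip => exact Frame.refl _ _
  | assign i e s =>
    refine ⟨fun r hr => ?_, fun _ _ => rfl⟩
    have : r ≠ i := by rintro rfl; simp [Prog.setsReg] at hr
    simp [this]
  | write a e₁ e₂ s =>
    refine ⟨fun _ _ => rfl, fun b hb => ?_⟩
    have : b ≠ a := by rintro rfl; simp [Prog.setsMem] at hb
    simp [State.setMem, this]
  | seq _ _ ih ih' =>
    refine ⟨fun r hr => ?_, fun a ha => ?_⟩
    · simp only [Prog.setsReg, Bool.or_eq_false_iff] at hr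
      exact (ih'.reg r hr.2).trans (ih.reg r hr.1)
    · simp only [Prog.setsMem, Bool.or_eq_false_iff] at ha
      exact (ih'.mem a ha.2).trans (ih.mem a ha.1)
  | ite_true _ _ ih =>
    refine ⟨fun r hr => ?_, fun a ha => ?_⟩
    · simp only [Prog.setsReg, Bool.or_eq_false_iff] at hr
      exact ih.reg r hr.1
    · simp only [Prog.setsMem, Bool.or_eq_false_iff] at ha
      exact ih.mem a ha.1
  | ite_false _ _ ih =>
    refine ⟨fun r hr => ?_, fun a ha => ?_⟩
    · simp only [Prog.setsReg, Bool.or_eq_false_iff] at hr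
      exact ih.reg r hr.2
    · simp only [Prog.setsMem, Bool.or_eq_false_iff] at ha
      exact ih.mem a ha.2
  | loop_true _ _ _ ih ih' =>
    exact ⟨fun r hr => (ih'.reg r hr).trans (ih.reg r hr),
      fun a ha => (ih'.mem a ha).trans (ih.mem a ha)⟩
  | loop_false => exact Frame.refl _ _

/-- Started in `s`, the program `p` halts after at most `T` steps in a state satisfying `Q`. -/
def Runs (p : Prog) (s : State) (T : ℕ) (Q : State → Prop) : Prop :=
  ∃ t s', Exec p s t s' ∧ t ≤ T ∧ Q s'

theorem Runs.mono {p : Prog} {s : State} {T T' : ℕ} {Q Q' : State → Prop} (h : Runs p s T Q)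
    (hT : T ≤ T') (hQ : ∀ s', Q s' → Frame p s s' → Q' s') : Runs p s T' Q' := by
  obtain ⟨t, s', he, ht, hq⟩ := h
  exact ⟨t, s', he, ht.trans hT, hQ s' hq he.frame⟩

theorem Runs.seq {p q : Prog} {s : State} {T T₁ T₂ : ℕ} {R Q : State → Prop} (hp : Runs p s T₁ R)
    (hq : ∀ s', R s' → Frame p s s' → Runs q s' T₂ Q) (hT : T₁ + T₂ ≤ T) :
    Runs (Prog.seq p q) s T Q := by
  obtain ⟨t, s', he, ht, hr⟩ := hp
  obtain ⟨t', s'', he', ht', hq'⟩ := hq s' hr he.frame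
  exact ⟨t + t', s'', he.seq he', by omega, hq'⟩

theorem Runs.ite {e₁ e₂ : Expr} {p q : Prog} {s : State} {T T' : ℕ} {Q : State → Prop}
    (hp : e₁.eval s < e₂.eval s → Runs p s T Q) (hq : ¬ e₁.eval s < e₂.eval s → Runs q s T Q)
    (hT : e₁.cost + e₂.cost + 1 + T ≤ T') : Runs (Prog.ite e₁ e₂ p q) s T' Q := by
  by_cases h : e₁.eval s < e₂.eval s
  · obtain ⟨t, s', he, ht, hq⟩ := hp h
    exact ⟨_, s', .ite_true h he, by omega, hq⟩
  · obtain ⟨t, s', he, ht, hq⟩ := hq h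
    exact ⟨_, s', .ite_false h he, by omega, hq⟩

theorem Prog.exec_run {p : Prog} (h : p.straight = true) (s : State) :
    ∃ t ≤ p.time, Exec p s t (p.run s) := by
  induction p generalizing s with
  | skip => exact ⟨1, le_rfl, .skip s⟩
  | assign i e => exact ⟨_, le_rfl, .assign i e s⟩
  | write a e₁ e₂ => exact ⟨_, le_rfl, .write a e₁ e₂ s⟩
  | seq p q ihp ihq =>
    simp only [Prog.straight, Bool.and_eq_true] at h
    obtain ⟨t, ht, he⟩ := ihp h.1 s
    obtain ⟨t', ht', he'⟩ := ihq h.2 (p.run s)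
    exact ⟨t + t', add_le_add ht ht', he.seq he'⟩
  | ite e₁ e₂ p q ihp ihq =>
    simp only [Prog.straight, Bool.and_eq_true] at h
    by_cases hc : e₁.eval s < e₂.eval s
    · obtain ⟨t, ht, he⟩ := ihp h.1 s
      refine ⟨_, ?_, by simpa only [Prog.run, if_pos hc] using Exec.ite_true hc he⟩
      simp only [Prog.time]; omega
    · obtain ⟨t, ht, he⟩ := ihq h.2 s
      refine ⟨_, ?_, by simpa only [Prog.run, if_neg hc] using Exec.ite_false hc he⟩
      simp only [Prog.time]; omega
  | loop => simp [Prog.straight] at h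

/-- Loop-free code is verified by evaluation: the postcondition becomes a computation with `run`,
and the time bound a comparison of numerals. -/
theorem Runs.of_straight {p : Prog} {s : State} {T : ℕ} {Q : State → Prop}
    (h : p.straight = true) (hT : p.time ≤ T) (hQ : Q (p.run s)) : Runs p s T Q := by
  obtain ⟨t, ht, he⟩ := p.exec_run h s
  exact ⟨t, _, he, ht.trans hT, hQ⟩

/-- The rule for loops: every round takes at most `T` steps and decreases the measure `μ`. -/
theorem Runs.loop {e₁ e₂ : Expr} {p : Prog} (s₀ : State) (Inv : State → Prop) (μ : State → ℕ)
    (T : ℕ)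
    (hstep : ∀ s, Frame p s₀ s → Inv s → e₁.eval s < e₂.eval s →
      Runs p s T fun s' => Inv s' ∧ μ s' < μ s)
    (h₀ : Inv s₀) :
    Runs (Prog.loop e₁ e₂ p) s₀ (μ s₀ * (T + (e₁.cost + e₂.cost + 1)) + (e₁.cost + e₂.cost + 1))
      fun s => Inv s ∧ ¬ e₁.eval s < e₂.eval s := by
  -- Induction on a bound for the measure. The frame relative to `s₀` is carried along, so that
  -- invariants need not mention what the body never writes.
  suffices H : ∀ k s, μ s ≤ k → Frame p s₀ s → Inv s →
      Runs (Prog.loop e₁ e₂ p) s (k * (T + (e₁.cost + e₂.cost + 1)) + (e₁.cost + e₂.cost + 1))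
        fun s => Inv s ∧ ¬ e₁.eval s < e₂.eval s from H _ _ le_rfl (Frame.refl _ _) h₀
  intro k
  induction k with
  | zero =>
    intro s hμ hf hs
    by_cases hc : e₁.eval s < e₂.eval s
    · obtain ⟨t, s', he, ht, hs', hlt⟩ := hstep s hf hs hc
      omega
    · exact ⟨_, s, .loop_false hc, by omega, hs, hc⟩
  | succ k ih =>
    intro s hμ hf hs
    by_cases hc : e₁.eval s < e₂.eval s
    · obtain ⟨t, s', he, ht, hs', hlt⟩ := hstep s hf hs hc
      obtain ⟨t', s'', he', ht', hs''⟩ := ih s' (by omega) (hf.trans he.frame) hs'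
      refine ⟨_, s'', .loop_true hc he he', ?_, hs''⟩
      rw [add_mul]
      omega
    · exact ⟨_, s, .loop_false hc, by omega, hs, hc⟩

/-- `for i < b do body`, where `i` and `b` are registers. -/
def Prog.forLoop (i b : ℕ) (body : Prog) : Prog :=
  .seq (.assign i (.lit 0))
    (.loop (.reg i) (.reg b) (.seq body (.assign i (.add (.reg i) (.lit 1)))))

/-- The rule for counting loops. -/
theorem Runs.forLoop {i b : ℕ} {body : Prog} (s₀ : State) (Inv : ℕ → State → Prop) (T : ℕ)
    (hi : body.setsReg i = false) (hb : body.setsReg b = false) (hib : i ≠ b)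
    (h₀ : Inv 0 (s₀.setReg i 0))
    (hstep : ∀ k s, k < s₀.reg b → s.reg i = k → Frame (Prog.forLoop i b body) s₀ s → Inv k s →
      Runs body s T fun s' => Frame body s s' → Inv (k + 1) (s'.setReg i (k + 1))) :
    Runs (Prog.forLoop i b body) s₀ (s₀.reg b * (T + 7) + 5) fun s => Inv (s₀.reg b) s := by
  have hsetb : (Prog.forLoop i b body).setsReg b = false := by
    have : Nat.beq i b = false := by rw [← Bool.not_eq_true]; simpa [Nat.beq_eq] using hib
    simp [Prog.forLoop, Prog.setsReg, hb, this]
  have hfr : Frame (Prog.forLoop i b body) s₀ (s₀.setReg i 0) := by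
    refine ⟨fun r hr => ?_, fun _ _ => rfl⟩
    have : r ≠ i := by rintro rfl; simp [Prog.forLoop, Prog.setsReg] at hr
    simp [this]
  -- The increment costs 4 steps and a test 3, so a round takes `T + 7`; the initial assignment (2)
  -- and the failing test (3) give the final 5.
  have key := Runs.loop (e₁ := .reg i) (e₂ := .reg b)
    (p := .seq body (.assign i (.add (.reg i) (.lit 1)))) (s₀.setReg i 0)
    (fun s => s.reg i ≤ s₀.reg b ∧ Inv (s.reg i) s) (fun s => s₀.reg b - s.reg i) (T + 4) ?_ ?_
  · refine Runs.seq (T₁ := 2) (R := fun s => s = s₀.setReg i 0) ⟨_, _, .assign i _ s₀, le_rfl, rfl⟩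
      (fun s' hs' _ => ?_) (T₂ := s₀.reg b * (T + 7) + 3) (by omega)
    subst hs'
    obtain ⟨t, s', he, ht, hs', hc⟩ := key
    refine ⟨t, s', he, ?_, ?_⟩
    · simpa [Expr.cost] using ht
    · have : s'.reg b = s₀.reg b := by
        rw [he.frame.reg b (by simpa [Prog.forLoop, Prog.setsReg, hb] using hsetb)]
        simp [hib.symm]
      simp only [Expr.eval, this] at hc
      have : s'.reg i = s₀.reg b := by omega
      rw [← this]
      exact hs'.2
  · rintro s hf ⟨hle, hs⟩ hc
    have hf' : Frame (Prog.forLoop i b body) s₀ s := by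
      refine hfr.trans ⟨fun r hr => hf.reg r ?_, fun a ha => hf.mem a ?_⟩
      · simp only [Prog.forLoop, Prog.setsReg, Bool.or_eq_false_iff] at hr ⊢
        exact hr.2
      · simpa [Prog.forLoop, Prog.setsMem] using ha
    have hbs : s.reg b = s₀.reg b := hf'.reg b hsetb
    simp only [Expr.eval, hbs] at hc
    refine Runs.seq (R := fun s' => Inv (s.reg i + 1) (s'.setReg i (s.reg i + 1)))
      ((hstep _ s hc rfl hf' hs).mono le_rfl fun s' h hfr => h hfr) (fun s' hs' hfs => ?_)
      (T₂ := 4) le_rfl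
    refine ⟨_, _, .assign i _ s', le_rfl, ?_⟩
    have : s'.reg i = s.reg i := hfs.reg i hi
    simp only [Expr.eval, this, State.setReg_reg, if_true]
    exact ⟨⟨hc, hs'⟩, by omega⟩
  · simpa using h₀

end RAM

/-! ### The algorithm

A *pendant* edge has an end of degree less than two, the other edges are *inner*. Every edge is
owned by one of its ends. A rainbow matching consists of inner edges, at most one for every owner,
and of pendant edges, which form a matching between owners and colors. The algorithm runs through
all choices of at most one inner edge per owner, and completes every admissible choice by augmenting
paths.

Edges are represented by the numbers `1, …, m`, and `0` stands for "none".

| array | contents |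
|---|---|
| `4`, `5` | degree of a vertex, number of inner edges at a vertex |
| `6`, `7`, `8` | owner, other end and color of an edge |
| `9`, `10` | last inner and last pendant edge owned by a vertex |
| `11` | previous edge of the same kind with the same owner |
| `12` | chosen inner edge of an owner |
| `13`, `16` | pendant edge matched to an owner, the same for the initial matching |
| `14`, `15` | is a vertex, is a color blocked by the chosen inner edges? |
| `17` | pendant edge matched to a color |
| `18`, `19`, `20` | queue, is a vertex in the queue, edge through which it was reached |
-/

namespace RainbowMatching

open RAM RAM.Expr RAM.Prog

infixr:30 " ;; " => RAM.Prog.seq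

namespace Algorithm

def degrees : Prog := forLoop 2 1
  (write 4 (read 0 (reg 2)) (add (read 4 (read 0 (reg 2))) (lit 1)) ;;
    write 4 (read 1 (reg 2)) (add (read 4 (read 1 (reg 2))) (lit 1)))

def innerDegrees : Prog := forLoop 2 1
  (ite (lit 1) (read 4 (read 0 (reg 2)))
    (ite (lit 1) (read 4 (read 1 (reg 2)))
      (write 5 (read 0 (reg 2)) (add (read 5 (read 0 (reg 2))) (lit 1)) ;;
        write 5 (read 1 (reg 2)) (add (read 5 (read 1 (reg 2))) (lit 1)))
      skip)
    skip)

/-- An inner edge goes to its first end unless fewer than two inner edges meet there; a pendant edge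
goes to an end of degree at least two if there is one. The edge is then put in front of one of two
linked lists of its owner, with heads in arrays `9` and `10` and links in array `11`, so these lists
are descending. -/
def ownersBody : Prog :=
  assign 3 (lit 0) ;;
  ite (lit 1) (read 4 (read 0 (reg 2)))
    (ite (lit 1) (read 4 (read 1 (reg 2))) (assign 3 (lit 1)) skip) skip ;;
  assign 4 (read 0 (reg 2)) ;;
  assign 5 (read 1 (reg 2)) ;;
  ite (lit 0) (reg 3)
    (ite (read 5 (read 0 (reg 2))) (lit 2)
      (assign 4 (read 1 (reg 2)) ;; assign 5 (read 0 (reg 2))) skip)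
    (ite (read 4 (read 0 (reg 2))) (lit 2)
      (assign 4 (read 1 (reg 2)) ;; assign 5 (read 0 (reg 2))) skip) ;;
  write 6 (add (reg 2) (lit 1)) (reg 4) ;;
  write 7 (add (reg 2) (lit 1)) (reg 5) ;;
  write 8 (add (reg 2) (lit 1)) (read 2 (reg 2)) ;;
  ite (lit 0) (reg 3)
    (write 11 (add (reg 2) (lit 1)) (read 9 (reg 4)) ;; write 9 (reg 4) (add (reg 2) (lit 1)))
    (write 11 (add (reg 2) (lit 1)) (read 10 (reg 4)) ;; write 10 (reg 4) (add (reg 2) (lit 1)))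

def owners : Prog := forLoop 2 1 ownersBody

/-- Compute array `17` from array `13`. -/
def colorMates : Prog :=
  forLoop 2 1 (write 17 (read 8 (add (reg 2) (lit 1))) (lit 0)) ;;
  forLoop 2 0 (ite (lit 0) (read 13 (reg 2))
    (write 17 (read 8 (read 13 (reg 2))) (read 13 (reg 2))) skip)

/-- Fill the queue with the unmatched vertices that are not blocked. -/
def roots : Prog :=
  assign 4 (lit 0) ;;
  forLoop 2 0
    (write 20 (reg 2) (lit 0) ;;
    ite (lit 0) (add (read 13 (reg 2)) (read 14 (reg 2)))
      (write 19 (reg 2) (lit 0))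
      (write 19 (reg 2) (lit 1) ;; write 18 (reg 4) (reg 2) ;; assign 4 (add (reg 4) (lit 1))))

/-- One step of the search for an augmenting path: if register `5` holds an edge, inspect it,
otherwise take the next vertex from the queue. -/
def searchBody : Prog :=
  ite (reg 5) (lit 1)
    (assign 5 (read 10 (read 18 (reg 3))) ;; assign 3 (add (reg 3) (lit 1)))
    (ite (lit 0) (read 15 (read 8 (reg 5)))
      (assign 5 (read 11 (reg 5)))
      (ite (read 17 (read 8 (reg 5))) (lit 1)
        (assign 6 (reg 5) ;; assign 5 (lit 0) ;; assign 3 (reg 4))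
        (assign 12 (read 6 (read 17 (read 8 (reg 5)))) ;;
        ite (read 19 (reg 12)) (lit 1)
          (write 19 (reg 12) (lit 1) ;; write 20 (reg 12) (reg 5) ;;
            write 18 (reg 4) (reg 12) ;; assign 4 (add (reg 4) (lit 1)))
          skip ;;
        assign 5 (read 11 (reg 5)))))

/-- Registers `3` and `4` are the head and the tail of the queue, `5` is the edge under inspection
and `6` the last edge of an augmenting path. A success empties the queue and clears `5`, which ends
the loop. -/
def search : Prog :=
  assign 3 (lit 0) ;; assign 5 (lit 0) ;; assign 6 (lit 0) ;;
  loop (lit 0) (add (sub (reg 4) (reg 3)) (reg 5)) searchBody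

/-- Exchange the edges along the augmenting path that ends with the edge in register `6`. -/
def exchange : Prog :=
  assign 5 (reg 6) ;;
  loop (lit 0) (reg 5)
    (assign 12 (read 6 (reg 5)) ;; write 13 (reg 12) (reg 5) ;; assign 5 (read 20 (reg 12)))

def augment : Prog := colorMates ;; roots ;; search ;; exchange

/-- After a search, register `6` is nonzero if an augmenting path was found, so it serves as the
loop flag. -/
def maximize : Prog := assign 6 (lit 1) ;; loop (lit 0) (reg 6) augment

/-- Block the ends and the colors of the chosen inner edges; register `7` becomes `0` if they do
not form a rainbow matching. -/
def blockChosen : Prog :=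
  forLoop 2 0 (write 14 (reg 2) (lit 0)) ;;
  forLoop 2 1 (write 15 (read 8 (add (reg 2) (lit 1))) (lit 0)) ;;
  assign 7 (lit 1) ;;
  forLoop 2 0
    (assign 5 (read 12 (reg 2)) ;;
    ite (lit 0) (reg 5)
      (ite (lit 0) (add (read 14 (read 6 (reg 5)))
          (add (read 14 (read 7 (reg 5))) (read 15 (read 8 (reg 5)))))
        (assign 7 (lit 0)) skip ;;
      write 14 (read 6 (reg 5)) (lit 1) ;; write 14 (read 7 (reg 5)) (lit 1) ;;
      write 15 (read 8 (reg 5)) (lit 1))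
      skip)

/-- Restrict the initial matching to the vertices and colors that are not blocked. -/
def restrict : Prog := forLoop 2 0
  (write 13 (reg 2) (lit 0) ;;
  ite (lit 0) (read 16 (reg 2))
    (ite (lit 0) (add (read 14 (reg 2)) (read 15 (read 8 (read 16 (reg 2)))))
      skip (write 13 (reg 2) (read 16 (reg 2))))
    skip)

def countEdges : Prog :=
  assign 8 (lit 0) ;;
  forLoop 2 0
    (ite (lit 0) (read 12 (reg 2)) (assign 8 (add (reg 8) (lit 1))) skip ;;
    ite (lit 0) (read 13 (reg 2)) (assign 8 (add (reg 8) (lit 1))) skip)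

def record : Prog :=
  assign 9 (reg 8) ;;
  forLoop 2 1 (write 3 (reg 2) (lit 0)) ;;
  forLoop 2 0
    (ite (lit 0) (read 12 (reg 2)) (write 3 (sub (read 12 (reg 2)) (lit 1)) (lit 1)) skip ;;
    ite (lit 0) (read 13 (reg 2)) (write 3 (sub (read 13 (reg 2)) (lit 1)) (lit 1)) skip)

/-- Complete the chosen inner edges in the best way, and compare with the best result so far. -/
def consider : Prog :=
  blockChosen ;;
  ite (lit 0) (reg 7)
    (restrict ;; maximize ;; countEdges ;; ite (reg 9) (reg 8) record skip) skip

/-- Go to the next choice of inner edges; register `10` becomes `0` if there is none. -/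
def advance : Prog :=
  -- Register `11` is the carry of an odometer: a zero entry wraps round to the largest edge of its
  -- list and passes the carry on, any other entry moves down its list and stops it.
  assign 11 (lit 1) ;;
  forLoop 2 0
    (ite (lit 0) (reg 11)
      (ite (lit 0) (read 12 (reg 2))
        (assign 11 (lit 0) ;; write 12 (reg 2) (read 11 (read 12 (reg 2))))
        (write 12 (reg 2) (read 9 (reg 2))))
      skip) ;;
  assign 10 (sub (lit 1) (reg 11))

def preprocess : Prog := degrees ;; innerDegrees ;; owners

/-- Array `16` preserves the maximum matching found with nothing blocked, from which the matching of
every choice is restarted. The first choice is the largest one. -/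
def firstChoice : Prog :=
  forLoop 2 0 (write 16 (reg 2) (read 13 (reg 2))) ;;
  forLoop 2 0 (write 12 (reg 2) (read 9 (reg 2))) ;;
  assign 10 (lit 1)

def main : Prog :=
  preprocess ;; maximize ;; firstChoice ;; loop (lit 0) (reg 10) (consider ;; advance)

end Algorithm

/-! ### Instances and partial solutions -/

/-- An instance after preprocessing. The edges are the numbers `1, …, m`. -/
structure Instance where
  n : ℕ
  m : ℕ
  own : ℕ → ℕ
  oth : ℕ → ℕ
  clr : ℕ → ℕ
  inner : ℕ → Prop

namespace Instance

variable (I : Instance)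

/-- `e` is a pendant edge owned by `v`. -/
def PendAt (v e : ℕ) : Prop := ¬ I.inner e ∧ I.own e = v

/-- `e` is an inner edge owned by `v`. -/
def InnerAt (v e : ℕ) : Prop := I.inner e ∧ I.own e = v

/-- `e` is an edge with end `v`. -/
def EndOf (v e : ℕ) : Prop := I.own e = v ∨ I.oth e = v

/-- `own_eq` is the reason why pendant edges are a bipartite problem: a pendant edge meets other
edges only at its owner. -/
structure Valid : Prop where
  own_lt : ∀ e, 1 ≤ e → e ≤ I.m → I.own e < I.n
  oth_lt : ∀ e, 1 ≤ e → e ≤ I.m → I.oth e < I.n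
  own_eq : ∀ e f v, 1 ≤ e → e ≤ I.m → 1 ≤ f → f ≤ I.m → e ≠ f → ¬ I.inner e → I.EndOf v e →
    I.EndOf v f → I.own e = v

open Classical in
/-- The memory holds the instance. -/
structure Loaded (s : State) : Prop where
  reg_n : s.reg 0 = I.n
  reg_m : s.reg 1 = I.m
  own : ∀ e, 1 ≤ e → e ≤ I.m → s.mem 6 e = I.own e
  oth : ∀ e, 1 ≤ e → e ≤ I.m → s.mem 7 e = I.oth e
  clr : ∀ e, 1 ≤ e → e ≤ I.m → s.mem 8 e = I.clr e
  last_inner : ∀ v, s.mem 9 v = Nat.findGreatest (I.InnerAt v) I.m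
  last_pend : ∀ v, s.mem 10 v = Nat.findGreatest (I.PendAt v) I.m
  prev_inner : ∀ e, 1 ≤ e → e ≤ I.m → I.inner e →
    s.mem 11 e = Nat.findGreatest (I.InnerAt (I.own e)) (e - 1)
  prev_pend : ∀ e, 1 ≤ e → e ≤ I.m → ¬ I.inner e →
    s.mem 11 e = Nat.findGreatest (I.PendAt (I.own e)) (e - 1)

variable {I}

/-- Does the program leave the memory cells alone that hold the instance? -/
def _root_.RAM.Prog.keeps (p : Prog) : Bool :=
  !p.setsReg 0 && !p.setsReg 1 && !p.setsMem 6 && !p.setsMem 7 && !p.setsMem 8 && !p.setsMem 9 &&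
    !p.setsMem 10 && !p.setsMem 11

theorem Loaded.frame {s s' : State} (h : I.Loaded s) {p : Prog} (hp : p.keeps = true)
    (hf : Frame p s s') : I.Loaded s' := by
  simp only [RAM.Prog.keeps, Bool.and_eq_true, Bool.not_eq_true'] at hp
  obtain ⟨⟨⟨⟨⟨⟨⟨h0, h1⟩, h6⟩, h7⟩, h8⟩, h9⟩, h10⟩, h11⟩ := hp
  have e0 := hf.reg _ h0
  have e1 := hf.reg _ h1
  have e6 := hf.mem _ h6
  have e7 := hf.mem _ h7
  have e8 := hf.mem _ h8
  have e9 := hf.mem _ h9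
  have e10 := hf.mem _ h10
  have e11 := hf.mem _ h11
  constructor <;> simp only [e0, e1, e6, e7, e8, e9, e10, e11]
  exacts [h.reg_n, h.reg_m, h.own, h.oth, h.clr, h.last_inner, h.last_pend, h.prev_inner,
    h.prev_pend]

variable (I)

/-- `mh` assigns to every owner at most one of its pendant edges, the colors are distinct, and
blocked owners and colors are not used. -/
structure Matching (bh bc mh : ℕ → ℕ) : Prop where
  mem : ∀ v < I.n, mh v ≠ 0 →
    mh v ≤ I.m ∧ I.PendAt v (mh v) ∧ bh v = 0 ∧ bc (I.clr (mh v)) = 0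
  inj : ∀ v < I.n, ∀ w < I.n, mh v ≠ 0 → mh w ≠ 0 → I.clr (mh v) = I.clr (mh w) → v = w

/-- The number of vertices with a nonzero entry. -/
def size (f : ℕ → ℕ) : ℕ := ((Finset.range I.n).filter fun v => f v ≠ 0).card

def Maximum (bh bc mh : ℕ → ℕ) : Prop :=
  I.Matching bh bc mh ∧ ∀ mh', I.Matching bh bc mh' → I.size mh' ≤ I.size mh

/-- `17` holds, for the colors of edges, the edge of `mh` of that color. -/
def ColorMates (mh mc : ℕ → ℕ) : Prop :=
  ∀ e, 1 ≤ e → e ≤ I.m →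
    (mc (I.clr e) = 0 → ∀ w < I.n, mh w ≠ 0 → I.clr (mh w) ≠ I.clr e) ∧
    (mc (I.clr e) ≠ 0 → ∃ w < I.n, mh w = mc (I.clr e) ∧ I.clr (mh w) = I.clr e)

end Instance

end RainbowMatching

/-! ### Augmenting paths: the color table and the roots of the search. -/

namespace RainbowMatching

open RAM RAM.Expr RAM.Prog Algorithm

namespace Instance

variable {I : Instance} {s : State}

/-- Colors are unbounded natural numbers, so array `17` cannot be cleared as a whole in time; only
the cells at colors of edges are reset, and `ColorMates` speaks of no others. -/
theorem runs_colorMates (hs : I.Loaded s) {bh bc : ℕ → ℕ} (hM : I.Matching bh bc (s.mem 13)) :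
    Runs colorMates s (100 * (I.n + I.m + 1)) fun s' => I.ColorMates (s.mem 13) (s'.mem 17) := by
  refine Runs.seq (T₁ := I.m * 20 + 5) (T₂ := I.n * 30 + 5) (R := fun s' =>
    ∀ e, 1 ≤ e → e ≤ I.m → s'.mem 17 (I.clr e) = 0) ?_ (fun s' h₁ hf => ?_) (by omega)
  · refine (Runs.forLoop s (fun k s' => ∀ e, 1 ≤ e → e ≤ k → s'.mem 17 (I.clr e) = 0) 13 rfl rfl
      (by decide) ?_ fun k s₁ hk hi hf hk' => ?_).mono (by rw [hs.reg_m]) fun s' h _ => by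
        rwa [hs.reg_m] at h
    · intro e h1 h0; omega
    · have hl := hs.frame (by rfl) hf
      rw [hs.reg_m] at hk
      refine Runs.of_straight rfl (by decide) ?_
      simp only [Prog.run, Expr.eval, State.setReg_mem, State.setMem_mem_apply]
      intro _ e h1 he
      split_ifs with h
      · rfl
      · refine hk' e h1 ?_
        by_contra hlt
        have : e = k + 1 := by omega
        subst this
        rw [hi, hl.clr _ (by omega) (by omega)] at h
        simp at h
  · have hl' := hs.frame (by rfl) hf
    have h13 : s'.mem 13 = s.mem 13 := hf.mem 13 rfl
    refine (Runs.forLoop s' (fun k s' => ∀ e, 1 ≤ e → e ≤ I.m →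
      (s'.mem 17 (I.clr e) = 0 → ∀ w < k, s.mem 13 w ≠ 0 → I.clr (s.mem 13 w) ≠ I.clr e) ∧
      (s'.mem 17 (I.clr e) ≠ 0 → ∃ w < k, s.mem 13 w = s'.mem 17 (I.clr e) ∧
        I.clr (s.mem 13 w) = I.clr e)) 23 rfl rfl
      (by decide) ?_ fun k s₁ hk hi hf' hk' => ?_).mono (by rw [hl'.reg_n]) fun s' h _ => by
        rwa [hl'.reg_n] at h
    · intro e h1 h2
      simp only [State.setReg_mem, h₁ e h1 h2]
      simp
    · rw [hl'.reg_n] at hk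
      have hl := hl'.frame (by rfl) hf'
      have e13 : s₁.mem 13 = s.mem 13 := (hf'.mem 13 rfl).trans h13
      refine Runs.of_straight rfl (by decide) ?_
      intro _ e h1 h2
      obtain ⟨ha, hb⟩ := hk' e h1 h2
      by_cases h0 : s.mem 13 k = 0
      · simp only [Prog.run, Expr.eval, hi, e13, h0, lt_self_iff_false, if_false,
          State.setReg_mem]
        refine ⟨fun h w hw hw0 => ?_, fun h => ?_⟩
        · exact ha h w (lt_of_le_of_ne (by omega) (by rintro rfl; exact hw0 h0)) hw0
        · obtain ⟨w, hw, hw'⟩ := hb h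
          exact ⟨w, by omega, hw'⟩
      · obtain ⟨hm, hp, -, -⟩ := hM.mem k hk h0
        simp only [Prog.run, Expr.eval, hi, e13, Nat.pos_of_ne_zero h0, if_true,
          State.setReg_mem, State.setMem_mem_apply, true_and,
          hl.clr _ (Nat.pos_of_ne_zero h0) hm]
        split_ifs with hc
        · exact ⟨fun h => absurd h h0, fun _ => ⟨k, by omega, rfl, hc.symm⟩⟩
        · refine ⟨fun h w hw hw0 => ?_, fun h => ?_⟩
          · rcases Nat.lt_succ_iff_lt_or_eq.1 hw with hw | rfl
            · exact ha h w hw hw0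
            · exact fun h => hc h.symm
          · obtain ⟨w, hw, hw'⟩ := hb h
            exact ⟨w, by omega, hw'⟩

/-- The queue after `roots`, or during the search. -/
structure Queue (mh bh q vis via : ℕ → ℕ) (n t : ℕ) : Prop where
  lt : ∀ p < t, q p < n
  marked : ∀ p < t, vis (q p) ≠ 0
  exists_of_marked : ∀ v < n, vis v ≠ 0 → ∃ p < t, q p = v
  inj : ∀ p < t, ∀ p' < t, q p = q p' → p = p'
  root : ∀ v < n, bh v = 0 → mh v = 0 → vis v ≠ 0
  free : ∀ p < t, bh (q p) = 0
  via_root : ∀ p < t, mh (q p) = 0 → via (q p) = 0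

theorem runs_roots (hs : I.Loaded s) :
    Runs roots s (100 * (I.n + I.m + 1)) fun s' =>
      (Queue (s.mem 13) (s.mem 14) (s'.mem 18) (s'.mem 19) (s'.mem 20) I.n (s'.reg 4)) ∧
      ∀ p < s'.reg 4, s.mem 13 (s'.mem 18 p) = 0 := by
  refine Runs.seq (T₁ := 2) (T₂ := I.n * 40 + 5) (R := fun s' => s' = s.setReg 4 0)
    (Runs.of_straight rfl le_rfl rfl) (fun s' h₁ hf => ?_) (by omega)
  have hl' := hs.frame (by rfl) hf
  subst h₁
  refine (Runs.forLoop _ (fun k s' =>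
      (∀ p < s'.reg 4, s'.mem 18 p < k ∧ s'.mem 19 (s'.mem 18 p) ≠ 0 ∧ s.mem 14 (s'.mem 18 p) = 0 ∧
        s.mem 13 (s'.mem 18 p) = 0 ∧ s'.mem 20 (s'.mem 18 p) = 0) ∧
      (∀ v < k, s'.mem 19 v ≠ 0 → ∃ p < s'.reg 4, s'.mem 18 p = v) ∧
      (∀ p < s'.reg 4, ∀ p' < s'.reg 4, s'.mem 18 p = s'.mem 18 p' → p = p') ∧
      (∀ v < k, s.mem 14 v = 0 → s.mem 13 v = 0 → s'.mem 19 v ≠ 0))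
      33 rfl rfl (by decide) ?_ fun k s₁ hk hi hf' hk' => ?_).mono
      (by rw [hl'.reg_n]) fun s' h _ => ?_
  · simp
  · have e13 : s₁.mem 13 = s.mem 13 := hf'.mem 13 rfl
    have e14 : s₁.mem 14 = s.mem 14 := hf'.mem 14 rfl
    refine Runs.of_straight rfl (by decide) ?_
    intro _
    obtain ⟨hA, hB, hC, hD⟩ := hk'
    by_cases h0 : 0 < s.mem 13 k + s.mem 14 k
    · simp [Prog.run, Expr.eval, hi, e13, e14, State.setMem_mem_apply, h0]
      refine ⟨fun p hp => ?_, fun v hv h => ?_, hC, fun v hv h1 h2 => ?_⟩ <;> grind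
    · simp [Prog.run, Expr.eval, hi, e13, e14, State.setMem_mem_apply, h0]
      refine ⟨fun p hp => ?_, fun v hv h => ?_, fun p hp p' hp' => ?_, fun v hv h1 h2 => ?_⟩
      · grind
      · rcases Nat.lt_or_eq_of_le hv with hv | rfl
        · rw [if_neg hv.ne] at h
          obtain ⟨p, hp, hp'⟩ := hB v hv h
          exact ⟨p, by omega, by rw [if_neg hp.ne, hp']⟩
        · exact ⟨s₁.reg 4, le_rfl, by simp⟩
      · grind
      · grind
  · rw [hl'.reg_n] at h
    obtain ⟨hA, hB, hC, hD⟩ := h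
    exact ⟨⟨fun p hp => (hA p hp).1, fun p hp => (hA p hp).2.1, hB, hC, hD,
      fun p hp => (hA p hp).2.2.1, fun p hp _ => (hA p hp).2.2.2.2⟩, fun p hp => (hA p hp).2.2.2.1⟩

end Instance
end RainbowMatching

/-! ### Augmenting paths: invariant of the search and certificate of maximality. -/

namespace RainbowMatching

open RAM RAM.Expr RAM.Prog Algorithm

namespace Instance

variable {I : Instance} {s : State}

theorem Queue.le {mh bh q vis via : ℕ → ℕ} {n t : ℕ} (h : Queue mh bh q vis via n t) : t ≤ n := by
  have := Finset.card_le_card_of_injOn (s := Finset.range t) (t := Finset.range n) q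
    (fun p hp => by simpa using h.lt p (by simpa using hp))
    (fun p hp p' hp' => h.inj p (by simpa using hp) p' (by simpa using hp'))
  simpa using this

variable (I) in
/-- Every matched vertex in the queue was reached from an earlier one, by an edge whose color is
that of its own matching edge. -/
def Tree (mh q via : ℕ → ℕ) (t : ℕ) : Prop :=
  ∀ p < t, mh (q p) ≠ 0 → via (q p) ≠ 0 ∧ via (q p) ≤ I.m ∧ ¬ I.inner (via (q p)) ∧
    I.clr (via (q p)) = I.clr (mh (q p)) ∧ ∃ p' < p, I.own (via (q p)) = q p'

variable (I) in
/-- A color is explored if it is blocked or if its matching partner is in the queue. -/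
def Explored (mh bc vis : ℕ → ℕ) (c : ℕ) : Prop :=
  bc c ≠ 0 ∨ ∃ w < I.n, vis w ≠ 0 ∧ mh w ≠ 0 ∧ I.clr (mh w) = c

variable (I) in
/-- The state of the search: the vertices before position `h` of the queue have been treated, and
of the last one the edges up to `e` remain. -/
structure Searching (mh bh bc q vis via : ℕ → ℕ) (h t e : ℕ) : Prop where
  queue : Queue mh bh q vis via I.n t
  tree : I.Tree mh q via t
  le : h ≤ t
  explored : ∀ p < h, ∀ f, 1 ≤ f → f ≤ I.m → I.PendAt (q p) f → (p + 1 = h → e < f) →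
    I.Explored mh bc vis (I.clr f)
  cur : e ≠ 0 → e ≤ I.m ∧ ∃ p, p + 1 = h ∧ I.PendAt (q p) e

variable (I) in
/-- The edge `f` completes an augmenting path. -/
structure Found (mh bh bc q vis via : ℕ → ℕ) (t f : ℕ) : Prop where
  queue : Queue mh bh q vis via I.n t
  tree : I.Tree mh q via t
  ne_zero : f ≠ 0
  le : f ≤ I.m
  pend : ¬ I.inner f
  free : bc (I.clr f) = 0
  clr_ne : ∀ w < I.n, mh w ≠ 0 → I.clr (mh w) ≠ I.clr f
  own : ∃ p < t, I.own f = q p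

open Classical in
variable (I) in
/-- The edges that are still to be inspected. -/
noncomputable def unseen (q : ℕ → ℕ) (h e : ℕ) : Finset ℕ :=
  (Finset.Icc 1 I.m).filter fun f => ¬ I.inner f ∧
    ((∀ p < h, I.own f ≠ q p) ∨ ∃ p, p + 1 = h ∧ I.own f = q p ∧ f ≤ e)

variable {mh bh bc q vis via : ℕ → ℕ} {h t e : ℕ}

open Classical in
-- The vertex taken from the queue may own no pendant edge, so the unseen edges need not decrease;
-- the progress is the moving head, which `searchMeasure` counts separately.
theorem Searching.pop (hS : I.Searching mh bh bc q vis via h t 0) (ht : h < t) :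
    I.Searching mh bh bc q vis via (h + 1) t (Nat.findGreatest (I.PendAt (q h)) I.m) ∧
    I.unseen q (h + 1) (Nat.findGreatest (I.PendAt (q h)) I.m) ⊆ I.unseen q h 0 := by
  refine ⟨⟨hS.queue, hS.tree, ht, fun p hp f hf1 hfm hpf hlt => ?_, fun h0 => ?_⟩, fun f hf => ?_⟩
  · rcases Nat.lt_succ_iff_lt_or_eq.1 hp with hp | rfl
    · exact hS.explored p hp f hf1 hfm hpf fun _ => by omega
    · exact absurd hpf (Nat.findGreatest_is_greatest (hlt rfl) hfm)
  · exact ⟨Nat.findGreatest_le _, h, rfl, Nat.findGreatest_of_ne_zero rfl h0⟩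
  · simp only [unseen, Finset.mem_filter, Finset.mem_Icc] at hf ⊢
    refine ⟨hf.1, hf.2.1, Or.inl ?_⟩
    rcases hf.2.2 with h' | ⟨p, hp, hp', -⟩
    · exact fun p hp => h' p (by omega)
    · have : p = h := by omega
      subst this
      intro p' hp'' he
      have := hS.queue.inj p' (by omega) p ht (he.symm.trans hp')
      omega

open Classical in
theorem Searching.skip (hS : I.Searching mh bh bc q vis via h t e) (he : e ≠ 0)
    (hx : I.Explored mh bc vis (I.clr e)) :
    I.Searching mh bh bc q vis via h t (Nat.findGreatest (I.PendAt (I.own e)) (e - 1)) ∧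
    I.unseen q h (Nat.findGreatest (I.PendAt (I.own e)) (e - 1)) ⊂ I.unseen q h e := by
  obtain ⟨hem, p₀, hp₀, hpe⟩ := hS.cur he
  have hlt : Nat.findGreatest (I.PendAt (I.own e)) (e - 1) ≤ e - 1 := Nat.findGreatest_le _
  refine ⟨⟨hS.queue, hS.tree, hS.le, fun p hp f hf1 hfm hpf hlt' => ?_, fun h0 => ?_⟩, ?_⟩
  · by_cases hpp : p = p₀
    · subst hpp
      rcases lt_trichotomy f e with hfe | rfl | hfe
      · refine absurd ?_ (Nat.findGreatest_is_greatest (hlt' hp₀) (by omega : f ≤ e - 1))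
        rwa [hpe.2]
      · exact hx
      · exact hS.explored p hp f hf1 hfm hpf fun _ => hfe
    · exact hS.explored p hp f hf1 hfm hpf fun h' => absurd (by omega) hpp
  · refine ⟨by omega, p₀, hp₀, ?_⟩
    rw [← hpe.2]
    exact Nat.findGreatest_of_ne_zero rfl h0
  · rw [Finset.ssubset_iff_of_subset]
    · refine ⟨e, ?_, ?_⟩
      · simp only [unseen, Finset.mem_filter, Finset.mem_Icc]
        exact ⟨⟨by omega, hem⟩, hpe.1, Or.inr ⟨p₀, hp₀, hpe.2, le_rfl⟩⟩
      · simp only [unseen, Finset.mem_filter, Finset.mem_Icc]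
        rintro ⟨-, -, h' | ⟨p, -, -, h'⟩⟩
        · exact h' p₀ (by omega) hpe.2
        · omega
    · intro f hf
      simp only [unseen, Finset.mem_filter, Finset.mem_Icc] at hf ⊢
      refine ⟨hf.1, hf.2.1, hf.2.2.imp id ?_⟩
      rintro ⟨p, hp, hp', hle⟩
      exact ⟨p, hp, hp', by omega⟩

/-- The new entry is written at position `t ≥ h`, beyond the treated part of the queue, so it does
not affect the unseen edges. -/
theorem Searching.push (hS : I.Searching mh bh bc q vis via h t e) (he : e ≠ 0) {w : ℕ}
    (hw : w < I.n) (hbw : bh w = 0) (hvis : vis w = 0) (hmw : mh w ≠ 0)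
    (hc : I.clr (mh w) = I.clr e) :
    I.Searching mh bh bc (Function.update q t w) (Function.update vis w 1)
      (Function.update via w e) h (t + 1) e ∧
    I.unseen (Function.update q t w) h e = I.unseen q h e := by
  obtain ⟨hem, p₀, hp₀, hpe⟩ := hS.cur he
  have hq : ∀ p < t, Function.update q t w p = q p := fun p hp => by simp [hp.ne]
  have hqw : ∀ p < t, q p ≠ w := fun p hp h' => hS.queue.marked p hp (h' ▸ hvis)
  have hle := hS.le
  have hQ := hS.queue
  refine ⟨⟨⟨?_, ?_, ?_, ?_, ?_, ?_, ?_⟩, ?_, by omega, ?_, fun _ => ⟨hem, p₀, hp₀, ?_⟩⟩, ?_⟩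
  · intro p hp
    rcases Nat.lt_succ_iff_lt_or_eq.1 hp with hp | rfl
    · rw [hq p hp]; exact hQ.lt p hp
    · simpa
  · intro p hp
    rcases Nat.lt_succ_iff_lt_or_eq.1 hp with hp | rfl
    · rw [hq p hp, Function.update_of_ne (hqw p hp)]; exact hQ.marked p hp
    · simp
  · intro v hv hvv
    by_cases hvw : v = w
    · exact ⟨t, by omega, by simp [hvw]⟩
    · rw [Function.update_of_ne hvw] at hvv
      obtain ⟨p, hp, hp'⟩ := hQ.exists_of_marked v hv hvv
      exact ⟨p, by omega, by rw [hq p hp, hp']⟩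
  · intro p hp p' hp' heq
    rcases Nat.lt_succ_iff_lt_or_eq.1 hp with hp | rfl <;>
    rcases Nat.lt_succ_iff_lt_or_eq.1 hp' with hp' | rfl
    · rw [hq p hp, hq p' hp'] at heq
      exact hQ.inj p hp p' hp' heq
    · rw [hq p hp, Function.update_self] at heq
      exact absurd heq (hqw p hp)
    · rw [hq p' hp', Function.update_self] at heq
      exact absurd heq.symm (hqw p' hp')
    · rfl
  · intro v hv h1 h2
    by_cases hvw : v = w
    · simp [hvw]
    · rw [Function.update_of_ne hvw]; exact hQ.root v hv h1 h2
  · intro p hp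
    rcases Nat.lt_succ_iff_lt_or_eq.1 hp with hp | rfl
    · rw [hq p hp]; exact hQ.free p hp
    · simpa
  · intro p hp h0
    rcases Nat.lt_succ_iff_lt_or_eq.1 hp with hp | rfl
    · rw [hq p hp] at h0 ⊢
      rw [Function.update_of_ne (hqw p hp)]
      exact hQ.via_root p hp h0
    · simp [hmw] at h0
  · intro p hp h0
    rcases Nat.lt_succ_iff_lt_or_eq.1 hp with hp | rfl
    · rw [hq p hp] at h0 ⊢
      rw [Function.update_of_ne (hqw p hp)]
      obtain ⟨h1, h2, h3, h4, p', hp', h5⟩ := hS.tree p hp h0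
      exact ⟨h1, h2, h3, h4, p', hp', by rw [hq p' (by omega), h5]⟩
    · simp only [Function.update_self]
      exact ⟨he, hem, hpe.1, hc.symm, p₀, by omega, by rw [hq p₀ (by omega), hpe.2]⟩
  · intro p hp f hf1 hfm hpf hlt
    rw [hq p (by omega)] at hpf
    refine (hS.explored p hp f hf1 hfm hpf hlt).imp id ?_
    rintro ⟨v, hv, h1, h2, h3⟩
    refine ⟨v, hv, ?_, h2, h3⟩
    by_cases hvw : v = w
    · simp [hvw]
    · rwa [Function.update_of_ne hvw]
  · rw [hq p₀ (by omega)]; exact hpe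
  · ext f
    simp only [unseen, Finset.mem_filter, Finset.mem_Icc]
    refine and_congr_right fun _ => and_congr_right fun _ => or_congr ?_ ?_
    · exact forall₂_congr fun p hp => by rw [hq p (by omega)]
    · exact exists_congr fun p => and_congr_right fun hp => by rw [hq p (by omega)]

/-- If the search ends without success, the matching is maximum. -/
theorem Searching.maximum (hM : I.Matching bh bc mh)
    (hS : I.Searching mh bh bc q vis via t t 0) : I.Maximum bh bc mh := by
  classical
  refine ⟨hM, fun N hN => ?_⟩
  have hex : ∀ v < I.n, vis v ≠ 0 → N v ≠ 0 →
      ∃ w < I.n, vis w ≠ 0 ∧ mh w ≠ 0 ∧ I.clr (mh w) = I.clr (N v) := by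
    intro v hv hvis hNv
    obtain ⟨p, hp, rfl⟩ := hS.queue.exists_of_marked v hv hvis
    obtain ⟨h1, h2, -, h3⟩ := hN.mem _ hv hNv
    exact (hS.explored p hp (N (q p)) (Nat.pos_of_ne_zero hNv) h1 h2
      fun _ => Nat.pos_of_ne_zero hNv).resolve_left (by simpa using h3)
  have hex' : ∀ v, ∃ w, v < I.n → vis v ≠ 0 → N v ≠ 0 →
      w < I.n ∧ vis w ≠ 0 ∧ mh w ≠ 0 ∧ I.clr (mh w) = I.clr (N v) := by
    intro v
    by_cases h' : v < I.n ∧ vis v ≠ 0 ∧ N v ≠ 0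
    · obtain ⟨w, hw, hw'⟩ := hex v h'.1 h'.2.1 h'.2.2
      exact ⟨w, fun _ _ _ => ⟨hw, hw'⟩⟩
    · exact ⟨0, fun h1 h2 h3 => absurd ⟨h1, h2, h3⟩ h'⟩
  choose g hg using hex'
  -- The vertices matched by `N` are injected into those matched by `mh`. An unreached vertex stays:
  -- it is unblocked, and were it unmatched by `mh` it would be a root. A reached vertex goes to the
  -- vertex which `mh` matches to the color of its `N`-edge; this one is reached too, which keeps
  -- the two kinds apart.
  refine Finset.card_le_card_of_injOn (fun v => if vis v = 0 then v else g v) ?_ ?_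
  · intro v hv
    simp only [Finset.coe_filter, Finset.mem_range, Set.mem_ofPred_eq] at hv ⊢
    split_ifs with h0
    · exact ⟨hv.1, fun hm => hS.queue.root v hv.1 (hN.mem v hv.1 hv.2).2.2.1 hm h0⟩
    · obtain ⟨h1, h2, h3, h4⟩ := hg v hv.1 h0 hv.2
      exact ⟨h1, h3⟩
  · intro v hv w hw heq
    simp only [Finset.coe_filter, Finset.mem_range, Set.mem_ofPred_eq] at hv hw heq
    split_ifs at heq with h0 h1 h1
    · exact heq
    · exact absurd h0 (heq ▸ (hg w hw.1 h1 hw.2).2.1)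
    · exact absurd h1 (heq ▸ (hg v hv.1 h0 hv.2).2.1)
    · have hv' := (hg v hv.1 h0 hv.2).2.2.2
      have hw' := (hg w hw.1 h1 hw.2).2.2.2
      rw [heq] at hv'
      exact hN.inj v hv.1 w hw.1 hv.2 hw.2 (hv'.symm.trans hw')

end Instance
end RainbowMatching

/-! ### Augmenting paths: running the search, exchanging edges, and iterating. -/

namespace RainbowMatching

open RAM RAM.Expr RAM.Prog Algorithm

namespace Instance

variable {I : Instance} {s : State}

/-- The invariant of the search loop. -/
def SearchInv (I : Instance) (mh bh bc : ℕ → ℕ) (s : State) : Prop :=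
  (s.reg 6 = 0 ∧ I.Searching mh bh bc (s.mem 18) (s.mem 19) (s.mem 20) (s.reg 3) (s.reg 4)
    (s.reg 5)) ∨
  (I.Found mh bh bc (s.mem 18) (s.mem 19) (s.mem 20) (s.reg 4) (s.reg 6) ∧ s.reg 3 = s.reg 4 ∧
    s.reg 5 = 0)

/-- The measure of the search loop. -/
noncomputable def searchMeasure (I : Instance) (s : State) : ℕ :=
  -- The summand 1 makes the measure drop also in the round that finds an augmenting path.
  if s.reg 6 = 0 then 1 + (I.n - s.reg 3) + (I.unseen (s.mem 18) (s.reg 3) (s.reg 5)).card else 0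

theorem searchInv_step {mh bh bc : ℕ → ℕ} (hl : I.Loaded s)
    (hM : I.Matching bh bc mh) (hC : I.ColorMates mh (s.mem 17)) (hbc : s.mem 15 = bc)
    (hI : I.SearchInv mh bh bc s) (hlt : 0 < s.reg 4 - s.reg 3 + s.reg 5) :
    I.SearchInv mh bh bc (searchBody.run s) ∧
      I.searchMeasure (searchBody.run s) < I.searchMeasure s := by
  classical
  rcases hI with ⟨h6, hS⟩ | ⟨-, h1, h2⟩
  swap
  · omega
  by_cases h5 : s.reg 5 = 0
  · rw [h5] at hS hlt
    have hlt' : s.reg 3 < s.reg 4 := by omega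
    obtain ⟨hS', hsub⟩ := hS.pop hlt'
    have hn := hS.queue.le
    have hrun : searchBody.run s = (s.setReg 5 (Nat.findGreatest
        (I.PendAt (s.mem 18 (s.reg 3))) I.m)).setReg 3 (s.reg 3 + 1) := by
      simp [searchBody, Prog.run, Expr.eval, h5, hl.last_pend]
    rw [hrun]
    refine ⟨Or.inl ⟨by simpa using h6, by simpa using hS'⟩, ?_⟩
    have := Finset.card_le_card hsub
    simp only [searchMeasure, State.setReg_reg, State.setReg_mem, h6, h5]
    simp
    omega
  · obtain ⟨hem, p₀, hp₀, hpe⟩ := hS.cur h5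
    have hclr := hl.clr _ (Nat.pos_of_ne_zero h5) hem
    have hprev := hl.prev_pend _ (Nat.pos_of_ne_zero h5) hem hpe.1
    have h51 : ¬ s.reg 5 < 1 := by omega
    by_cases hb : 0 < bc (I.clr (s.reg 5))
    · obtain ⟨hS', hsub⟩ := hS.skip h5 (Or.inl hb.ne')
      have hrun : searchBody.run s = s.setReg 5 (Nat.findGreatest
          (I.PendAt (I.own (s.reg 5))) (s.reg 5 - 1)) := by
        simp [searchBody, Prog.run, Expr.eval, h51, hprev, hbc, hclr, hb]
      rw [hrun]
      refine ⟨Or.inl ⟨by simpa using h6, by simpa using hS'⟩, ?_⟩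
      have := Finset.card_lt_card hsub
      simp only [searchMeasure, State.setReg_reg, State.setReg_mem, h6]
      simp
      omega
    · obtain ⟨hC0, hC1⟩ := hC _ (Nat.pos_of_ne_zero h5) hem
      by_cases hm : s.mem 17 (I.clr (s.reg 5)) = 0
      · have hrun : searchBody.run s =
            ((s.setReg 6 (s.reg 5)).setReg 5 0).setReg 3 (s.reg 4) := by
          simp [searchBody, Prog.run, Expr.eval, h51, hbc, hclr, hb, hm]
        rw [hrun]
        refine ⟨Or.inr ⟨?_, by simp, by simp⟩, ?_⟩
        · simp only [State.setReg_reg, State.setReg_mem]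
          simp only [Nat.reduceEqDiff, if_false, if_true]
          exact ⟨hS.queue, hS.tree, h5, hem, hpe.1, by omega, hC0 hm, p₀,
            lt_of_lt_of_le (by omega) hS.le, hpe.2⟩
        · simp only [searchMeasure, State.setReg_reg, State.setReg_mem, h6]
          simp [h5]
      · obtain ⟨w, hw, hmw, hcw⟩ := hC1 hm
        have hmw0 : mh w ≠ 0 := hmw ▸ hm
        obtain ⟨hmm, hmp, hmb, -⟩ := hM.mem w hw hmw0
        have hown : s.mem 6 (s.mem 17 (I.clr (s.reg 5))) = w := by
          rw [hl.own _ (Nat.pos_of_ne_zero hm) (hmw ▸ hmm), ← hmw, hmp.2]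
        have hm1 : ¬ s.mem 17 (I.clr (s.reg 5)) < 1 := by omega
        by_cases hv : s.mem 19 w = 0
        · obtain ⟨hS₁, hu⟩ := hS.push h5 hw hmb hv hmw0 hcw
          obtain ⟨hS', hsub⟩ := hS₁.skip h5 (Or.inr ⟨w, hw, by simp, hmw0, hcw⟩)
          rw [hu] at hsub
          have hrun : searchBody.run s = ((((((s.setReg 12 w).setMem 19 w 1).setMem 20 w
              (s.reg 5)).setMem 18 (s.reg 4) w)).setReg 4 (s.reg 4 + 1)).setReg 5 (Nat.findGreatest
                (I.PendAt (I.own (s.reg 5))) (s.reg 5 - 1)) := by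
            simp [searchBody, Prog.run, Expr.eval, h51, hbc, hclr, hb, hm1, hown, hv, hprev]
          rw [hrun]
          refine ⟨Or.inl ⟨by simpa using h6, by simpa [State.setMem_mem] using hS'⟩, ?_⟩
          have := Finset.card_lt_card hsub
          simp only [searchMeasure, State.setReg_reg, State.setReg_mem, State.setMem_reg, h6]
          simp [State.setMem_mem]
          omega
        · obtain ⟨hS', hsub⟩ := hS.skip h5 (Or.inr ⟨w, hw, hv, hmw0, hcw⟩)
          have hrun : searchBody.run s = (s.setReg 12 w).setReg 5 (Nat.findGreatest
                (I.PendAt (I.own (s.reg 5))) (s.reg 5 - 1)) := by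
            simp [searchBody, Prog.run, Expr.eval, h51, hbc, hclr, hb, hm1, hown, hv, hprev]
          rw [hrun]
          refine ⟨Or.inl ⟨by simpa using h6, by simpa using hS'⟩, ?_⟩
          have := Finset.card_lt_card hsub
          simp only [searchMeasure, State.setReg_reg, State.setReg_mem, h6]
          simp
          omega

theorem card_unseen_le (q : ℕ → ℕ) (h e : ℕ) : (I.unseen q h e).card ≤ I.m := by
  classical
  refine (Finset.card_filter_le _ _).trans ?_
  simp

/-- The time is linear because a vertex enters the queue at most once and a pendant edge is
inspected at most once. -/
theorem runs_search (hs : I.Loaded s)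
    (hM : I.Matching (s.mem 14) (s.mem 15) (s.mem 13)) (hC : I.ColorMates (s.mem 13) (s.mem 17))
    (hQ : Queue (s.mem 13) (s.mem 14) (s.mem 18) (s.mem 19) (s.mem 20) I.n (s.reg 4))
    (hu : ∀ p < s.reg 4, s.mem 13 (s.mem 18 p) = 0) :
    Runs search s (200 * (I.n + I.m + 1)) fun s' =>
      (s'.reg 6 = 0 ∧ I.Maximum (s.mem 14) (s.mem 15) (s.mem 13)) ∨
      I.Found (s.mem 13) (s.mem 14) (s.mem 15) (s'.mem 18) (s'.mem 19) (s'.mem 20) (s'.reg 4)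
        (s'.reg 6) := by
  refine Runs.seq (T₁ := 2) (T₂ := 4 + (1 + I.n + I.m) * 180 + 10) (R := fun s' => s' = s.setReg 3 0)
    (Runs.of_straight rfl le_rfl rfl) (fun s₁ h₁ _ => ?_) (by omega)
  refine Runs.seq (T₁ := 2) (T₂ := 2 + (1 + I.n + I.m) * 180 + 10)
    (R := fun s' => s' = s₁.setReg 5 0)
    (Runs.of_straight rfl le_rfl rfl) (fun s₂ h₂ _ => ?_) (by omega)
  refine Runs.seq (T₁ := 2) (T₂ := (1 + I.n + I.m) * 180 + 10)
    (R := fun s' => s' = s₂.setReg 6 0)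
    (Runs.of_straight rfl le_rfl rfl) (fun s₃ h₃ _ => ?_) (by omega)
  have hl : I.Loaded s₃ := by
    subst h₁ h₂ h₃
    exact hs.frame (p := assign 3 (lit 0) ;; assign 5 (lit 0) ;; assign 6 (lit 0)) rfl
      (Exec.frame (.seq (.assign _ _ _) (.seq (.assign _ _ _) (.assign _ _ _))))
  have hmem : s₃.mem = s.mem := by subst h₁ h₂ h₃; rfl
  have h3 : s₃.reg 3 = 0 := by subst h₁ h₂ h₃; simp
  have h4 : s₃.reg 4 = s.reg 4 := by subst h₁ h₂ h₃; simp
  have h5 : s₃.reg 5 = 0 := by subst h₁ h₂ h₃; simp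
  have h6 : s₃.reg 6 = 0 := by subst h₁ h₂ h₃; simp
  refine (Runs.loop s₃ (I.SearchInv (s.mem 13) (s.mem 14) (s.mem 15)) I.searchMeasure 170
    (fun s' hf hI hlt => ?_) ?_).mono ?_ ?_
  · refine Runs.of_straight rfl (by decide) ?_
    refine searchInv_step (hl.frame (by rfl) hf) hM ?_ ?_ hI hlt
    · rwa [hf.mem 17 rfl, hmem]
    · rw [hf.mem 15 rfl, hmem]
  · refine Or.inl ⟨h6, ?_⟩
    rw [h3, h4, h5, hmem]
    exact ⟨hQ, fun p hp h => absurd (hu p hp) h, Nat.zero_le _, fun p hp => by omega,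
      fun h => absurd rfl h⟩
  · have hμ : I.searchMeasure s₃ ≤ 1 + I.n + I.m := by
      rw [searchMeasure, if_pos h6]
      have := card_unseen_le (I := I) (s₃.mem 18) (s₃.reg 3) (s₃.reg 5)
      omega
    refine Nat.add_le_add (Nat.mul_le_mul hμ (by decide)) (by decide)
  · rintro s' ⟨hI, hlt⟩ hf
    rcases hI with ⟨h6', hS⟩ | ⟨hF, -, -⟩
    · refine Or.inl ⟨h6', ?_⟩
      simp only [Expr.eval] at hlt
      have h3' : s'.reg 3 = s'.reg 4 := by have := hS.le; omega
      have h5' : s'.reg 5 = 0 := by omega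
      rw [h3', h5'] at hS
      exact hS.maximum hM
    · exact Or.inr hF

/-- One step along the augmenting path. -/
theorem Matching.exchange {mh N bh bc q vis via : ℕ → ℕ} {t p x : ℕ} (hN : I.Matching bh bc N)
    (hQ : Queue mh bh q vis via I.n t) (hT : I.Tree mh q via t) (hp : p < t) (hx0 : x ≠ 0) (hxm : x ≤ I.m) (hxi : ¬ I.inner x)
    (hxo : I.own x = q p) (hxb : bc (I.clr x) = 0)
    (hxc : ∀ w < I.n, N w ≠ 0 → I.clr (N w) ≠ I.clr x) (hagree : ∀ r ≤ p, N (q r) = mh (q r)) :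
    I.Matching bh bc (Function.update N (q p) x) ∧
    ((via (q p) = 0 ∧ I.size (Function.update N (q p) x) = I.size N + 1) ∨
      (via (q p) ≠ 0 ∧ via (q p) ≤ I.m ∧ ¬ I.inner (via (q p)) ∧
        (∃ p' < p, I.own (via (q p)) = q p') ∧ bc (I.clr (via (q p))) = 0 ∧
        (∀ w < I.n, Function.update N (q p) x w ≠ 0 →
          I.clr (Function.update N (q p) x w) ≠ I.clr (via (q p))) ∧
        (∀ r < p, Function.update N (q p) x (q r) = mh (q r)) ∧
        I.size (Function.update N (q p) x) = I.size N)) := by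
  refine ⟨⟨fun v hv h0 => ?_, fun v hv w hw hv0 hw0 hc => ?_⟩, ?_⟩
  · by_cases hvq : v = q p
    · subst hvq
      simp only [Function.update_self]
      exact ⟨hxm, ⟨hxi, hxo⟩, hQ.free p hp, hxb⟩
    · rw [Function.update_of_ne hvq] at h0 ⊢
      exact hN.mem v hv h0
  · by_cases hvq : v = q p <;> by_cases hwq : w = q p
    · rw [hvq, hwq]
    · subst hvq
      rw [Function.update_of_ne hwq] at hw0 hc
      rw [Function.update_self] at hc
      exact absurd hc.symm (hxc w hw hw0)
    · subst hwq
      rw [Function.update_of_ne hvq] at hv0 hc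
      rw [Function.update_self] at hc
      exact absurd hc (hxc v hv hv0)
    · rw [Function.update_of_ne hvq] at hv0 hc
      rw [Function.update_of_ne hwq] at hw0 hc
      exact hN.inj v hv w hw hv0 hw0 hc
  · have hqn := hQ.lt p hp
    have hNp := hagree p le_rfl
    -- At a root nothing is dropped, so the matching grows and the path ends. Otherwise the old edge
    -- at `q p` is dropped; this frees the color of `via (q p)`, which then goes to an earlier
    -- vertex of the queue, where `N` still agrees with `mh`.
    by_cases h0 : mh (q p) = 0
    · refine Or.inl ⟨hQ.via_root p hp h0, ?_⟩
      rw [h0] at hNp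
      rw [size, size, ← Finset.card_insert_of_notMem (a := q p) (by simp [hNp])]
      congr 1
      ext v
      by_cases hvq : v = q p
      · subst hvq; simp [hx0, hqn]
      · simp [hvq]
    · obtain ⟨h1, h2, h3, h4, h5⟩ := hT p hp h0
      rw [← hNp] at h0 h4
      refine Or.inr ⟨h1, h2, h3, h5, ?_, fun w hw hw0 => ?_, fun r hr => ?_, ?_⟩
      · rw [h4]; exact (hN.mem _ hqn h0).2.2.2
      · rw [h4]
        by_cases hwq : w = q p
        · subst hwq
          rw [Function.update_self]
          exact (hxc _ hqn h0).symm
        · rw [Function.update_of_ne hwq] at hw0 ⊢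
          exact fun hc => hwq (hN.inj w hw _ hqn hw0 h0 hc)
      · rw [Function.update_of_ne, hagree r hr.le]
        intro he
        have := hQ.inj r (by omega) p hp he
        omega
      · rw [size, size]
        congr 1
        ext v
        by_cases hvq : v = q p
        · subst hvq; simp [hx0, h0]
        · simp [hvq]

theorem runs_exchange {mh bh bc vis : ℕ → ℕ} (hs : I.Loaded s)
    (hM : I.Matching bh bc mh) (hmh : s.mem 13 = mh)
    (hF : I.Found mh bh bc (s.mem 18) vis (s.mem 20) (s.reg 4) (s.reg 6)) :
    Runs exchange s (100 * (I.n + I.m + 1)) fun s' =>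
      I.Matching bh bc (s'.mem 13) ∧ I.size (s'.mem 13) = I.size mh + 1 := by
  classical
  set q := s.mem 18 with hq
  set via := s.mem 20 with hvia
  set t := s.reg 4 with ht
  have htn := hF.queue.le
  refine Runs.seq (T₁ := 2) (T₂ := I.n * 30 + 10) (R := fun s' => s' = s.setReg 5 (s.reg 6))
    (Runs.of_straight rfl le_rfl rfl) (fun s₁ h₁ hf₁ => ?_) (by omega)
  have hl := hs.frame (by rfl) hf₁
  -- The exchange terminates because the queue position of the owner of the current edge decreases
  -- along the path; the measure is that position plus one.
  let pos : State → ℕ := fun s' => if h : ∃ p, p < t ∧ I.own (s'.reg 5) = q p then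
    Nat.find h + 1 else 0
  have hpos : ∀ s' p, p < t → I.own (s'.reg 5) = q p → pos s' = p + 1 := by
    intro s' p hp hp'
    have h : ∃ p, p < t ∧ I.own (s'.reg 5) = q p := ⟨p, hp, hp'⟩
    have h' := Nat.find_spec h
    simp only [pos, dif_pos h]
    rw [hF.queue.inj _ h'.1 p hp (h'.2.symm.trans hp')]
  let Inv : State → Prop := fun s' => I.Matching bh bc (s'.mem 13) ∧
    ((s'.reg 5 = 0 ∧ I.size (s'.mem 13) = I.size mh + 1) ∨
     (s'.reg 5 ≠ 0 ∧ s'.reg 5 ≤ I.m ∧ ¬ I.inner (s'.reg 5) ∧ bc (I.clr (s'.reg 5)) = 0 ∧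
      (∀ w < I.n, s'.mem 13 w ≠ 0 → I.clr (s'.mem 13 w) ≠ I.clr (s'.reg 5)) ∧
      (∃ p < t, I.own (s'.reg 5) = q p ∧ ∀ r ≤ p, s'.mem 13 (q r) = mh (q r)) ∧
      I.size (s'.mem 13) = I.size mh))
  refine (Runs.loop s₁ Inv (fun s' => if s'.reg 5 = 0 then 0 else pos s') 20
    (fun s' hf hI hlt => ?_) ?_).mono ?_ ?_
  · obtain ⟨hN, ⟨h0, -⟩ | ⟨h0, hxm, hxi, hxb, hxc, ⟨p, hp, hxo, hag⟩, hsz⟩⟩ := hI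
    · simp [Expr.eval, h0] at hlt
    have hl' := hl.frame (by rfl) hf
    have h20 : s'.mem 20 = via := by rw [hf.mem 20 rfl, hf₁.mem 20 rfl]
    obtain ⟨hN', hcase⟩ := hN.exchange hF.queue hF.tree hp h0 hxm hxi hxo hxb hxc hag
    refine Runs.of_straight rfl (by decide) ?_
    have hrun : (assign 12 (Expr.read 6 (reg 5)) ;; write 13 (reg 12) (reg 5) ;;
        assign 5 (Expr.read 20 (reg 12))).run s' =
        ((s'.setReg 12 (q p)).setMem 13 (q p) (s'.reg 5)).setReg 5 (via (q p)) := by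
      simp [Prog.run, Expr.eval, hl'.own _ (Nat.pos_of_ne_zero h0) hxm, hxo, h20]
    rw [hrun]
    have e5 : (((s'.setReg 12 (q p)).setMem 13 (q p) (s'.reg 5)).setReg 5 (via (q p))).reg 5 =
      via (q p) := by simp
    have e13 : (((s'.setReg 12 (q p)).setMem 13 (q p) (s'.reg 5)).setReg 5 (via (q p))).mem 13 =
      Function.update (s'.mem 13) (q p) (s'.reg 5) := by simp [State.setMem_mem]
    simp only [Inv, e5, e13, hpos s' p hp hxo, h0, if_false]
    rcases hcase with ⟨hv0, hsz'⟩ | ⟨hv0, h1, h2, ⟨p', hp', hp''⟩, h3, h4, h5, h6⟩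
    · exact ⟨⟨hN', Or.inl ⟨hv0, by omega⟩⟩, by simp [hv0]⟩
    · refine ⟨⟨hN', Or.inr ⟨hv0, h1, h2, h3, h4, ⟨p', by omega, hp'', fun r hr =>
        h5 r (by omega)⟩, by omega⟩⟩, ?_⟩
      rw [if_neg hv0, hpos _ p' (by omega) (by rw [e5, hp''])]
      omega
  · subst h₁
    simp only [Inv, State.setReg_mem, State.setReg_reg, if_true]
    rw [hmh]
    obtain ⟨p, hp, hp'⟩ := hF.own
    exact ⟨hM, Or.inr ⟨hF.ne_zero, hF.le, hF.pend, hF.free, hF.clr_ne,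
      ⟨p, hp, hp', fun _ _ => rfl⟩, rfl⟩⟩
  · have : (if s₁.reg 5 = 0 then 0 else pos s₁) ≤ I.n := by
      split_ifs
      · omega
      · simp only [pos]
        split_ifs with h
        · have := (Nat.find_spec h).1
          omega
        · omega
    refine Nat.add_le_add (Nat.mul_le_mul this (by decide)) (by decide)
  · rintro s' ⟨⟨hN, h⟩, hlt⟩ -
    rcases h with h | h
    · exact ⟨hN, h.2⟩
    · simp only [Expr.eval] at hlt
      omega

theorem runs_augment (hs : I.Loaded s)
    (hM : I.Matching (s.mem 14) (s.mem 15) (s.mem 13)) :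
    Runs augment s (500 * (I.n + I.m + 1)) fun s' =>
      (s'.reg 6 = 0 ∧ I.Maximum (s.mem 14) (s.mem 15) (s'.mem 13)) ∨
      (s'.reg 6 ≠ 0 ∧ I.Matching (s.mem 14) (s.mem 15) (s'.mem 13) ∧
        I.size (s'.mem 13) = I.size (s.mem 13) + 1) := by
  refine Runs.seq (runs_colorMates hs hM) (fun s₁ h₁ f₁ => ?_) (T₂ := 400 * (I.n + I.m + 1))
    (by omega)
  have l₁ := hs.frame (by rfl) f₁
  refine Runs.seq (runs_roots l₁) (fun s₂ h₂ f₂ => ?_) (T₂ := 300 * (I.n + I.m + 1))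
    (by omega)
  have l₂ := l₁.frame (by rfl) f₂
  have e13 : s₂.mem 13 = s.mem 13 := by rw [f₂.mem 13 rfl, f₁.mem 13 rfl]
  have e14 : s₂.mem 14 = s.mem 14 := by rw [f₂.mem 14 rfl, f₁.mem 14 rfl]
  have e15 : s₂.mem 15 = s.mem 15 := by rw [f₂.mem 15 rfl, f₁.mem 15 rfl]
  rw [← e13, ← f₂.mem 17 rfl] at h₁
  rw [← f₂.mem 13 rfl, ← f₂.mem 14 rfl] at h₂
  rw [← e13, ← e14, ← e15] at hM
  refine Runs.seq (runs_search l₂ hM h₁ h₂.1 h₂.2) (fun s₃ h₃ f₃ => ?_)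
    (T₂ := 100 * (I.n + I.m + 1)) (by omega)
  have l₃ := l₂.frame (by rfl) f₃
  rw [← e13, ← e14, ← e15]
  rcases h₃ with ⟨h6, hmax⟩ | hF
  · refine Runs.seq (R := fun s' => s'.reg 5 = 0 ∧ s'.mem = s₃.mem ∧ s'.reg 6 = 0)
      (Runs.of_straight rfl le_rfl ?_) (fun s₄ h₄ f₄ => ?_)
      (T₂ := 3) (by simp [Prog.time, Expr.cost]; omega)
    · simp [Prog.run, Expr.eval, h6, State.setReg]
    · refine ⟨_, s₄, .loop_false (by simp [Expr.eval, h₄.1]), by simp [Expr.cost], Or.inl ?_⟩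
      rw [h₄.2.1, f₃.mem 13 rfl]
      exact ⟨h₄.2.2, hmax⟩
  · exact (runs_exchange l₃ hM (f₃.mem 13 rfl) hF).mono le_rfl fun s' h f =>
      Or.inr ⟨(f.reg 6 rfl).trans_ne hF.ne_zero, h⟩

/-- The parameter `r` bounds the deficit of the initial matching: at most `r` augmentations succeed,
and one more search fails. A good start is thus rewarded. -/
theorem runs_maximize (hs : I.Loaded s)
    (hM : I.Matching (s.mem 14) (s.mem 15) (s.mem 13)) (r : ℕ)
    (hr : ∀ N, I.Matching (s.mem 14) (s.mem 15) N → I.size N ≤ I.size (s.mem 13) + r) :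
    Runs maximize s (600 * (r + 1) * (I.n + I.m + 1)) fun s' =>
      I.Maximum (s.mem 14) (s.mem 15) (s'.mem 13) := by
  refine Runs.seq (R := fun s' => s' = s.setReg 6 1) (Runs.of_straight rfl le_rfl rfl)
    (fun s₁ h₁ f₁ => ?_) (T₂ := (r + 1) * (500 * (I.n + I.m + 1) + 3) + 3) ?_
  swap
  · simp only [Prog.time, Expr.cost]
    nlinarith [Nat.zero_le ((r + 1) * (I.n + I.m)), Nat.zero_le r]
  have l₁ := hs.frame (by rfl) f₁
  refine (Runs.loop s₁ (fun s' => I.Matching (s.mem 14) (s.mem 15) (s'.mem 13) ∧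
    (s'.reg 6 = 0 → I.Maximum (s.mem 14) (s.mem 15) (s'.mem 13)))
    (fun s' => if s'.reg 6 = 0 then 0 else I.size (s.mem 13) + r + 1 - I.size (s'.mem 13))
    (500 * (I.n + I.m + 1)) (fun s' hf hI hlt => ?_) ?_).mono ?_ ?_
  · have e14 : s'.mem 14 = s.mem 14 := by rw [hf.mem 14 rfl, f₁.mem 14 rfl]
    have e15 : s'.mem 15 = s.mem 15 := by rw [hf.mem 15 rfl, f₁.mem 15 rfl]
    have h6 : s'.reg 6 ≠ 0 := by simpa [Expr.eval, Nat.pos_iff_ne_zero] using hlt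
    have hle := hr _ hI.1
    refine (runs_augment (l₁.frame (by rfl) hf) (by rw [e14, e15]; exact hI.1)).mono le_rfl
      fun s'' h _ => ?_
    rw [e14, e15] at h
    rcases h with ⟨h6', hm⟩ | ⟨h6', hm, hsz⟩
    · refine ⟨⟨hm.1, fun _ => hm⟩, ?_⟩
      rw [if_pos h6', if_neg h6]
      omega
    · have hle' := hr _ hm
      refine ⟨⟨hm, fun h => absurd h h6'⟩, ?_⟩
      rw [if_neg h6', if_neg h6]
      omega
  · subst h₁
    exact ⟨hM, by simp⟩
  · refine Nat.add_le_add (Nat.mul_le_mul ?_ le_rfl) le_rfl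
    subst h₁
    simp
    omega
  · rintro s' ⟨⟨-, h⟩, hlt⟩ -
    refine h ?_
    simpa [Expr.eval] using hlt

end Instance
end RainbowMatching

namespace RainbowMatching

open RAM RAM.Expr RAM.Prog Algorithm

namespace Instance

variable {I : Instance} {s : State}

/-! ### Choices of inner edges -/

variable (I) in
/-- At most one inner edge for every owner. -/
def Choice (cur : ℕ → ℕ) : Prop := ∀ v < I.n, cur v ≠ 0 → cur v ≤ I.m ∧ I.InnerAt v (cur v)

variable (I) in
/-- The edges chosen for the vertices below `k` form a rainbow matching. -/
def Admissible (cur : ℕ → ℕ) (k : ℕ) : Prop :=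
  ∀ v < k, ∀ w < k, v ≠ w → cur v ≠ 0 → cur w ≠ 0 →
    I.clr (cur v) ≠ I.clr (cur w) ∧ ∀ u, I.EndOf u (cur v) → ¬ I.EndOf u (cur w)

variable (I) in
def VertexBlocked (cur : ℕ → ℕ) (k v : ℕ) : Prop := ∃ w < k, cur w ≠ 0 ∧ I.EndOf v (cur w)

variable (I) in
def ColorBlocked (cur : ℕ → ℕ) (k c : ℕ) : Prop := ∃ w < k, cur w ≠ 0 ∧ I.clr (cur w) = c

open Classical in
variable (I) in
/-- The vertices blocked by a choice, as a memory array. -/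
noncomputable def blockedVertices (cur : ℕ → ℕ) (v : ℕ) : ℕ :=
  if I.VertexBlocked cur I.n v then 1 else 0

open Classical in
variable (I) in
/-- The colors blocked by a choice, as a memory array. -/
noncomputable def blockedColors (cur : ℕ → ℕ) (c : ℕ) : ℕ :=
  if I.ColorBlocked cur I.n c then 1 else 0

variable (I) in
/-- A choice of inner edges, and pendant edges that complete it to a rainbow matching. -/
structure Compatible (cur N : ℕ → ℕ) : Prop where
  choice : I.Choice cur
  admissible : I.Admissible cur I.n
  matching : I.Matching (I.blockedVertices cur) (I.blockedColors cur) N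

/-- Needed because the arrays in memory are controlled only at vertices and at colors of edges,
while the abstract blocking functions are defined everywhere. -/
theorem Matching.congr {bh bc bh' bc' N N' : ℕ → ℕ} (h : I.Matching bh bc N)
    (hh : ∀ v < I.n, bh v = 0 → bh' v = 0)
    (hc : ∀ e, 1 ≤ e → e ≤ I.m → bc (I.clr e) = 0 → bc' (I.clr e) = 0)
    (hN : ∀ v < I.n, N' v = N v) : I.Matching bh' bc' N' := by
  refine ⟨fun v hv h0 => ?_, fun v hv w hw h0 h0' he => ?_⟩
  · rw [hN v hv] at h0 ⊢
    obtain ⟨h1, h2, h3, h4⟩ := h.mem v hv h0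
    exact ⟨h1, h2, hh v hv h3, hc _ (Nat.pos_of_ne_zero h0) h1 h4⟩
  · rw [hN v hv, hN w hw] at he
    rw [hN v hv] at h0
    rw [hN w hw] at h0'
    exact h.inj v hv w hw h0 h0' he

theorem size_congr {f g : ℕ → ℕ} (h : ∀ v < I.n, f v = g v) : I.size f = I.size g := by
  unfold size
  congr 1
  refine Finset.filter_congr fun v hv => ?_
  rw [h v (Finset.mem_range.1 hv)]

theorem Admissible.succ {cur : ℕ → ℕ} {k : ℕ} (h0 : cur k ≠ 0) :
    I.Admissible cur (k + 1) ↔ I.Admissible cur k ∧ ¬ I.ColorBlocked cur k (I.clr (cur k)) ∧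
      ¬ I.VertexBlocked cur k (I.own (cur k)) ∧ ¬ I.VertexBlocked cur k (I.oth (cur k)) := by
  constructor
  · intro h
    refine ⟨fun v hv w hw => h v (by omega) w (by omega), ?_, ?_, ?_⟩
    · rintro ⟨w, hw, hw0, hc⟩
      exact (h w (by omega) k (by omega) hw.ne hw0 h0).1 hc
    · rintro ⟨w, hw, hw0, hc⟩
      exact (h w (by omega) k (by omega) hw.ne hw0 h0).2 _ hc (Or.inl rfl)
    · rintro ⟨w, hw, hw0, hc⟩
      exact (h w (by omega) k (by omega) hw.ne hw0 h0).2 _ hc (Or.inr rfl)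
  · rintro ⟨h, hc, h1, h2⟩
    have key : ∀ v < k, cur v ≠ 0 → ∀ u, I.EndOf u (cur v) → ¬ I.EndOf u (cur k) := by
      rintro v hv hv0 u hu (rfl | rfl)
      · exact h1 ⟨v, hv, hv0, hu⟩
      · exact h2 ⟨v, hv, hv0, hu⟩
    intro v hv w hw hvw hv0 hw0
    rcases Nat.lt_succ_iff_lt_or_eq.1 hv with hv | rfl <;>
    rcases Nat.lt_succ_iff_lt_or_eq.1 hw with hw | rfl
    · exact h v hv w hw hvw hv0 hw0
    · exact ⟨fun he => hc ⟨v, hv, hv0, he⟩, key v hv hv0⟩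
    · exact ⟨fun he => hc ⟨w, hw, hw0, he.symm⟩, fun u hu hu' => key w hw hw0 u hu' hu⟩
    · exact absurd rfl hvw

theorem Admissible.succ_of_eq_zero {cur : ℕ → ℕ} {k : ℕ} (h0 : cur k = 0) :
    I.Admissible cur (k + 1) ↔ I.Admissible cur k := by
  constructor
  · exact fun h v hv w hw => h v (by omega) w (by omega)
  · intro h v hv w hw hvw hv0 hw0
    refine h v (lt_of_le_of_ne (by omega) ?_) w (lt_of_le_of_ne (by omega) ?_) hvw hv0 hw0
    · rintro rfl; exact hv0 h0
    · rintro rfl; exact hw0 h0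

theorem exists_lt_succ_and {p : ℕ → Prop} {k : ℕ} :
    (∃ w < k + 1, p w) ↔ (∃ w < k, p w) ∨ p k := by
  constructor
  · rintro ⟨w, hw, h⟩
    rcases Nat.lt_succ_iff_lt_or_eq.1 hw with hw | rfl
    exacts [Or.inl ⟨w, hw, h⟩, Or.inr h]
  · rintro (⟨w, hw, h⟩ | h)
    exacts [⟨w, by omega, h⟩, ⟨k, by omega, h⟩]

theorem runs_blockChosen (hs : I.Loaded s) (hV : I.Valid) (hc : I.Choice (s.mem 12)) :
    Runs blockChosen s (100 * (I.n + I.m + 1)) fun s' =>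
      (∀ v < I.n, s'.mem 14 v ≠ 0 ↔ I.VertexBlocked (s.mem 12) I.n v) ∧
      (∀ e, 1 ≤ e → e ≤ I.m →
        (s'.mem 15 (I.clr e) ≠ 0 ↔ I.ColorBlocked (s.mem 12) I.n (I.clr e))) ∧
      (s'.reg 7 ≠ 0 ↔ I.Admissible (s.mem 12) I.n) := by
  refine Runs.seq (T₁ := I.n * 20 + 5) (T₂ := I.m * 20 + 5 + (2 + (I.n * 60 + 5))) (R := fun s' =>
    ∀ v < I.n, s'.mem 14 v = 0) ?_ (fun s₁ h₁ f₁ => ?_) (by omega)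
  · refine (Runs.forLoop s (fun k s' => ∀ v < k, s'.mem 14 v = 0) 13 rfl rfl
      (by decide) ?_ fun k s₁ hk hi hf hk' => ?_).mono (by rw [hs.reg_n]) fun s' h _ => by
        rwa [hs.reg_n] at h
    · simp
    · refine Runs.of_straight rfl (by decide) ?_
      intro _ v hv
      simp [Prog.run, Expr.eval, hi]
      exact fun h => hk' v (by omega)
  have l₁ := hs.frame (by rfl) f₁
  refine Runs.seq (T₁ := I.m * 20 + 5) (T₂ := 2 + (I.n * 60 + 5)) (R := fun s' =>
    ∀ e, 1 ≤ e → e ≤ I.m → s'.mem 15 (I.clr e) = 0) ?_ (fun s₂ h₂ f₂ => ?_) (by omega)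
  · refine (Runs.forLoop s₁ (fun k s' => ∀ e, 1 ≤ e → e ≤ k → s'.mem 15 (I.clr e) = 0) 13 rfl rfl
      (by decide) ?_ fun k s₂ hk hi hf hk' => ?_).mono (by rw [l₁.reg_m]) fun s' h _ => by
        rwa [l₁.reg_m] at h
    · intro e h1 h0; omega
    · rw [l₁.reg_m] at hk
      refine Runs.of_straight rfl (by decide) ?_
      intro _ e h1 he
      have hl := l₁.frame (by rfl) hf
      simp only [Prog.run, Expr.eval, hi, State.setReg_mem, State.setMem_mem_apply,
        hl.clr (k + 1) (by omega) (by omega), true_and]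
      split_ifs with h
      · rfl
      · refine hk' e h1 (Nat.le_of_lt_succ (lt_of_le_of_ne he ?_))
        rintro rfl
        exact h rfl
  have l₂ := l₁.frame (by rfl) f₂
  rw [← f₂.mem 14 rfl] at h₁
  refine Runs.seq (T₁ := 2) (T₂ := I.n * 60 + 5) (R := fun s' => s' = s₂.setReg 7 1)
    (Runs.of_straight rfl le_rfl rfl) (fun s₃ h₃ f₃ => ?_) (by omega)
  have l₃ := l₂.frame (by rfl) f₃
  have e12 : s₃.mem 12 = s.mem 12 := by rw [f₃.mem 12 rfl, f₂.mem 12 rfl, f₁.mem 12 rfl]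
  set cur := s.mem 12 with hcur
  refine (Runs.forLoop s₃ (fun k s' =>
      (∀ v < I.n, s'.mem 14 v ≠ 0 ↔ I.VertexBlocked cur k v) ∧
      (∀ e, 1 ≤ e → e ≤ I.m → (s'.mem 15 (I.clr e) ≠ 0 ↔ I.ColorBlocked cur k (I.clr e))) ∧
      (s'.reg 7 ≠ 0 ↔ I.Admissible cur k)) 53 rfl rfl
      (by decide) ?_ fun k s₄ hk hi hf hk' => ?_).mono (by rw [l₃.reg_n]) fun s' h _ => by
        rwa [l₃.reg_n] at h
  · subst h₃
    refine ⟨fun v hv => ?_, fun e h1 he => ?_, ?_⟩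
    · simp [h₁ v hv, VertexBlocked]
    · simp [h₂ e h1 he, ColorBlocked]
    · simp [Admissible]
  · rw [l₃.reg_n] at hk
    have hl := l₃.frame (by rfl) hf
    have e12' : s₄.mem 12 = cur := (hf.mem 12 rfl).trans e12
    obtain ⟨hA, hB, hC⟩ := hk'
    refine Runs.of_straight rfl (by decide) ?_
    intro _
    by_cases h0 : cur k = 0
    · have hVs : ∀ v, I.VertexBlocked cur (k + 1) v ↔ I.VertexBlocked cur k v := fun v => by
        simp only [VertexBlocked, exists_lt_succ_and, h0, ne_eq, not_true_eq_false, false_and,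
          or_false]
      have hCs : ∀ c, I.ColorBlocked cur (k + 1) c ↔ I.ColorBlocked cur k c := fun v => by
        simp only [ColorBlocked, exists_lt_succ_and, h0, ne_eq, not_true_eq_false, false_and,
          or_false]
      simp only [Admissible.succ_of_eq_zero h0, hVs, hCs]
      simp [Prog.run, Expr.eval, hi, e12', h0]
      exact ⟨by simpa using hA, by simpa using hB, by simpa using hC⟩
    · obtain ⟨hm, hin⟩ := hc k hk h0
      have h1 := Nat.pos_of_ne_zero h0
      have ho := hl.own _ h1 hm
      have ht := hl.oth _ h1 hm
      have hcl := hl.clr _ h1 hm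
      have hA1 := hA _ (hV.own_lt _ h1 hm)
      have hA2 := hA _ (hV.oth_lt _ h1 hm)
      have hB1 := hB _ h1 hm
      have hVs : ∀ v, I.VertexBlocked cur (k + 1) v ↔
          I.VertexBlocked cur k v ∨ I.own (cur k) = v ∨ I.oth (cur k) = v := by
        intro v
        simp only [VertexBlocked, exists_lt_succ_and, h0, ne_eq, not_false_eq_true, true_and,
          EndOf]
      have hCs : ∀ c, I.ColorBlocked cur (k + 1) c ↔
          I.ColorBlocked cur k c ∨ I.clr (cur k) = c := by
        intro v
        simp only [ColorBlocked, exists_lt_succ_and, h0, ne_eq, not_false_eq_true, true_and]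
      simp only [hVs, hCs, Admissible.succ h0]
      by_cases hbad : 0 < s₄.mem 14 (I.own (cur k)) +
          (s₄.mem 14 (I.oth (cur k)) + s₄.mem 15 (I.clr (cur k)))
      · simp [Prog.run, Expr.eval, hi, e12', h1, ho, ht, hcl, hbad]
        refine ⟨fun v hv => ?_, fun e h1e hme => ?_, ?_⟩
        · rw [← hA v hv]; grind
        · rw [← hB e h1e hme]; grind
        · intro _
          by_contra!
          rw [← not_iff_not.2 hA1, ← not_iff_not.2 hA2, ← not_iff_not.2 hB1] at this
          omega
      · simp [Prog.run, Expr.eval, hi, e12', h1, ho, ht, hcl, hbad]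
        refine ⟨fun v hv => ?_, fun e h1e hme => ?_, ?_⟩
        · rw [← hA v hv]; grind
        · rw [← hB e h1e hme]; grind
        · rw [← not_iff_not.2 hA1, ← not_iff_not.2 hA2, ← not_iff_not.2 hB1, ← hC]
          omega

/-- At a vertex with `s.mem 16 v = 0` both branches of the result are `0`, so the meaningless color
of the edge `0` does no harm. -/
theorem runs_restrict (hs : I.Loaded s) (hM : I.Matching 0 0 (s.mem 16)) :
    Runs restrict s (100 * (I.n + I.m + 1)) fun s' => ∀ v < I.n, s'.mem 13 v =
      if s.mem 14 v = 0 ∧ s.mem 15 (I.clr (s.mem 16 v)) = 0 then s.mem 16 v else 0 := by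
  refine (Runs.forLoop s (fun k s' => ∀ v < k, s'.mem 13 v =
      if s.mem 14 v = 0 ∧ s.mem 15 (I.clr (s.mem 16 v)) = 0 then s.mem 16 v else 0) 33 rfl rfl
      (by decide) ?_ fun k s₁ hk hi hf hk' => ?_).mono (by rw [hs.reg_n]; omega) fun s' h _ => by
        rwa [hs.reg_n] at h
  · simp
  · rw [hs.reg_n] at hk
    have hl := hs.frame (by rfl) hf
    have e16 : s₁.mem 16 = s.mem 16 := hf.mem 16 rfl
    have e14 : s₁.mem 14 = s.mem 14 := hf.mem 14 rfl
    have e15 : s₁.mem 15 = s.mem 15 := hf.mem 15 rfl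
    refine Runs.of_straight rfl (by decide) ?_
    intro _ v hv
    rcases Nat.lt_succ_iff_lt_or_eq.1 hv with hv | rfl
    · rw [← hk' v hv]
      simp [Prog.run, Expr.eval, hi, e14, e15, e16]
      split_ifs <;> simp [hv.ne]
    · by_cases h0 : s.mem 16 v = 0
      · simp [Prog.run, Expr.eval, hi, e16, h0]
      · have hcl := hl.clr _ (Nat.pos_of_ne_zero h0) (hM.mem v hk h0).1
        simp [Prog.run, Expr.eval, hi, e14, e15, e16, Nat.pos_of_ne_zero h0, hcl]
        split_ifs <;> simp_all

theorem card_filter_range_succ (f : ℕ → ℕ) (k : ℕ) :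
    ((Finset.range (k + 1)).filter fun v => f v ≠ 0).card =
      ((Finset.range k).filter fun v => f v ≠ 0).card + if 0 < f k then 1 else 0 := by
  rw [Finset.range_add_one, Finset.filter_insert]
  simp only [Nat.pos_iff_ne_zero]
  split_ifs <;> simp

theorem runs_countEdges (hs : I.Loaded s) :
    Runs countEdges s (100 * (I.n + I.m + 1)) fun s' =>
      s'.reg 8 = I.size (s.mem 12) + I.size (s.mem 13) := by
  refine Runs.seq (R := fun s' => s' = s.setReg 8 0) (Runs.of_straight rfl le_rfl rfl)
    (fun s₁ h₁ f₁ => ?_) (T₂ := I.n * 50 + 5) (by simp only [Prog.time, Expr.cost]; omega)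
  have l₁ := hs.frame (by rfl) f₁
  refine (Runs.forLoop s₁ (fun k s' => s'.reg 8 =
      ((Finset.range k).filter fun v => s.mem 12 v ≠ 0).card +
      ((Finset.range k).filter fun v => s.mem 13 v ≠ 0).card) 43 rfl rfl
      (by decide) ?_ fun k s₂ hk hi hf hk' => ?_).mono (by rw [l₁.reg_n]) fun s' h _ => by
        rwa [l₁.reg_n] at h
  · subst h₁; simp
  · have e12 : s₂.mem 12 = s.mem 12 := by rw [hf.mem 12 rfl, f₁.mem 12 rfl]
    have e13 : s₂.mem 13 = s.mem 13 := by rw [hf.mem 13 rfl, f₁.mem 13 rfl]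
    refine Runs.of_straight rfl (by decide) ?_
    intro _
    rw [card_filter_range_succ, card_filter_range_succ]
    by_cases h1 : 0 < s.mem 12 k <;> by_cases h2 : 0 < s.mem 13 k <;>
    simp [Prog.run, Expr.eval, hi, e12, e13, h1, h2, hk'] <;> omega

theorem runs_record (hs : I.Loaded s) :
    Runs record s (200 * (I.n + I.m + 1)) fun s' => s'.reg 9 = s.reg 8 ∧
      ∀ i < I.m, s'.mem 3 i ≠ 0 ↔ ∃ v < I.n, s.mem 12 v = i + 1 ∨ s.mem 13 v = i + 1 := by
  refine Runs.seq (R := fun s' => s' = s.setReg 9 (s.reg 8)) (Runs.of_straight rfl le_rfl rfl)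
    (fun s₁ h₁ f₁ => ?_) (T₂ := I.m * 20 + 5 + (I.n * 60 + 5))
    (by simp only [Prog.time, Expr.cost]; omega)
  have l₁ := hs.frame (by rfl) f₁
  have e9 : s₁.reg 9 = s.reg 8 := by subst h₁; simp
  refine Runs.seq (T₁ := I.m * 20 + 5) (T₂ := I.n * 60 + 5) (R := fun s' =>
    ∀ i < I.m, s'.mem 3 i = 0) ?_ (fun s₂ h₂ f₂ => ?_) (by omega)
  · refine (Runs.forLoop s₁ (fun k s' => ∀ i < k, s'.mem 3 i = 0) 13 rfl rfl
      (by decide) ?_ fun k s₁ hk hi hf hk' => ?_).mono (by rw [l₁.reg_m]) fun s' h _ => by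
        rwa [l₁.reg_m] at h
    · simp
    · refine Runs.of_straight rfl (by decide) ?_
      intro _ v hv
      simp [Prog.run, Expr.eval, hi]
      exact fun h => hk' v (by omega)
  have l₂ := l₁.frame (by rfl) f₂
  refine (Runs.forLoop s₂ (fun k s' => ∀ i < I.m, s'.mem 3 i ≠ 0 ↔
      ∃ v < k, s.mem 12 v = i + 1 ∨ s.mem 13 v = i + 1) 53 rfl rfl
      (by decide) ?_ fun k s₃ hk hi hf hk' => ?_).mono (by rw [l₂.reg_n]) fun s' h f => ?_
  · intro i hi
    simp [h₂ i hi]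
  · have e12 : s₃.mem 12 = s.mem 12 := by rw [hf.mem 12 rfl, f₂.mem 12 rfl, f₁.mem 12 rfl]
    have e13 : s₃.mem 13 = s.mem 13 := by rw [hf.mem 13 rfl, f₂.mem 13 rfl, f₁.mem 13 rfl]
    refine Runs.of_straight rfl (by decide) ?_
    intro _ i hi'
    rw [exists_lt_succ_and, ← hk' i hi']
    by_cases h1 : 0 < s.mem 12 k <;> by_cases h2 : 0 < s.mem 13 k <;>
    simp [Prog.run, Expr.eval, hi, e12, e13, h1, h2] <;> grind
  · rw [l₂.reg_n] at h
    exact ⟨by rw [f.reg 9 rfl, f₂.reg 9 rfl, e9], h⟩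

end Instance
end RainbowMatching

/-! ### The cost of one choice, and the enumeration of all choices. -/

namespace RainbowMatching

open RAM RAM.Expr RAM.Prog Algorithm

namespace Instance

variable {I : Instance} {s : State}

theorem blockedVertices_eq_zero {cur : ℕ → ℕ} {v : ℕ} :
    I.blockedVertices cur v = 0 ↔ ¬ I.VertexBlocked cur I.n v := by
  simp [blockedVertices]

theorem blockedColors_eq_zero {cur : ℕ → ℕ} {c : ℕ} :
    I.blockedColors cur c = 0 ↔ ¬ I.ColorBlocked cur I.n c := by
  simp [blockedColors]

/-- Blocking removes at most three edges from a matching for every chosen edge. -/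
theorem Matching.size_le_restrict {cur M N : ℕ → ℕ} (hM : I.Matching 0 0 M)
    (hN : ∀ v < I.n, N v = if I.blockedVertices cur v = 0 ∧ I.blockedColors cur (I.clr (M v)) = 0
      then M v else 0) :
    I.size M ≤ I.size N + 3 * I.size cur := by
  classical
  -- `S` indexes the chosen edges. A vertex loses its edge because it is an end of a chosen edge,
  -- i.e. lies in one of two images of `S`, or because the color is taken; the latter vertices form
  -- `B`, with at most one for every chosen color since `M` repeats no color.
  set S := (Finset.range I.n).filter fun v => cur v ≠ 0 with hS
  set B := (Finset.range I.n).filter fun v => M v ≠ 0 ∧ I.ColorBlocked cur I.n (I.clr (M v))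
  have hB : B.card ≤ S.card := by
    refine (Finset.card_le_card_of_injOn (t := S.image fun w => I.clr (cur w))
      (fun v => I.clr (M v)) (fun v hv => ?_) (fun v hv w hw he => ?_)).trans Finset.card_image_le
    · obtain ⟨w, hw, hw0, hw'⟩ := (Finset.mem_filter.1 hv).2.2
      exact Finset.mem_coe.2 (Finset.mem_image.2 ⟨w, by simp [hS, hw, hw0], hw'⟩)
    · have hv' := Finset.mem_filter.1 hv
      have hw' := Finset.mem_filter.1 hw
      exact hM.inj v (Finset.mem_range.1 hv'.1) w (Finset.mem_range.1 hw'.1) hv'.2.1 hw'.2.1 he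
  have hsub : ((Finset.range I.n).filter fun v => M v ≠ 0) ⊆
      ((((Finset.range I.n).filter fun v => N v ≠ 0) ∪ S.image fun w => I.own (cur w)) ∪
        S.image fun w => I.oth (cur w)) ∪ B := by
    intro v hv
    simp only [Finset.mem_filter, Finset.mem_range] at hv
    simp only [Finset.mem_union, Finset.mem_image, Finset.mem_filter, Finset.mem_range, B, hS]
    by_cases h1 : I.VertexBlocked cur I.n v
    · obtain ⟨w, hw, hw0, h | h⟩ := h1
      · exact Or.inl (Or.inl (Or.inr ⟨w, ⟨hw, hw0⟩, h⟩))
      · exact Or.inl (Or.inr ⟨w, ⟨hw, hw0⟩, h⟩)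
    · by_cases h2 : I.ColorBlocked cur I.n (I.clr (M v))
      · exact Or.inr ⟨hv.1, hv.2, h2⟩
      · refine Or.inl (Or.inl (Or.inl ⟨hv.1, ?_⟩))
        rw [hN v hv.1, if_pos ⟨blockedVertices_eq_zero.2 h1, blockedColors_eq_zero.2 h2⟩]
        exact hv.2
  have h := Finset.card_le_card hsub
  have h1 := Finset.card_union_le ((((Finset.range I.n).filter fun v => N v ≠ 0) ∪
    S.image fun w => I.own (cur w)) ∪ S.image fun w => I.oth (cur w)) B
  have h2 := Finset.card_union_le (((Finset.range I.n).filter fun v => N v ≠ 0) ∪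
    S.image fun w => I.own (cur w)) (S.image fun w => I.oth (cur w))
  have h3 := Finset.card_union_le ((Finset.range I.n).filter fun v => N v ≠ 0)
    (S.image fun w => I.own (cur w))
  have h4 : (S.image fun w => I.own (cur w)).card ≤ S.card := Finset.card_image_le
  have h5 : (S.image fun w => I.oth (cur w)).card ≤ S.card := Finset.card_image_le
  simp only [size, ← hS]
  omega

variable (I) in
/-- Array `3` holds a rainbow matching with as many edges as register `9` says. -/
def Recorded (s : State) : Prop :=
  ∃ cur N, I.Compatible cur N ∧ s.reg 9 = I.size cur + I.size N ∧
    ∀ i < I.m, s.mem 3 i ≠ 0 ↔ ∃ v < I.n, cur v = i + 1 ∨ N v = i + 1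

theorem runs_consider (hs : I.Loaded s) (hV : I.Valid) (hc : I.Choice (s.mem 12))
    (hM : I.Maximum 0 0 (s.mem 16)) (hR : I.Recorded s) :
    Runs consider s (3000 * (I.size (s.mem 12) + 1) * (I.n + I.m + 1)) fun s' =>
      I.Recorded s' ∧ s.reg 9 ≤ s'.reg 9 ∧
      ∀ N, I.Compatible (s.mem 12) N → I.size (s.mem 12) + I.size N ≤ s'.reg 9 := by
  set cur := s.mem 12 with hcur
  set T := I.n + I.m + 1 with hT
  refine Runs.seq (runs_blockChosen hs hV hc) (fun s₁ h₁ f₁ => ?_)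
    (T₂ := 2500 * (I.size cur + 1) * T) (by rw [← hT]; nlinarith [Nat.zero_le (I.size cur * T)])
  obtain ⟨hA, hB, hC⟩ := h₁
  have l₁ := hs.frame (by rfl) f₁
  have e3₁ : s₁.mem 3 = s.mem 3 := f₁.mem 3 rfl
  have e9₁ : s₁.reg 9 = s.reg 9 := f₁.reg 9 rfl
  have hpos : 0 < (I.size cur + 1) * T := by positivity
  refine Runs.ite (T := 2400 * (I.size cur + 1) * T) (fun h7 => ?_) (fun h7 => ?_)
    (by simp only [Expr.cost]; nlinarith)
  swap
  · refine Runs.of_straight rfl ?_ ?_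
    · simp only [Prog.time]; nlinarith
    · simp only [Expr.eval, not_lt, Nat.le_zero] at h7
      refine ⟨?_, e9₁.ge, fun N hN => absurd (hC.2 hN.admissible) (by simpa using h7)⟩
      simpa [Recorded, Prog.run, e3₁, e9₁] using hR
  have hadm : I.Admissible cur I.n := hC.1 (by simpa [Expr.eval, Nat.pos_iff_ne_zero] using h7)
  have hA' : ∀ v < I.n, s₁.mem 14 v = 0 ↔ I.blockedVertices cur v = 0 := fun v hv => by
    rw [blockedVertices_eq_zero, ← hA v hv, not_not]
  have hB' : ∀ e, 1 ≤ e → e ≤ I.m → (s₁.mem 15 (I.clr e) = 0 ↔ I.blockedColors cur (I.clr e) = 0) :=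
    fun e h1 h2 => by rw [blockedColors_eq_zero, ← hB e h1 h2, not_not]
  have e16 : s₁.mem 16 = s.mem 16 := f₁.mem 16 rfl
  rw [← e16] at hM
  refine Runs.seq (runs_restrict l₁ hM.1) (fun s₂ h₂ f₂ => ?_)
    (T₂ := 2300 * (I.size cur + 1) * T) (by rw [← hT]; nlinarith [Nat.zero_le (I.size cur * T)])
  have l₂ := l₁.frame (by rfl) f₂
  have e14 : s₂.mem 14 = s₁.mem 14 := f₂.mem 14 rfl
  have e15 : s₂.mem 15 = s₁.mem 15 := f₂.mem 15 rfl
  have hM₂ : I.Matching (s₂.mem 14) (s₂.mem 15) (s₂.mem 13) := by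
    rw [e14, e15]
    refine ⟨fun v hv h0 => ?_, fun v hv w hw h0 h0' he => ?_⟩
    · rw [h₂ v hv] at h0 ⊢
      split_ifs at h0 ⊢ with hb
      · obtain ⟨h1, h2, -, -⟩ := hM.1.mem v hv h0
        exact ⟨h1, h2, hb⟩
      · exact absurd rfl h0
    · rw [h₂ v hv] at h0 he
      rw [h₂ w hw] at h0' he
      split_ifs at h0 h0' he with hb hb'
      · exact hM.1.inj v hv w hw h0 h0' he
      all_goals first | exact absurd rfl h0 | exact absurd rfl h0'
  have hle : I.size (s₁.mem 16) ≤ I.size (s₂.mem 13) + 3 * I.size cur := by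
    refine hM.1.size_le_restrict fun v hv => ?_
    rw [h₂ v hv]
    by_cases h0 : s₁.mem 16 v = 0
    · simp [h0]
    · simp only [hA' v hv, hB' _ (Nat.pos_of_ne_zero h0) (hM.1.mem v hv h0).1]
  -- The warm start. Blocking only removes competitors, so the unblocked maximum bounds every `N`,
  -- and the deficit is at most `3 * I.size cur`. The cost factor `600 * (3 * I.size cur + 1)` fits
  -- into `1900 * (I.size cur + 1)`, the difference of the two budgets.
  refine Runs.seq (runs_maximize l₂ hM₂ (3 * I.size cur) fun N hN => (hM.2 N ?_).trans hle)
    (fun s₃ h₃ f₃ => ?_) (T₂ := 400 * (I.size cur + 1) * T)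
    (by rw [← hT]; nlinarith [Nat.zero_le (I.size cur * T)])
  · exact hN.congr (fun _ _ _ => rfl) (fun _ _ _ _ => rfl) fun _ _ => rfl
  have l₃ := l₂.frame (by rfl) f₃
  rw [e14, e15] at h₃
  have hcomp : ∀ N, I.Compatible cur N → I.size N ≤ I.size (s₃.mem 13) := fun N hN =>
    h₃.2 N (hN.matching.congr (fun v hv => (hA' v hv).2) (fun e h1 h2 => (hB' e h1 h2).2)
      fun _ _ => rfl)
  have hcomp' : I.Compatible cur (s₃.mem 13) := ⟨hc, hadm, h₃.1.congr (fun v hv => (hA' v hv).1)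
    (fun e h1 h2 => (hB' e h1 h2).1) fun _ _ => rfl⟩
  refine Runs.seq (runs_countEdges l₃) (fun s₄ h₄ f₄ => ?_) (T₂ := 300 * (I.size cur + 1) * T)
    (by rw [← hT]; nlinarith [Nat.zero_le (I.size cur * T)])
  have l₄ := l₃.frame (by rfl) f₄
  have e12 : s₄.mem 12 = cur := by
    rw [f₄.mem 12 rfl, f₃.mem 12 rfl, f₂.mem 12 rfl, f₁.mem 12 rfl]
  have e12₃ : s₃.mem 12 = cur := by rw [f₃.mem 12 rfl, f₂.mem 12 rfl, f₁.mem 12 rfl]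
  have e3 : s₄.mem 3 = s.mem 3 := by
    rw [f₄.mem 3 rfl, f₃.mem 3 rfl, f₂.mem 3 rfl, f₁.mem 3 rfl]
  have e9 : s₄.reg 9 = s.reg 9 := by
    rw [f₄.reg 9 rfl, f₃.reg 9 rfl, f₂.reg 9 rfl, f₁.reg 9 rfl]
  have e13 : s₄.mem 13 = s₃.mem 13 := f₄.mem 13 rfl
  rw [e12₃] at h₄
  refine Runs.ite (T := 200 * (I.size cur + 1) * T) (fun h9 => ?_) (fun h9 => ?_)
    (by simp only [Expr.cost]; nlinarith)
  · simp only [Expr.eval, e9, h₄] at h9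
    refine (runs_record l₄).mono (by rw [← hT]; nlinarith [Nat.zero_le (I.size cur * T)])
      fun s₅ h₅ f₅ => ?_
    rw [h₄, e12, e13] at h₅
    refine ⟨⟨cur, _, hcomp', h₅.1, h₅.2⟩, by rw [h₅.1]; exact h9.le, fun N hN => ?_⟩
    rw [h₅.1]
    exact Nat.add_le_add_left (hcomp N hN) _
  · simp only [Expr.eval, e9, h₄] at h9
    refine Runs.of_straight rfl (by simp only [Prog.time]; nlinarith) ?_
    refine ⟨?_, e9.ge, fun N hN => ?_⟩
    · simpa [Recorded, Prog.run, e3, e9] using hR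
    · have := hcomp N hN
      simp only [Prog.run, e9]
      omega

/-! ### Running through all choices -/

open Classical in
variable (I) in
/-- The possible values of a choice at `v`. -/
noncomputable def options (v : ℕ) : Finset ℕ :=
  (Finset.range (I.m + 1)).filter fun e => e = 0 ∨ I.InnerAt v e

open Classical in
variable (I) in
/-- The next choice in descending colexicographic order. -/
noncomputable def next (cur : ℕ → ℕ) (v : ℕ) : ℕ :=
  if ∀ w < v, cur w = 0 then
    if cur v = 0 then Nat.findGreatest (I.InnerAt v) I.m
    else Nat.findGreatest (I.InnerAt v) (cur v - 1)
  else cur v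

variable (I) in
noncomputable def choices : Finset (Fin I.n → ℕ) := Fintype.piFinset fun v => I.options v

theorem mem_options {v e : ℕ} : e ∈ I.options v ↔ e = 0 ∨ (e ≤ I.m ∧ I.InnerAt v e) := by
  simp only [options, Finset.mem_filter, Finset.mem_range, Nat.lt_succ_iff]
  constructor
  · rintro ⟨h, rfl | h'⟩
    exacts [Or.inl rfl, Or.inr ⟨h, h'⟩]
  · rintro (rfl | h)
    exacts [⟨Nat.zero_le _, Or.inl rfl⟩, ⟨h.1, Or.inr h.2⟩]

theorem mem_choices {cur : ℕ → ℕ} : (fun v : Fin I.n => cur v) ∈ I.choices ↔ I.Choice cur := by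
  simp only [choices, Fintype.mem_piFinset, mem_options, Choice, or_iff_not_imp_left]
  exact ⟨fun h v hv => h ⟨v, hv⟩, fun h v => h v v.2⟩

open Classical in
theorem findGreatest_mem_options (v k : ℕ) (hk : k ≤ I.m) :
    Nat.findGreatest (I.InnerAt v) k ∈ I.options v := by
  rw [mem_options]
  by_cases h : Nat.findGreatest (I.InnerAt v) k = 0
  · exact Or.inl h
  · exact Or.inr ⟨(Nat.findGreatest_le k).trans hk, Nat.findGreatest_of_ne_zero rfl h⟩

theorem Choice.next {cur : ℕ → ℕ} (h : I.Choice cur) : I.Choice (I.next cur) := by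
  intro v hv
  have hm := fun k hk => or_iff_not_imp_left.1 (mem_options.1 (findGreatest_mem_options (I := I) v k hk))
  unfold Instance.next
  split_ifs with h1 h2
  · exact hm _ le_rfl
  · refine hm _ ?_
    have := (h v hv h2).1
    omega
  · exact h v hv

variable (I) in
/-- The restriction to the vertices, with the colexicographic order. -/
def toCol (cur : ℕ → ℕ) : Colex (Fin I.n → ℕ) := toColex fun v : Fin I.n => cur v

theorem next_lt {cur : ℕ → ℕ} (h : ∃ v < I.n, cur v ≠ 0) :
    I.toCol (I.next cur) < I.toCol cur := by
  classical
  have hspec := Nat.find_spec h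
  set z := Nat.find h
  refine ⟨⟨z, hspec.1⟩, fun j hj => ?_, ?_⟩
  · have : z < j := hj
    change I.next cur j = cur j
    rw [Instance.next, if_neg]
    exact fun h' => hspec.2 (h' z this)
  · change I.next cur z < cur z
    rw [Instance.next, if_pos, if_neg hspec.2]
    · exact lt_of_le_of_lt (Nat.findGreatest_le _) (Nat.sub_lt (Nat.pos_of_ne_zero hspec.2) one_pos)
    · intro w hw
      by_contra h0
      exact Nat.find_min h hw ⟨hw.trans hspec.1, h0⟩

/-- `next` skips no choice. Let `i` be the last position at which `g` and `cur` differ. If `cur`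
vanishes before `i`, then `next` takes the largest possible values at and before `i`, so it
dominates `g` entrywise. Otherwise `next` does not change position `i`, where `cur` already exceeds
`g`. -/
theorem le_next {cur g : ℕ → ℕ} (hg : I.Choice g) (hlt : I.toCol g < I.toCol cur) :
    I.toCol g ≤ I.toCol (I.next cur) := by
  classical
  obtain ⟨i, hi, hi'⟩ := hlt
  change ∀ j : Fin I.n, i < j → g j = cur j at hi
  change g i < cur i at hi'
  have hi0 : cur i ≠ 0 := by omega
  have hgt : ∀ j : Fin I.n, i < j → g j = I.next cur j := fun j hj => by
    rw [hi j hj, Instance.next, if_neg]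
    exact fun h => hi0 (h i hj)
  by_cases hz : ∀ w < (i : ℕ), cur w = 0
  · refine Pi.toColex_monotone fun j => ?_
    have hopt : ∀ k, g j ≤ k → g j ≤ Nat.findGreatest (I.InnerAt j) k := fun k hk => by
      by_cases h0 : g j = 0
      · omega
      · exact Nat.le_findGreatest hk (hg j j.2 h0).2
    change g j ≤ I.next cur j
    rcases lt_trichotomy i j with hij | rfl | hij
    · exact (hgt j hij).le
    · rw [Instance.next, if_pos hz, if_neg hi0]
      exact hopt _ (by omega)
    · rw [Instance.next, if_pos fun w hw => hz w (hw.trans hij), if_pos (hz j hij)]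
      refine hopt _ ?_
      by_cases h0 : g j = 0
      · omega
      · exact (hg j j.2 h0).1
  · refine le_of_lt ⟨i, hgt, ?_⟩
    change g i < I.next cur i
    rwa [Instance.next, if_neg hz]

open Classical in
-- The carry survives all vertices exactly if every entry is zero, which is the last choice in this
-- order; the array then wraps round, but register `10` stops the enumeration.
theorem runs_advance (hs : I.Loaded s) (hc : I.Choice (s.mem 12)) :
    Runs advance s (100 * (I.n + I.m + 1)) fun s' =>
      (∀ v < I.n, s'.mem 12 v = I.next (s.mem 12) v) ∧
      (s'.reg 10 = 0 ↔ ∀ v < I.n, s.mem 12 v = 0) := by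
  set cur := s.mem 12 with hcur
  refine Runs.seq (R := fun s' => s' = s.setReg 11 1) (Runs.of_straight rfl le_rfl rfl)
    (fun s₁ h₁ f₁ => ?_) (T₂ := I.n * 60 + 10) (by simp only [Prog.time, Expr.cost]; omega)
  have l₁ := hs.frame (by rfl) f₁
  have e12 : s₁.mem 12 = cur := f₁.mem 12 rfl
  refine Runs.seq (T₁ := I.n * 60 + 5) (T₂ := 5) (R := fun s' =>
      (∀ v, s'.mem 12 v = if v < I.n then I.next cur v else cur v) ∧
      (s'.reg 11 = 1 ∧ (∀ v < I.n, cur v = 0) ∨ s'.reg 11 = 0 ∧ ¬ ∀ v < I.n, cur v = 0))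
      ?_ (fun s₂ h₂ f₂ => ?_) (by omega)
  · refine (Runs.forLoop s₁ (fun k s' =>
      (∀ v, s'.mem 12 v = if v < k then I.next cur v else cur v) ∧
      (s'.reg 11 = 1 ∧ (∀ v < k, cur v = 0) ∨ s'.reg 11 = 0 ∧ ¬ ∀ v < k, cur v = 0)) 53 rfl rfl
      (by decide) ?_ fun k s₂ hk hi hf hk' => ?_).mono (by rw [l₁.reg_n]) fun s' h _ => by
        rwa [l₁.reg_n] at h
    · subst h₁; simp [hcur]
    · rw [l₁.reg_n] at hk
      have hl := l₁.frame (by rfl) hf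
      obtain ⟨hA, hB⟩ := hk'
      have hAk : s₂.mem 12 k = cur k := by simp [hA]
      refine Runs.of_straight rfl (by decide) ?_
      intro _
      have hforall : (∀ v < k + 1, cur v = 0) ↔ (∀ v < k, cur v = 0) ∧ cur k = 0 := by
        constructor
        · exact fun h => ⟨fun v hv => h v (by omega), h k (by omega)⟩
        · rintro ⟨h, h'⟩ v hv
          rcases Nat.lt_succ_iff_lt_or_eq.1 hv with hv | rfl
          exacts [h v hv, h']
      rw [hforall]
      have hmain : ∀ x, x = I.next cur k → ∀ v, (if v = k then x else s₂.mem 12 v) =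
          if v < k + 1 then I.next cur v else cur v := by
        rintro x rfl v
        rw [hA v]
        rcases lt_trichotomy v k with h | rfl | h
        · rw [if_neg h.ne, if_pos h, if_pos (by omega)]
        · rw [if_pos rfl, if_pos (by omega)]
        · rw [if_neg h.ne', if_neg (by omega), if_neg (by omega)]
      rcases hB with ⟨h11, hz⟩ | ⟨h11, hz⟩
      · by_cases h0 : cur k = 0
        · have := hmain _ (show Nat.findGreatest (I.InnerAt k) I.m = I.next cur k by
            rw [Instance.next, if_pos hz, if_pos h0])
          simpa [Prog.run, Expr.eval, hi, h11, hAk, h0, hl.last_inner, hz] using And.intro this hz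
        · obtain ⟨hm, hin⟩ := hc k hk h0
          have hp := hl.prev_inner _ (Nat.pos_of_ne_zero h0) hm hin.1
          have := hmain _ (show Nat.findGreatest (I.InnerAt k) (cur k - 1) = I.next cur k by
            rw [Instance.next, if_pos hz, if_neg h0])
          rw [hin.2] at hp
          simpa [Prog.run, Expr.eval, hi, h11, hAk, Nat.pos_of_ne_zero h0, hp, h0] using this
      · have := hmain _ (show s₂.mem 12 k = I.next cur k by rw [Instance.next, if_neg hz, hAk])
        have hne : ∀ v, (if v = k then s₂.mem 12 k else s₂.mem 12 v) = s₂.mem 12 v := fun v => by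
          split_ifs with h
          · rw [h]
          · rfl
        simp only [hne] at this
        simp only [Prog.run, Expr.eval, h11, lt_self_iff_false, if_false, State.setReg_mem,
          State.setReg_reg]
        exact ⟨this, Or.inr ⟨by simp, fun h => hz h.1⟩⟩
  · refine Runs.of_straight rfl (by decide) ?_
    refine ⟨fun v hv => ?_, ?_⟩
    · have := h₂.1 v
      rw [if_pos hv] at this
      simpa [Prog.run] using this
    · rcases h₂.2 with ⟨h, h'⟩ | ⟨h, h'⟩
      · simp only [Prog.run, Expr.eval, h]
        simpa using h'
      · simp only [Prog.run, Expr.eval, h]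
        simpa using h'

open Classical in
theorem runs_firstChoice (hs : I.Loaded s) :
    Runs firstChoice s (100 * (I.n + I.m + 1)) fun s' =>
      (∀ v < I.n, s'.mem 16 v = s.mem 13 v) ∧
      (∀ v < I.n, s'.mem 12 v = Nat.findGreatest (I.InnerAt v) I.m) ∧ s'.reg 10 = 1 := by
  refine Runs.seq (T₁ := I.n * 40 + 5) (T₂ := I.n * 40 + 10) (R := fun s' =>
    ∀ v < I.n, s'.mem 16 v = s.mem 13 v) ?_ (fun s₁ h₁ f₁ => ?_) (by omega)
  · refine (Runs.forLoop s (fun k s' => ∀ v < k, s'.mem 16 v = s.mem 13 v) 13 rfl rfl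
      (by decide) ?_ fun k s₁ hk hi hf hk' => ?_).mono (by rw [hs.reg_n]; omega) fun s' h _ => by
        rwa [hs.reg_n] at h
    · simp
    · have e13 : s₁.mem 13 = s.mem 13 := hf.mem 13 rfl
      refine Runs.of_straight rfl (by decide) ?_
      intro _ v hv
      simp [Prog.run, Expr.eval, hi, e13]
      split_ifs with h
      · rw [h]
      · exact hk' v (by omega)
  have l₁ := hs.frame (by rfl) f₁
  refine Runs.seq (T₁ := I.n * 40 + 5) (T₂ := 5) (R := fun s' =>
    ∀ v < I.n, s'.mem 12 v = Nat.findGreatest (I.InnerAt v) I.m) ?_ (fun s₂ h₂ f₂ => ?_) (by omega)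
  · refine (Runs.forLoop s₁ (fun k s' => ∀ v < k, s'.mem 12 v =
      Nat.findGreatest (I.InnerAt v) I.m) 13 rfl rfl
      (by decide) ?_ fun k s₁ hk hi hf hk' => ?_).mono (by rw [l₁.reg_n]; omega) fun s' h _ => by
        rwa [l₁.reg_n] at h
    · simp
    · have hl := l₁.frame (by rfl) hf
      refine Runs.of_straight rfl (by decide) ?_
      intro _ v hv
      simp [Prog.run, Expr.eval, hi, hl.last_inner]
      split_ifs with h
      · rw [h]
      · exact hk' v (by omega)
  · refine Runs.of_straight rfl (by decide) ?_
    simp [Prog.run, Expr.eval, f₂.mem 16 rfl]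
    exact ⟨h₁, h₂⟩

variable (I) in
/-- The vertices that own inner edges. -/
noncomputable def innerOwners : Finset ℕ := by
  classical exact (Finset.range I.n).filter fun v => ∃ e, 1 ≤ e ∧ e ≤ I.m ∧ I.InnerAt v e

theorem Choice.size_le {cur : ℕ → ℕ} (h : I.Choice cur) : I.size cur ≤ I.innerOwners.card := by
  classical
  refine Finset.card_le_card fun v hv => ?_
  simp only [Finset.mem_filter, Finset.mem_range, innerOwners] at hv ⊢
  exact ⟨hv.1, cur v, Nat.pos_of_ne_zero hv.2, h v hv.1 hv.2⟩

open Classical in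
theorem runs_choices (hs : I.Loaded s) (hV : I.Valid) (hM : I.Maximum 0 0 (s.mem 16))
    (hR : I.Recorded s) (hcur : ∀ v < I.n, s.mem 12 v = Nat.findGreatest (I.InnerAt v) I.m)
    (h10 : s.reg 10 = 1) :
    Runs (loop (lit 0) (reg 10) (consider ;; advance)) s
      (4000 * (I.choices.card + 1) * ((I.innerOwners.card + 1) * (I.n + I.m + 1))) fun s' =>
      I.Recorded s' ∧ ∀ cur N, I.Compatible cur N → I.size cur + I.size N ≤ s'.reg 9 := by
  classical
  let rest : State → Finset (Fin I.n → ℕ) := fun s' =>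
    I.choices.filter fun g => toColex g ≤ I.toCol (s'.mem 12)
  have hchoice : I.Choice (s.mem 12) := by
    intro v hv h0
    rw [hcur v hv] at h0 ⊢
    exact ⟨Nat.findGreatest_le _, Nat.findGreatest_of_ne_zero rfl h0⟩
  set T := (I.innerOwners.card + 1) * (I.n + I.m + 1) with hT
  have hTpos : 0 < T := by positivity
  -- Invariant: every choice that is not colexicographically at most the current one has been dealt
  -- with, so register `9` is at least the size of all its completions. The measure counts the
  -- remaining choices, the current one included; when register `10` is `0` none remain.
  refine (Runs.loop s (fun s' => I.Choice (s'.mem 12) ∧ I.Recorded s' ∧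
    ∀ cur N, I.Compatible cur N → (s'.reg 10 ≠ 0 → ¬ I.toCol cur ≤ I.toCol (s'.mem 12)) →
      I.size cur + I.size N ≤ s'.reg 9)
    (fun s' => if s'.reg 10 = 0 then 0 else (rest s').card) (3200 * T)
    (fun s₀ hf hI hlt => ?_) ?_).mono ?_ ?_
  · obtain ⟨hc, hR, hdone⟩ := hI
    have l₀ := hs.frame (by rfl) hf
    have e16 : s₀.mem 16 = s.mem 16 := hf.mem 16 rfl
    have h10' : s₀.reg 10 ≠ 0 := by simpa [Expr.eval, Nat.pos_iff_ne_zero] using hlt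
    have hsz := hc.size_le
    refine Runs.seq (runs_consider l₀ hV hc (e16 ▸ hM) hR) (fun s₁ h₁ f₁ => ?_) (T₂ := 100 * T) ?_
    swap
    · have : (I.size (s₀.mem 12) + 1) * (I.n + I.m + 1) ≤ T := Nat.mul_le_mul (by omega) le_rfl
      nlinarith
    obtain ⟨hR₁, h9, hnew⟩ := h₁
    have l₁ := l₀.frame (by rfl) f₁
    have e12 : s₁.mem 12 = s₀.mem 12 := f₁.mem 12 rfl
    refine (runs_advance l₁ (e12 ▸ hc)).mono ?_ fun s₂ h₂ f₂ => ?_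
    · exact Nat.mul_le_mul_left _ (Nat.le_mul_of_pos_left _ (Nat.succ_pos _))
    rw [e12] at h₂
    have e9 : s₂.reg 9 = s₁.reg 9 := f₂.reg 9 rfl
    have e3 : s₂.mem 3 = s₁.mem 3 := f₂.mem 3 rfl
    have hcol : I.toCol (s₂.mem 12) = I.toCol (I.next (s₀.mem 12)) := by
      unfold toCol
      congr 1
      funext v
      exact h₂.1 v v.2
    have hc₂ : I.Choice (s₂.mem 12) := by
      rw [← mem_choices, show (fun v : Fin I.n => s₂.mem 12 v) =
        fun v : Fin I.n => I.next (s₀.mem 12) v from funext fun v => h₂.1 v v.2, mem_choices]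
      exact hc.next
    refine ⟨⟨hc₂, ?_, fun cur N hN hrest => ?_⟩, ?_⟩
    · simpa [Recorded, e9, e3] using hR₁
    · rw [e9]
      by_cases heq : I.toCol cur = I.toCol (s₀.mem 12)
      · have hcv : ∀ v < I.n, cur v = s₀.mem 12 v := fun v hv =>
          congrFun (toColex.injective heq) ⟨v, hv⟩
        rw [size_congr hcv]
        refine hnew N ⟨hc, ?_, hN.matching.congr (fun v _ => ?_) (fun e _ _ => ?_) fun _ _ => rfl⟩
        · intro v hv w hw
          rw [← hcv v hv, ← hcv w hw]
          exact hN.admissible v hv w hw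
        · rw [blockedVertices_eq_zero, blockedVertices_eq_zero]
          rintro h ⟨w, hw, hw'⟩
          exact h ⟨w, hw, by rwa [hcv w hw]⟩
        · rw [blockedColors_eq_zero, blockedColors_eq_zero]
          rintro h ⟨w, hw, hw'⟩
          exact h ⟨w, hw, by rwa [hcv w hw]⟩
      · refine (hdone cur N hN fun _ hle => ?_).trans h9
        have hlt := lt_of_le_of_ne hle heq
        by_cases hz : s₂.reg 10 = 0
        · rw [h₂.2] at hz
          obtain ⟨i, -, hi⟩ := hlt
          change cur i < s₀.mem 12 i at hi
          rw [hz i i.2] at hi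
          exact absurd hi (Nat.not_lt_zero _)
        · refine hrest hz ?_
          rw [hcol]
          exact le_next hN.choice hlt
    · have hmem : (fun v : Fin I.n => s₀.mem 12 v) ∈ rest s₀ :=
        Finset.mem_filter.2 ⟨mem_choices.2 hc, le_rfl⟩
      rw [if_neg h10']
      split_ifs with hz
      · exact Finset.card_pos.2 ⟨_, hmem⟩
      · refine Finset.card_lt_card ?_
        have hlt' := next_lt (I := I) (cur := s₀.mem 12) (by
          rw [h₂.2] at hz
          push Not at hz
          exact hz)
        rw [Finset.ssubset_iff_of_subset]
        · refine ⟨_, hmem, fun h => ?_⟩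
          have := (Finset.mem_filter.1 h).2
          rw [hcol] at this
          exact absurd this (not_le.2 hlt')
        · intro g hg
          rw [Finset.mem_filter] at hg ⊢
          rw [hcol] at hg
          exact ⟨hg.1, hg.2.trans hlt'.le⟩
  · refine ⟨hchoice, hR, fun cur N hN h => absurd (Pi.toColex_monotone fun v => ?_) (h (by omega))⟩
    change cur v ≤ s.mem 12 v
    rw [hcur v v.2]
    by_cases h0 : cur v = 0
    · omega
    · obtain ⟨h1, h2⟩ := hN.choice v v.2 h0
      exact Nat.le_findGreatest h1 h2
  · have h1 : (if s.reg 10 = 0 then 0 else (rest s).card) ≤ I.choices.card := by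
      split_ifs
      · omega
      · exact Finset.card_filter_le _ _
    simp only [Expr.cost]
    have h2 := Nat.mul_le_mul_right (3200 * T + (1 + 1 + 1)) h1
    nlinarith [Nat.zero_le (I.choices.card * T)]
  · rintro s' ⟨⟨-, hR', h⟩, hlt⟩ -
    have h10'' : s'.reg 10 = 0 := by simpa [Expr.eval] using hlt
    exact ⟨hR', fun cur N hN => h cur N hN fun h => absurd h10'' h⟩

/-- The part of the algorithm after preprocessing. -/
theorem runs_main (hs : I.Loaded s) (hV : I.Valid) (h3 : s.mem 3 = 0) (h9 : s.reg 9 = 0)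
    (h13 : s.mem 13 = 0) (h14 : s.mem 14 = 0) (h15 : s.mem 15 = 0) :
    Runs (maximize ;; firstChoice ;; loop (lit 0) (reg 10) (consider ;; advance)) s
      (1000 * (I.n + I.m + 1) ^ 2 +
        4000 * (I.choices.card + 1) * ((I.innerOwners.card + 1) * (I.n + I.m + 1))) fun s' =>
      ∃ cur N, I.Compatible cur N ∧
        (∀ i < I.m, s'.mem 3 i ≠ 0 ↔ ∃ v < I.n, cur v = i + 1 ∨ N v = i + 1) ∧
        ∀ cur' N', I.Compatible cur' N' → I.size cur' + I.size N' ≤ I.size cur + I.size N := by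
  have hemp : ∀ bh bc, I.Matching bh bc 0 :=
    fun bh bc => ⟨fun v _ h => absurd rfl h, fun v _ w _ h => absurd rfl h⟩
  -- Starting from the empty matching, the deficit is only bounded by `n`; this single run causes
  -- the quadratic term.
  refine Runs.seq (runs_maximize hs (by rw [h13]; exact hemp _ _) I.n fun N _ => ?_)
    (fun s₁ h₁ f₁ => ?_)
    (T₂ := 100 * (I.n + I.m + 1) +
      4000 * (I.choices.card + 1) * ((I.innerOwners.card + 1) * (I.n + I.m + 1))) ?_
  · refine le_add_left ((Finset.card_filter_le _ _).trans ?_)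
    simp
  swap
  · nlinarith [Nat.zero_le (I.n * I.m), Nat.zero_le (I.m * I.m), Nat.zero_le (I.n * I.n)]
  have l₁ := hs.frame (by rfl) f₁
  rw [h14, h15] at h₁
  refine Runs.seq (runs_firstChoice l₁) (fun s₂ h₂ f₂ => ?_) le_rfl
  have l₂ := l₁.frame (by rfl) f₂
  obtain ⟨h16, h12, h10⟩ := h₂
  refine (runs_choices l₂ hV ?_ ?_ h12 h10).mono le_rfl ?_
  · refine ⟨h₁.1.congr (fun _ _ => id) (fun _ _ _ => id) h16, fun N hN => ?_⟩
    rw [size_congr h16]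
    exact h₁.2 N hN
  · refine ⟨0, 0, ⟨fun v _ h => absurd rfl h, fun v _ w _ _ h => absurd rfl h, hemp _ _⟩, ?_,
      fun i _ => ?_⟩
    · rw [f₂.reg 9 rfl, f₁.reg 9 rfl, h9]
      simp [size]
    · rw [f₂.mem 3 rfl, f₁.mem 3 rfl, h3]
      simp
  · rintro s' ⟨⟨cur, N, hC, hsz, hout⟩, hbest⟩ -
    exact ⟨cur, N, hC, hout, fun cur' N' h' => hsz ▸ hbest cur' N' h'⟩

end Instance
end RainbowMatching

namespace RainbowMatching

open RAM RAM.Expr RAM.Prog Algorithm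

/-! ### Preprocessing -/

/-- The edges of a graph on `{0, …, n - 1}`, with their ends and colors. -/
structure EdgeArrays where
  n : ℕ
  m : ℕ
  src : ℕ → ℕ
  dst : ℕ → ℕ
  col : ℕ → ℕ

namespace EdgeArrays

variable (A : EdgeArrays)

open Classical in
/-- The number of edges among the first `k` ones that satisfy `p` and have the end `v`. -/
noncomputable def incident (p : ℕ → Prop) (k v : ℕ) : ℕ :=
  ((Finset.range k).filter fun j => p j ∧ (A.src j = v ∨ A.dst j = v)).card

noncomputable def deg (v : ℕ) : ℕ := A.incident (fun _ => True) A.m v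

/-- Both ends have degree at least two. -/
def IsInner (j : ℕ) : Prop := 1 < A.deg (A.src j) ∧ 1 < A.deg (A.dst j)

noncomputable def innerDeg (v : ℕ) : ℕ := A.incident A.IsInner A.m v

/-- The second end owns the edge. -/
def Swapped (j : ℕ) : Prop :=
  (A.IsInner j ∧ A.innerDeg (A.src j) < 2) ∨ (¬ A.IsInner j ∧ A.deg (A.src j) < 2)

open Classical in
noncomputable def inst : Instance where
  n := A.n
  m := A.m
  own e := if A.Swapped (e - 1) then A.dst (e - 1) else A.src (e - 1)
  oth e := if A.Swapped (e - 1) then A.src (e - 1) else A.dst (e - 1)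
  clr e := A.col (e - 1)
  inner e := A.IsInner (e - 1)

structure Valid : Prop where
  src_lt : ∀ j < A.m, A.src j < A.n
  dst_lt : ∀ j < A.m, A.dst j < A.n
  ne : ∀ j < A.m, A.src j ≠ A.dst j

variable {A}

/-- Without loops the program's two increments never count an edge twice at the same vertex. -/
theorem incident_succ (p : ℕ → Prop) (k v : ℕ) [Decidable (p k)] (hne : A.src k ≠ A.dst k) :
    A.incident p (k + 1) v = A.incident p k v +
      if p k then (if A.src k = v then 1 else 0) + (if A.dst k = v then 1 else 0) else 0 := by
  classical
  rw [incident, incident, Finset.range_add_one, Finset.filter_insert]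
  by_cases hp : p k
  · by_cases h1 : A.src k = v
    · have h2 : A.dst k ≠ v := fun h => hne (h1.trans h.symm)
      simp [hp, h1, h2]
    · by_cases h2 : A.dst k = v <;> simp [hp, h1, h2]
  · simp [hp]

theorem endOf_inst {v e : ℕ} :
    A.inst.EndOf v e ↔ A.src (e - 1) = v ∨ A.dst (e - 1) = v := by
  simp only [Instance.EndOf, inst]
  split_ifs
  · exact or_comm
  · rfl

theorem one_lt_incident {p : ℕ → Prop} {i j k v : ℕ} (hi : i < k) (hj : j < k) (hij : i ≠ j)
    (hpi : p i) (hpj : p j) (h : A.src i = v ∨ A.dst i = v) (h' : A.src j = v ∨ A.dst j = v) :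
    1 < A.incident p k v := by
  classical
  exact Finset.one_lt_card.2 ⟨i, by simp [hi, hpi, h], j, by simp [hj, hpj, h'], hij⟩

/-- The point is `own_eq`: two edges at `v` give `v` degree at least two, so the other end of a
pendant edge at `v` has degree less than two, and the rule for pendant edges selects `v`. -/
theorem Valid.inst (h : A.Valid) : A.inst.Valid := by
  refine ⟨fun e h1 h2 => ?_, fun e h1 h2 => ?_, fun e f v he1 hem hf1 hfm hef hin he hf => ?_⟩
  · simp only [EdgeArrays.inst] at *
    split_ifs
    exacts [h.dst_lt _ (by omega), h.src_lt _ (by omega)]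
  · simp only [EdgeArrays.inst] at *
    split_ifs
    exacts [h.src_lt _ (by omega), h.dst_lt _ (by omega)]
  · rw [endOf_inst] at he hf
    have hem' : e ≤ A.m := hem
    have hfm' : f ≤ A.m := hfm
    have hdeg : 1 < A.deg v := one_lt_incident (i := e - 1) (j := f - 1) (by omega) (by omega)
      (by omega) trivial trivial he hf
    have hin' : ¬ A.IsInner (e - 1) := hin
    have hsw : A.Swapped (e - 1) ↔ A.deg (A.src (e - 1)) < 2 := by simp [Swapped, hin']
    simp only [EdgeArrays.inst, hsw]
    by_cases hs : A.src (e - 1) = v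
    · rw [if_neg (by rw [hs]; omega), hs]
    · have hd := he.resolve_left hs
      rw [if_pos, hd]
      by_contra hc
      exact hin' ⟨by omega, by rwa [hd]⟩

variable {s : State}

variable (A) in
/-- The memory holds the edges. -/
structure Loaded (s : State) : Prop where
  reg_n : s.reg 0 = A.n
  reg_m : s.reg 1 = A.m
  src : ∀ j < A.m, s.mem 0 j = A.src j
  dst : ∀ j < A.m, s.mem 1 j = A.dst j
  col : ∀ j < A.m, s.mem 2 j = A.col j

/-- Does the program leave the memory cells alone that hold the edges? -/
def _root_.RAM.Prog.keepsEdges (p : Prog) : Bool :=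
  !p.setsReg 0 && !p.setsReg 1 && !p.setsMem 0 && !p.setsMem 1 && !p.setsMem 2

theorem Loaded.frame {s s' : State} (h : A.Loaded s) {p : Prog} (hp : p.keepsEdges = true)
    (hf : Frame p s s') : A.Loaded s' := by
  simp only [RAM.Prog.keepsEdges, Bool.and_eq_true, Bool.not_eq_true'] at hp
  obtain ⟨⟨⟨⟨h0, h1⟩, h2⟩, h3⟩, h4⟩ := hp
  have e0 := hf.reg _ h0
  have e1 := hf.reg _ h1
  have e2 := hf.mem _ h2
  have e3 := hf.mem _ h3
  have e4 := hf.mem _ h4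
  constructor <;> simp only [e0, e1, e2, e3, e4]
  exacts [h.reg_n, h.reg_m, h.src, h.dst, h.col]

theorem runs_degrees (hs : A.Loaded s) (hV : A.Valid) (h4 : s.mem 4 = 0) :
    Runs degrees s (100 * (A.n + A.m + 1)) fun s' => ∀ v, s'.mem 4 v = A.deg v := by
  classical
  refine (Runs.forLoop s (fun k s' => ∀ v, s'.mem 4 v = A.incident (fun _ => True) k v) 33 rfl rfl
    (by decide) ?_ fun k s₁ hk hi hf hk' => ?_).mono (by rw [hs.reg_m]; omega) fun s' h _ => by
        rwa [hs.reg_m] at h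
  · simp [h4, incident]
  · rw [hs.reg_m] at hk
    have hl := hs.frame (by rfl) hf
    have hne := hV.ne k hk
    refine Runs.of_straight rfl (by decide) ?_
    intro _ v
    rw [incident_succ _ _ _ hne, ← hk' v]
    simp [Prog.run, Expr.eval, hi, hl.src k hk, hl.dst k hk]
    grind

theorem runs_innerDegrees (hs : A.Loaded s) (hV : A.Valid) (h4 : ∀ v, s.mem 4 v = A.deg v)
    (h5 : s.mem 5 = 0) :
    Runs innerDegrees s (100 * (A.n + A.m + 1)) fun s' => ∀ v, s'.mem 5 v = A.innerDeg v := by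
  classical
  refine (Runs.forLoop s (fun k s' => ∀ v, s'.mem 5 v = A.incident A.IsInner k v) 53 rfl rfl
    (by decide) ?_ fun k s₁ hk hi hf hk' => ?_).mono (by rw [hs.reg_m]; omega) fun s' h _ => by
        rwa [hs.reg_m] at h
  · simp [h5, incident]
  · rw [hs.reg_m] at hk
    have hl := hs.frame (by rfl) hf
    have hne := hV.ne k hk
    have e4 : ∀ v, s₁.mem 4 v = A.deg v := by rwa [hf.mem 4 rfl]
    refine Runs.of_straight rfl (by decide) ?_
    intro _ v
    rw [incident_succ _ _ _ hne, ← hk' v]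
    by_cases h1 : 1 < A.deg (A.src k) <;> by_cases h2 : 1 < A.deg (A.dst k) <;>
      simp [Prog.run, Expr.eval, hi, hl.src k hk, hl.dst k hk, e4, h1, h2, IsInner]
    grind

open Classical in
variable (A) in
/-- The tables of the instance are correct for the edges up to `k`. -/
structure LoadedUpTo (k : ℕ) (s : State) : Prop where
  own : ∀ e, 1 ≤ e → e ≤ k → s.mem 6 e = A.inst.own e
  oth : ∀ e, 1 ≤ e → e ≤ k → s.mem 7 e = A.inst.oth e
  clr : ∀ e, 1 ≤ e → e ≤ k → s.mem 8 e = A.inst.clr e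
  last_inner : ∀ v, s.mem 9 v = Nat.findGreatest (A.inst.InnerAt v) k
  last_pend : ∀ v, s.mem 10 v = Nat.findGreatest (A.inst.PendAt v) k
  prev_inner : ∀ e, 1 ≤ e → e ≤ k → A.inst.inner e →
    s.mem 11 e = Nat.findGreatest (A.inst.InnerAt (A.inst.own e)) (e - 1)
  prev_pend : ∀ e, 1 ≤ e → e ≤ k → ¬ A.inst.inner e →
    s.mem 11 e = Nat.findGreatest (A.inst.PendAt (A.inst.own e)) (e - 1)

theorem forall_le_succ {p : ℕ → Prop} {k : ℕ} (h : ∀ e, 1 ≤ e → e ≤ k → p e) (h' : p (k + 1)) :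
    ∀ e, 1 ≤ e → e ≤ k + 1 → p e := by
  intro e h1 h2
  rcases Nat.lt_succ_iff_lt_or_eq.1 (Nat.lt_succ_iff.2 h2) with h3 | rfl
  exacts [h e h1 (by omega), h']

theorem LoadedUpTo.step {k : ℕ} (hs : A.Loaded s) (h4 : ∀ v, s.mem 4 v = A.deg v)
    (h5 : ∀ v, s.mem 5 v = A.innerDeg v) (h : A.LoadedUpTo k s) (hk : k < A.m)
    (h2 : s.reg 2 = k) : A.LoadedUpTo (k + 1) (ownersBody.run s) := by
  classical
  have hs0 := hs.src k hk
  have hs1 := hs.dst k hk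
  have hs2 := hs.col k hk
  have hown : A.inst.own (k + 1) = if A.Swapped k then A.dst k else A.src k := rfl
  have hoth : A.inst.oth (k + 1) = if A.Swapped k then A.src k else A.dst k := rfl
  have hclr : A.inst.clr (k + 1) = A.col k := rfl
  have hinn : A.inst.inner (k + 1) ↔ A.IsInner k := Iff.rfl
  have key : (ownersBody.run s).mem 6 = Function.update (s.mem 6) (k + 1) (A.inst.own (k + 1)) ∧
      (ownersBody.run s).mem 7 = Function.update (s.mem 7) (k + 1) (A.inst.oth (k + 1)) ∧
      (ownersBody.run s).mem 8 = Function.update (s.mem 8) (k + 1) (A.inst.clr (k + 1)) ∧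
      (ownersBody.run s).mem 9 = (if A.IsInner k then
        Function.update (s.mem 9) (A.inst.own (k + 1)) (k + 1) else s.mem 9) ∧
      (ownersBody.run s).mem 10 = (if A.IsInner k then s.mem 10 else
        Function.update (s.mem 10) (A.inst.own (k + 1)) (k + 1)) ∧
      (ownersBody.run s).mem 11 = Function.update (s.mem 11) (k + 1) (if A.IsInner k then
        s.mem 9 (A.inst.own (k + 1)) else s.mem 10 (A.inst.own (k + 1))) := by
    rw [hown, hoth, hclr]
    by_cases h1 : 1 < A.deg (A.src k)
    · have h1' : ¬ A.deg (A.src k) < 2 := by omega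
      by_cases h2' : 1 < A.deg (A.dst k)
      · by_cases h3 : A.innerDeg (A.src k) < 2 <;>
        simp [ownersBody, Prog.run, Expr.eval, h2, hs0, hs1, hs2, h4, h5, h1, h2', h3, Swapped,
          IsInner, State.setMem_mem]
      · simp [ownersBody, Prog.run, Expr.eval, h2, hs0, hs1, hs2, h4, h1, h1', h2', Swapped,
          IsInner, State.setMem_mem]
    · have h1' : A.deg (A.src k) < 2 := by omega
      simp [ownersBody, Prog.run, Expr.eval, h2, hs0, hs1, hs2, h4, h1, h1', Swapped,
        IsInner, State.setMem_mem]
  obtain ⟨k6, k7, k8, k9, k10, k11⟩ := key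
  have hup : ∀ {f : ℕ → ℕ} {x e : ℕ}, e ≤ k → Function.update f (k + 1) x e = f e :=
    fun he => Function.update_of_ne (by omega) _ _
  refine ⟨forall_le_succ (fun e he1 he => ?_) ?_, forall_le_succ (fun e he1 he => ?_) ?_,
    forall_le_succ (fun e he1 he => ?_) ?_, fun v => ?_, fun v => ?_,
    forall_le_succ (fun e he1 he hin => ?_) fun hin => ?_,
    forall_le_succ (fun e he1 he hin => ?_) fun hin => ?_⟩
  · rw [k6, hup he, h.own e he1 he]
  · rw [k6, Function.update_self]
  · rw [k7, hup he, h.oth e he1 he]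
  · rw [k7, Function.update_self]
  · rw [k8, hup he, h.clr e he1 he]
  · rw [k8, Function.update_self]
  · rw [k9, Nat.findGreatest_succ, Instance.InnerAt, hinn, ← h.last_inner v]
    by_cases hi : A.IsInner k
    · simp only [hi, if_true, true_and, Function.update_apply, eq_comm]
    · simp [hi]
  · rw [k10, Nat.findGreatest_succ, Instance.PendAt, hinn, ← h.last_pend v]
    by_cases hi : A.IsInner k
    · simp [hi]
    · simp only [hi, if_false, not_false_eq_true, true_and, Function.update_apply, eq_comm]
  · rw [k11, hup he, h.prev_inner e he1 he hin]
  · rw [k11, Function.update_self, if_pos (hinn.1 hin), h.last_inner, Nat.add_sub_cancel]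
  · rw [k11, hup he, h.prev_pend e he1 he hin]
  · rw [k11, Function.update_self, if_neg (mt hinn.2 hin), h.last_pend, Nat.add_sub_cancel]

theorem runs_preprocess (hs : A.Loaded s) (hV : A.Valid) (h4 : s.mem 4 = 0) (h5 : s.mem 5 = 0)
    (h9 : s.mem 9 = 0) (h10 : s.mem 10 = 0) :
    Runs preprocess s (400 * (A.n + A.m + 1)) fun s' => A.inst.Loaded s' := by
  classical
  refine Runs.seq (runs_degrees hs hV h4) (fun s₁ h₁ f₁ => ?_) (T₂ := 300 * (A.n + A.m + 1))
    (by omega)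
  have l₁ := hs.frame (by rfl) f₁
  refine Runs.seq (runs_innerDegrees l₁ hV h₁ ((f₁.mem 5 rfl).trans h5)) (fun s₂ h₂ f₂ => ?_)
    (T₂ := 200 * (A.n + A.m + 1)) (by omega)
  have l₂ := l₁.frame (by rfl) f₂
  refine (Runs.forLoop s₂ (fun k s' => A.LoadedUpTo k s') 153 rfl rfl
    (by decide) ?_ fun k s₃ hk hi hf hk' => ?_).mono (by rw [l₂.reg_m]; omega) fun s' h f => ?_
  · have e9 : s₂.mem 9 = 0 := by rw [f₂.mem 9 rfl, f₁.mem 9 rfl, h9]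
    have e10 : s₂.mem 10 = 0 := by rw [f₂.mem 10 rfl, f₁.mem 10 rfl, h10]
    refine ⟨?_, ?_, ?_, ?_, ?_, ?_, ?_⟩
    all_goals first | (intro e h1 h2; omega) | skip
    · simp [e9]
    · simp [e10]
  · rw [l₂.reg_m] at hk
    have l₃ := l₂.frame (by rfl) hf
    refine Runs.of_straight rfl (by decide) ?_
    intro _
    have := hk'.step l₃ (by rw [hf.mem 4 rfl, f₂.mem 4 rfl]; exact h₁)
      (by rw [hf.mem 5 rfl]; exact h₂) hk hi
    exact ⟨this.own, this.oth, this.clr, this.last_inner, this.last_pend, this.prev_inner,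
      this.prev_pend⟩
  · rw [l₂.reg_m] at h
    have l := l₂.frame (by rfl) f
    exact ⟨l.reg_n, l.reg_m, h.own, h.oth, h.clr, h.last_inner, h.last_pend, h.prev_inner,
      h.prev_pend⟩

end EdgeArrays
end RainbowMatching

namespace RainbowMatching

open RAM RAM.Expr RAM.Prog Algorithm

/-! ### Rainbow matchings as sets of edges -/

namespace Instance

variable {I : Instance}

variable (I) in
/-- A set of edges with pairwise distinct colors and without common ends. -/
structure Rainbow (E : Finset ℕ) : Prop where
  mem : ∀ e ∈ E, 1 ≤ e ∧ e ≤ I.m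
  pairwise : ∀ e ∈ E, ∀ f ∈ E, e ≠ f →
    I.clr e ≠ I.clr f ∧ ∀ u, I.EndOf u e → ¬ I.EndOf u f

open Classical in
variable (I) in
/-- The edges of a partial solution. -/
noncomputable def edges (cur N : ℕ → ℕ) : Finset ℕ :=
  (Finset.Icc 1 I.m).filter fun e => ∃ v < I.n, cur v = e ∨ N v = e

/-- A pendant edge can meet another edge only at its owner. Two pendant edges of `N` have different
owners, and the ends of the chosen inner edges are blocked as owners, so no conflicts arise. -/
theorem Compatible.rainbow {cur N : ℕ → ℕ} (h : I.Compatible cur N) (hV : I.Valid) :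
    I.Rainbow (I.edges cur N) := by
  have hmix : ∀ v < I.n, ∀ w < I.n, cur v ≠ 0 → N w ≠ 0 → cur v ≠ N w →
      I.clr (cur v) ≠ I.clr (N w) ∧ ∀ u, I.EndOf u (cur v) → ¬ I.EndOf u (N w) := by
    intro v hv w hw hv0 hw0 hne
    obtain ⟨h1, h2, h3, h4⟩ := h.matching.mem w hw hw0
    rw [blockedVertices_eq_zero] at h3
    rw [blockedColors_eq_zero] at h4
    refine ⟨fun hc => h4 ⟨v, hv, hv0, hc⟩, fun u hu hu' => h3 ⟨v, hv, hv0, ?_⟩⟩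
    have := hV.own_eq _ _ u (Nat.pos_of_ne_zero hw0) h1 (Nat.pos_of_ne_zero hv0)
      (h.choice v hv hv0).1 hne.symm h2.1 hu' hu
    rw [h2.2] at this
    rwa [this]
  refine ⟨fun e he => ?_, fun e he f hf hne => ?_⟩
  · exact Finset.mem_Icc.1 (Finset.mem_filter.1 he).1
  · obtain ⟨he, v, hv, hve⟩ := Finset.mem_filter.1 he
    obtain ⟨hf, w, hw, hwf⟩ := Finset.mem_filter.1 hf
    rw [Finset.mem_Icc] at he hf
    have hvw : ∀ g : ℕ → ℕ, g v = e → g w = f → v ≠ w := by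
      rintro g h1 h2 rfl
      exact hne (h1.symm.trans h2)
    rcases hve with rfl | rfl <;> rcases hwf with rfl | rfl
    · exact h.admissible v hv w hw (hvw cur rfl rfl) (by omega) (by omega)
    · exact hmix v hv w hw (by omega) (by omega) hne
    · obtain ⟨h1, h2⟩ := hmix w hw v hv (by omega) (by omega) hne.symm
      exact ⟨h1.symm, fun u hu hu' => h2 u hu' hu⟩
    · refine ⟨fun hc => hvw N rfl rfl (h.matching.inj v hv w hw (by omega) (by omega) hc),
        fun u hu hu' => hvw N rfl rfl ?_⟩
      obtain ⟨h1, h2, -⟩ := h.matching.mem v hv (by omega)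
      obtain ⟨h3, h4, -⟩ := h.matching.mem w hw (by omega)
      have e1 := hV.own_eq _ _ u he.1 he.2 hf.1 hf.2 hne h2.1 hu hu'
      have e2 := hV.own_eq _ _ u hf.1 hf.2 he.1 he.2 hne.symm h4.1 hu' hu
      rw [← h2.2, ← h4.2, e1, e2]

theorem Compatible.size_le_card_edges {cur N : ℕ → ℕ} (h : I.Compatible cur N) :
    I.size cur + I.size N ≤ (I.edges cur N).card := by
  classical
  set S := (Finset.range I.n).filter fun v => cur v ≠ 0 with hS
  set S' := (Finset.range I.n).filter fun v => N v ≠ 0 with hS'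
  have h1 : (S.image cur).card = I.size cur := by
    refine Finset.card_image_of_injOn fun v hv w hw he => ?_
    have hv := Finset.mem_filter.1 hv
    have hw := Finset.mem_filter.1 hw
    rw [← (h.choice v (Finset.mem_range.1 hv.1) hv.2).2.2,
      ← (h.choice w (Finset.mem_range.1 hw.1) hw.2).2.2]
    exact congrArg _ he
  have h2 : (S'.image N).card = I.size N := by
    refine Finset.card_image_of_injOn fun v hv w hw he => ?_
    have hv := Finset.mem_filter.1 hv
    have hw := Finset.mem_filter.1 hw
    rw [← (h.matching.mem v (Finset.mem_range.1 hv.1) hv.2).2.1.2,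
      ← (h.matching.mem w (Finset.mem_range.1 hw.1) hw.2).2.1.2]
    exact congrArg _ he
  rw [← h1, ← h2, ← Finset.card_union_of_disjoint]
  · refine Finset.card_le_card fun e he => ?_
    simp only [Finset.mem_union, Finset.mem_image, hS, hS', Finset.mem_filter,
      Finset.mem_range] at he
    rw [edges, Finset.mem_filter, Finset.mem_Icc]
    rcases he with ⟨v, ⟨hv, h0⟩, rfl⟩ | ⟨v, ⟨hv, h0⟩, rfl⟩
    · exact ⟨⟨Nat.pos_of_ne_zero h0, (h.choice v hv h0).1⟩, v, hv, Or.inl rfl⟩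
    · exact ⟨⟨Nat.pos_of_ne_zero h0, (h.matching.mem v hv h0).1⟩, v, hv, Or.inr rfl⟩
  · rw [Finset.disjoint_left]
    intro e he he'
    simp only [Finset.mem_image, hS, hS', Finset.mem_filter, Finset.mem_range] at he he'
    obtain ⟨v, ⟨hv, h0⟩, rfl⟩ := he
    obtain ⟨w, ⟨hw, h0'⟩, hvw⟩ := he'
    have := (h.matching.mem w hw h0').2.1.1
    rw [hvw] at this
    exact this (h.choice v hv h0).2.1

/-- Edges without common ends have distinct owners. So recording, for every vertex, the inner and
the pendant edge of `E` that it owns loses no edge, and `I.own` provides the injections for the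
count. -/
theorem Rainbow.exists_compatible {E : Finset ℕ} (h : I.Rainbow E) (hV : I.Valid) :
    ∃ cur N, I.Compatible cur N ∧ E.card ≤ I.size cur + I.size N := by
  classical
  have hsel : ∀ P : ℕ → ℕ → Prop, ∃ f : ℕ → ℕ, ∀ v, (f v ≠ 0 → f v ∈ E ∧ P v (f v)) ∧
      ((∃ e ∈ E, P v e) → f v ≠ 0) := by
    intro P
    have : ∀ v, ∃ e, (e ≠ 0 → e ∈ E ∧ P v e) ∧ ((∃ e ∈ E, P v e) → e ≠ 0) := by
      intro v
      by_cases hex : ∃ e ∈ E, P v e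
      · obtain ⟨e, he, hp⟩ := hex
        have := (h.mem e he).1
        exact ⟨e, fun _ => ⟨he, hp⟩, fun _ => by omega⟩
      · exact ⟨0, fun h => absurd rfl h, fun h => absurd h hex⟩
    choose f hf using this
    exact ⟨f, hf⟩
  obtain ⟨cur, hcur⟩ := hsel I.InnerAt
  obtain ⟨N, hN⟩ := hsel I.PendAt
  refine ⟨cur, N, ⟨fun v hv h0 => ?_, fun v hv w hw hvw hv0 hw0 => ?_, fun v hv h0 => ?_,
    fun v hv w hw h0 h0' hc => ?_⟩, ?_⟩
  · obtain ⟨h1, h2⟩ := (hcur v).1 h0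
    exact ⟨(h.mem _ h1).2, h2⟩
  · obtain ⟨h1, h2⟩ := (hcur v).1 hv0
    obtain ⟨h3, h4⟩ := (hcur w).1 hw0
    refine h.pairwise _ h1 _ h3 fun he => hvw ?_
    rw [← h2.2, ← h4.2, he]
  · obtain ⟨h1, h2⟩ := (hN v).1 h0
    refine ⟨(h.mem _ h1).2, h2, ?_, ?_⟩
    · rw [blockedVertices_eq_zero]
      rintro ⟨w, hw, hw0, he⟩
      obtain ⟨h3, h4⟩ := (hcur w).1 hw0
      refine (h.pairwise _ h3 _ h1 fun he => h2.1 ?_).2 v he (Or.inl h2.2)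
      rw [← he]; exact h4.1
    · rw [blockedColors_eq_zero]
      rintro ⟨w, hw, hw0, he⟩
      obtain ⟨h3, h4⟩ := (hcur w).1 hw0
      refine (h.pairwise _ h3 _ h1 fun he => h2.1 ?_).1 he
      rw [← he]; exact h4.1
  · obtain ⟨h1, h2⟩ := (hN v).1 h0
    obtain ⟨h3, h4⟩ := (hN w).1 h0'
    by_contra hvw
    refine (h.pairwise _ h1 _ h3 fun he => hvw ?_).1 hc
    rw [← h2.2, ← h4.2, he]
  · have hinj : Set.InjOn I.own E := by
      intro e he f hf hef
      by_contra hne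
      exact (h.pairwise e he f hf hne).2 (I.own e) (Or.inl rfl) (Or.inl hef.symm)
    have hown : ∀ e ∈ E, I.own e < I.n := fun e he => hV.own_lt e (h.mem e he).1 (h.mem e he).2
    rw [← Finset.card_filter_add_card_filter_not (s := E) I.inner]
    refine Nat.add_le_add ?_ ?_
    · refine Finset.card_le_card_of_injOn I.own (fun e he => ?_)
        (hinj.mono (Finset.coe_subset.2 (Finset.filter_subset _ _)))
      obtain ⟨he, hin⟩ := Finset.mem_filter.1 he
      exact Finset.mem_coe.2 (Finset.mem_filter.2 ⟨Finset.mem_range.2 (hown e he),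
        (hcur _).2 ⟨e, he, hin, rfl⟩⟩)
    · refine Finset.card_le_card_of_injOn I.own (fun e he => ?_)
        (hinj.mono (Finset.coe_subset.2 (Finset.filter_subset _ _)))
      obtain ⟨he, hin⟩ := Finset.mem_filter.1 he
      exact Finset.mem_coe.2 (Finset.mem_filter.2 ⟨Finset.mem_range.2 (hown e he),
        (hN _).2 ⟨e, he, hin, rfl⟩⟩)

end Instance

/-! ### Correctness on graphs -/

section Graph

variable {n : ℕ} {G : SimpleGraph (Fin n)} (φ : G.EdgeLabeling ℕ) (L : EdgeList G)

/-- The edge arrays in the initial memory. -/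
def edgeArrays : EdgeArrays where
  n := n
  m := L.m
  src := (input φ L).mem 0
  dst := (input φ L).mem 1
  col := (input φ L).mem 2

theorem edgeArrays_src (i : Fin L.m) : (edgeArrays φ L).src i = L.src i := by
  simp [edgeArrays, input]

theorem edgeArrays_dst (i : Fin L.m) : (edgeArrays φ L).dst i = L.dst i := by
  simp [edgeArrays, input]

theorem edgeArrays_col (i : Fin L.m) : (edgeArrays φ L).col i = φ (L.edge i) := by
  simp [edgeArrays, input]

theorem EdgeList.adj (i : Fin L.m) : G.Adj (L.src i) (L.dst i) := by
  have := (L.edge i).2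
  rwa [L.edge_eq, SimpleGraph.mem_edgeSet] at this

theorem edgeArrays_valid : (edgeArrays φ L).Valid := by
  refine ⟨fun j hj => ?_, fun j hj => ?_, fun j hj => ?_⟩
  · rw [edgeArrays_src φ L ⟨j, hj⟩]; exact Fin.is_lt _
  · rw [edgeArrays_dst φ L ⟨j, hj⟩]; exact Fin.is_lt _
  · rw [edgeArrays_src φ L ⟨j, hj⟩, edgeArrays_dst φ L ⟨j, hj⟩]
    exact fun h => (L.adj ⟨j, hj⟩).ne (Fin.ext h)

theorem endOf_succ (i : Fin L.m) (v : Fin n) :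
    (edgeArrays φ L).inst.EndOf v (i + 1) ↔ v ∈ (L.edge i : Sym2 (Fin n)) := by
  rw [EdgeArrays.endOf_inst, Nat.add_sub_cancel, edgeArrays_src, edgeArrays_dst, L.edge_eq,
    Sym2.mem_iff, Fin.ext_iff, Fin.ext_iff, eq_comm, @eq_comm _ _ (v : ℕ)]

theorem endOf_lt {i : Fin L.m} {u : ℕ} (h : (edgeArrays φ L).inst.EndOf u (i + 1)) : u < n := by
  rw [EdgeArrays.endOf_inst, Nat.add_sub_cancel, edgeArrays_src, edgeArrays_dst] at h
  rcases h with rfl | rfl <;> exact Fin.is_lt _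

/-- The subgraph formed by a set of edges. -/
def subgraphOf (S : Set (Fin L.m)) : G.Subgraph where
  verts := {v | ∃ i ∈ S, v ∈ (L.edge i : Sym2 (Fin n))}
  Adj v w := ∃ i ∈ S, s(v, w) = (L.edge i : Sym2 (Fin n))
  adj_sub := by
    rintro v w ⟨i, -, h⟩
    rw [← SimpleGraph.mem_edgeSet, h]
    exact (L.edge i).2
  edge_vert := by
    rintro v w ⟨i, hi, h⟩
    exact ⟨i, hi, by rw [← h]; exact Sym2.mem_mk_left _ _⟩
  symm := ⟨by
    rintro v w ⟨i, hi, h⟩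
    exact ⟨i, hi, by rw [← h, Sym2.eq_swap]⟩⟩

theorem edgeSet_subgraphOf (S : Set (Fin L.m)) :
    (subgraphOf L S).edgeSet = {e : Sym2 (Fin n) | ∃ i ∈ S, e = L.edge i} := by
  ext e
  induction e with
  | _ v w => rfl

theorem ncard_edges (S : Set (Fin L.m)) :
    {e : Sym2 (Fin n) | ∃ i ∈ S, e = L.edge i}.ncard = S.ncard := by
  rw [← Set.ncard_image_of_injective S
    (f := fun i => (L.edge i : Sym2 (Fin n)))
    (Subtype.val_injective.comp L.edge.injective)]
  congr 1
  ext e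
  simp [eq_comm]

open Classical in
/-- The numbers of the edges in a set. -/
noncomputable def numbers (S : Set (Fin L.m)) : Finset ℕ :=
  (Finset.univ.filter fun i => i ∈ S).image fun i : Fin L.m => (i : ℕ) + 1

theorem mem_numbers {S : Set (Fin L.m)} {e : ℕ} :
    e ∈ numbers L S ↔ ∃ i ∈ S, (i : ℕ) + 1 = e := by
  simp [numbers]

theorem card_numbers (S : Set (Fin L.m)) : (numbers L S).card = S.ncard := by
  classical
  rw [numbers, Finset.card_image_of_injective _ fun i j h => by simpa [Fin.ext_iff] using h,
    Set.ncard_eq_toFinset_card']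
  congr 1
  ext i
  simp

theorem succ_mem_numbers {S : Set (Fin L.m)} {i : Fin L.m} :
    (i : ℕ) + 1 ∈ numbers L S ↔ i ∈ S := by
  rw [mem_numbers]
  constructor
  · rintro ⟨j, hj, h⟩
    rwa [← Fin.ext (Nat.succ_injective h)]
  · exact fun h => ⟨i, h, rfl⟩

theorem isRainbowMatching_subgraphOf {S : Set (Fin L.m)}
    (h : (edgeArrays φ L).inst.Rainbow (numbers L S)) :
    IsRainbowMatching φ (subgraphOf L S) := by
  have hp : ∀ i ∈ S, ∀ j ∈ S, i ≠ j → φ (L.edge i) ≠ φ (L.edge j) ∧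
      ∀ v, v ∈ (L.edge i : Sym2 (Fin n)) → v ∉ (L.edge j : Sym2 (Fin n)) := by
    intro i hi j hj hij
    obtain ⟨h1, h2⟩ := h.pairwise _ ((succ_mem_numbers L).2 hi) _ ((succ_mem_numbers L).2 hj)
      (by simpa [Fin.ext_iff] using hij)
    refine ⟨?_, fun v hv hv' => h2 v ((endOf_succ φ L i v).2 hv) ((endOf_succ φ L j v).2 hv')⟩
    simp only [EdgeArrays.inst, Nat.add_sub_cancel, edgeArrays_col] at h1
    exact h1
  refine ⟨?_, ?_⟩
  · rintro v ⟨i, hi, hv⟩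
    obtain ⟨w, hw⟩ := hv
    refine ⟨w, ⟨i, hi, hw.symm⟩, ?_⟩
    rintro w' ⟨j, hj, hw'⟩
    have hij : i = j := by
      by_contra hij
      refine (hp i hi j hj hij).2 v ?_ ?_
      · rw [hw]; exact Sym2.mem_mk_left _ _
      · rw [← hw']; exact Sym2.mem_mk_left _ _
    subst hij
    rw [hw] at hw'
    exact Sym2.congr_right.1 hw'
  · intro e f he hf hc
    rw [edgeSet_subgraphOf] at he hf
    obtain ⟨i, hi, he⟩ := he
    obtain ⟨j, hj, hf⟩ := hf
    obtain rfl := Subtype.ext he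
    obtain rfl := Subtype.ext hf
    by_contra hne
    exact (hp i hi j hj fun h => hne (by rw [h])).1 hc

theorem rainbow_of_isRainbowMatching {M : G.Subgraph} (h : IsRainbowMatching φ M) :
    (edgeArrays φ L).inst.Rainbow (numbers L {i | (L.edge i : Sym2 (Fin n)) ∈ M.edgeSet}) := by
  have hm : ∀ e ∈ numbers L {i | (L.edge i : Sym2 (Fin n)) ∈ M.edgeSet}, ∃ i : Fin L.m,
      (L.edge i : Sym2 (Fin n)) ∈ M.edgeSet ∧ e = i + 1 := by
    intro e he
    obtain ⟨i, hi, rfl⟩ := (mem_numbers L).1 he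
    exact ⟨i, hi, rfl⟩
  refine ⟨fun e he => ?_, fun e he f hf hne => ?_⟩
  · obtain ⟨i, hi, rfl⟩ := hm e he
    have := i.2
    exact ⟨by omega, this⟩
  · obtain ⟨i, hi, rfl⟩ := hm e he
    obtain ⟨j, hj, rfl⟩ := hm f hf
    have hij : L.edge i ≠ L.edge j := fun h => hne (by rw [L.edge.injective h])
    refine ⟨fun hc => hij (h.2 _ _ hi hj ?_), fun u hu hu' => hij (Subtype.ext ?_)⟩
    · simp only [EdgeArrays.inst, Nat.add_sub_cancel, edgeArrays_col] at hc
      exact hc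
    · have hun := endOf_lt φ L hu
      obtain ⟨w, hw⟩ := (endOf_succ φ L i ⟨u, hun⟩).1 hu
      obtain ⟨w', hw'⟩ := (endOf_succ φ L j ⟨u, hun⟩).1 hu'
      rw [hw, SimpleGraph.Subgraph.mem_edgeSet] at hi
      rw [hw', SimpleGraph.Subgraph.mem_edgeSet] at hj
      rw [hw, hw', h.1.eq_of_adj_left hi hj]

theorem ncard_edgeSet_eq (M : G.Subgraph) :
    M.edgeSet.ncard = {i | (L.edge i : Sym2 (Fin n)) ∈ M.edgeSet}.ncard := by
  rw [← ncard_edges]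
  congr 1
  ext e
  constructor
  · intro he
    exact ⟨L.edge.symm ⟨e, M.edgeSet_subset he⟩, by simpa using he, by simp⟩
  · rintro ⟨i, hi, rfl⟩
    exact hi

/-- The running time of the algorithm, up to a constant. -/
noncomputable def stepBound : ℕ :=
  (n + L.m + 1) ^ 2 + ((edgeArrays φ L).inst.choices.card + 1) *
    (((edgeArrays φ L).inst.innerOwners.card + 1) * (n + L.m + 1))

/-- No assumption on the graph: acyclicity and the excluded path matter only for estimating
`stepBound`. -/
theorem solvesWithin_main : SolvesWithin main φ L (4000 * stepBound φ L : ℕ) := by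
  set A := edgeArrays φ L with hA
  have hAV : A.Valid := edgeArrays_valid φ L
  have hV := hAV.inst
  have hl : A.Loaded (input φ L) := ⟨by simp [input, hA, edgeArrays], by simp [input, hA, edgeArrays],
    fun _ _ => rfl, fun _ _ => rfl, fun _ _ => rfl⟩
  have hzero : ∀ a, 2 < a → (input φ L).mem a = 0 := by
    intro a ha
    funext i
    have h0 : a ≠ 0 := by omega
    have h1 : a ≠ 1 := by omega
    have h2 : a ≠ 2 := by omega
    simp [input, h0, h1, h2]
  have hruns := Runs.seq (T := 4000 * stepBound φ L)
    (EdgeArrays.runs_preprocess hl hAV (hzero 4 (by decide)) (hzero 5 (by decide))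
    (hzero 9 (by decide)) (hzero 10 (by decide))) (fun s₁ l₁ f₁ => Instance.runs_main l₁ hV
      ((f₁.mem 3 rfl).trans (hzero 3 (by decide)))
      ((f₁.reg 9 rfl).trans (by simp [input]))
      ((f₁.mem 13 rfl).trans (hzero 13 (by decide)))
      ((f₁.mem 14 rfl).trans (hzero 14 (by decide)))
      ((f₁.mem 15 rfl).trans (hzero 15 (by decide)))) ?_
  swap
  · change 400 * (n + L.m + 1) + (1000 * (n + L.m + 1) ^ 2 + 4000 * (A.inst.choices.card + 1) *
      ((A.inst.innerOwners.card + 1) * (n + L.m + 1))) ≤ 4000 * ((n + L.m + 1) ^ 2 +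
        (A.inst.choices.card + 1) * ((A.inst.innerOwners.card + 1) * (n + L.m + 1)))
    nlinarith [Nat.zero_le (n + L.m)]
  obtain ⟨t, s, hex, ht, cur, N, hC, hout, hbest⟩ := hruns
  refine ⟨t, s, subgraphOf L {i | s.mem 3 i ≠ 0}, hex, by exact_mod_cast ht, ?_, ?_⟩
  · have hedges : A.inst.edges cur N = numbers L {i | s.mem 3 i ≠ 0} := by
      ext e
      rw [Instance.edges, Finset.mem_filter, Finset.mem_Icc, mem_numbers]
      constructor
      · rintro ⟨⟨h1, h2⟩, v, hv, hve⟩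
        have hlt : e - 1 < L.m := by
          have : e ≤ L.m := h2
          omega
        refine ⟨⟨e - 1, hlt⟩, (hout (e - 1) hlt).2 ⟨v, hv, ?_⟩, Nat.sub_add_cancel h1⟩
        rwa [Nat.sub_add_cancel h1]
      · rintro ⟨i, hi, rfl⟩
        exact ⟨⟨by omega, i.2⟩, (hout i i.2).1 hi⟩
    have hR := hC.rainbow hV
    rw [hedges] at hR
    refine ⟨isRainbowMatching_subgraphOf φ L hR, fun M' hM' => ?_⟩
    obtain ⟨cur', N', hC', hle⟩ := (rainbow_of_isRainbowMatching φ L hM').exists_compatible hV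
    rw [card_numbers, ← ncard_edgeSet_eq] at hle
    rw [edgeSet_subgraphOf, ncard_edges, ← card_numbers, ← hedges]
    exact hle.trans ((hbest cur' N' hC').trans hC.size_le_card_edges)
  · rw [edgeSet_subgraphOf]
    rfl

end Graph

end RainbowMatching

/-! ### Forests without paths on seven vertices -/

namespace SimpleGraph

variable {V : Type*} {G : SimpleGraph V}

/-- At least two neighbors. -/
def Nonleaf (G : SimpleGraph V) (v : V) : Prop := ∀ u, ∃ w, w ≠ u ∧ G.Adj v w

/-- At least two neighbors that are not leaves. -/
def Branching (G : SimpleGraph V) (v : V) : Prop := ∀ u, ∃ w, w ≠ u ∧ G.Adj v w ∧ G.Nonleaf w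

/-- In a forest, a neighbor of the start of a path that differs from the next vertex is off the
whole path. Avoiding a single vertex is therefore all that `Nonleaf` and `Branching` have to
provide. -/
theorem IsAcyclic.cons_isPath (hG : G.IsAcyclic) {u v w : V} {p : G.Walk u v} (hp : p.IsPath)
    (h : G.Adj w u) (hw : w ≠ p.snd) : (Walk.cons h p).IsPath :=
  hp.cons fun hs => hw (hG.eq_snd_of_adj_start hp h.symm hs)

theorem IsAcyclic.exists_isPath_length_add_two (hG : G.IsAcyclic) {u v : V} {p : G.Walk u v}
    (hp : p.IsPath) (hu : G.Branching u) :
    ∃ (w : V) (q : G.Walk w v), q.IsPath ∧ q.length = p.length + 2 := by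
  obtain ⟨w, hw, hadj, hnl⟩ := hu p.snd
  obtain ⟨z, hz, hadj'⟩ := hnl u
  have h₁ := hG.cons_isPath hp hadj.symm hw
  have h₂ := hG.cons_isPath h₁ hadj'.symm (by simpa using hz)
  exact ⟨z, _, h₂, by simp⟩

theorem Walk.IsPath.pathGraph_isContained {u v : V} {p : G.Walk u v} (hp : p.IsPath) {k : ℕ}
    (hk : k ≤ p.length) : (pathGraph (k + 1)) ⊑ G := by
  refine ⟨Hom.toCopy ⟨fun i => p.getVert i, ?_⟩ fun i j hij => Fin.ext ?_⟩
  · intro i j hij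
    rcases pathGraph_adj.1 hij with h | h
    · rw [← h]
      exact p.adj_getVert_succ (by have := j.2; omega)
    · rw [← h]
      exact (p.adj_getVert_succ (by have := i.2; omega)).symm
  · exact hp.getVert_injOn (by rw [Set.mem_ofPred_eq]; omega) (by rw [Set.mem_ofPred_eq]; omega) hij

/-- A path of length at least two between branching vertices extends by two edges at both ends, to
at least six edges and so seven vertices. -/
theorem IsAcyclic.length_le_one_of_branching (hG : G.IsAcyclic) (hP : (pathGraph 7).Free G)
    {u v : V} {p : G.Walk u v} (hp : p.IsPath) (hu : G.Branching u) (hv : G.Branching v) :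
    p.length ≤ 1 := by
  by_contra! h
  obtain ⟨w, q, hq, hql⟩ := hG.exists_isPath_length_add_two hp hu
  obtain ⟨w', q', hq', hql'⟩ := hG.exists_isPath_length_add_two hq.reverse hv
  rw [Walk.length_reverse] at hql'
  exact hP (hq'.pathGraph_isContained (k := 6) (by omega))

theorem Walk.IsPath.nonleaf_getVert {u v : V} {p : G.Walk u v} (hp : p.IsPath) {i : ℕ}
    (hi : i + 1 < p.length) : G.Nonleaf (p.getVert (i + 1)) := by
  have h1 := p.adj_getVert_succ (i := i) (by omega)
  have h2 := p.adj_getVert_succ (i := i + 1) hi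
  have hne : p.getVert i ≠ p.getVert (i + 1 + 1) := fun h => by
    have := hp.getVert_injOn (by rw [Set.mem_ofPred_eq]; omega)
      (by rw [Set.mem_ofPred_eq]; omega) h
    omega
  intro x
  by_cases hx : p.getVert i = x
  · exact ⟨_, fun h => hne (hx.trans h.symm), h2⟩
  · exact ⟨_, hx, h1.symm⟩

/-- The possible positions of the owners of inner edges. -/
def Central (G : SimpleGraph V) (v : V) : Prop := G.Nonleaf v ∧ (G.Branching v ∨
  ∃ y, (∀ x, G.Adj v x → G.Nonleaf x → x = y) ∧ ∀ x, G.Adj y x → G.Nonleaf x → x = v)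

/-- In the second alternative of `Central`, `u` and `y` are each other's only nonleaf neighbors. A
longer path to another nonleaf would pass from `u` to `y` and on to a nonleaf neighbor of `y`, which
is `u` again. -/
theorem Central.branching {u v : V} (hu : G.Central u) (hv : G.Central v) {p : G.Walk u v}
    (hp : p.IsPath) (hl : 1 < p.length) : G.Branching u := by
  refine hu.2.resolve_right ?_
  rintro ⟨y, hy, hy'⟩
  have h1 := hy _ (by simpa using p.adj_getVert_succ (i := 0) (by omega)) (hp.nonleaf_getVert hl)
  have hnl : G.Nonleaf (p.getVert 2) := by
    rcases Nat.lt_or_eq_of_le hl with h | h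
    · exact hp.nonleaf_getVert (i := 1) h
    · have := hv.1
      rwa [← p.getVert_length, ← h] at this
  have h2 := hy' _ (by simpa [← h1] using p.adj_getVert_succ (i := 1) hl) hnl
  have : (2 : ℕ) = 0 := hp.getVert_injOn (by rw [Set.mem_ofPred_eq]; omega)
    (by rw [Set.mem_ofPred_eq]; omega) (by simpa using h2)
  omega

theorem IsAcyclic.adj_of_central (hG : G.IsAcyclic) (hP : (pathGraph 7).Free G) {u v : V}
    (hu : G.Central u) (hv : G.Central v) (hne : u ≠ v) (hr : G.Reachable u v) : G.Adj u v := by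
  classical
  obtain ⟨p, hp⟩ := hr.exists_isPath
  have hpos : p.length ≠ 0 := fun h => hne (Walk.eq_of_length_eq_zero h)
  have hl : p.length ≤ 1 := by
    by_contra! hl
    have h1 := hu.branching hv hp hl
    have h2 := hv.branching hu hp.reverse (by simpa using hl)
    have := hG.length_le_one_of_branching hP hp h1 h2
    omega
  exact p.adj_of_length_eq_one (by omega)

theorem IsAcyclic.not_triangle (hG : G.IsAcyclic) {u v w : V} (h₁ : G.Adj u v) (h₂ : G.Adj v w)
    (h₃ : G.Adj u w) : False := by
  have hq : (Walk.cons h₁ (Walk.cons h₂ Walk.nil)).IsPath := by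
    simp [h₁.ne, h₃.ne, h₂.ne]
  have := hG.eq_snd_of_adj_start hq h₃ (by simp)
  simp at this
  exact h₂.ne this.symm

/-- In a forest, a component with two adjacent vertices that are not leaves has four vertices. -/
theorem IsAcyclic.four_le_card [Fintype V] (hG : G.IsAcyclic) {u v : V} (h : G.Adj u v)
    (hu : G.Nonleaf u) (hv : G.Nonleaf v) {S : Finset V} (hS : ∀ w, G.Reachable u w → w ∈ S) :
    4 ≤ S.card := by
  classical
  obtain ⟨x, hx, hxu⟩ := hu v
  obtain ⟨y, hy, hyv⟩ := hv u
  have h₀ : (Walk.cons hyv Walk.nil).IsPath := by simp [hyv.ne]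
  have h₁ := hG.cons_isPath h₀ h (by simpa using hy.symm)
  have h₂ := hG.cons_isPath h₁ hxu.symm (by simpa using hx)
  have hnd := h₂.support_nodup
  rw [← show (Walk.cons hxu.symm (Walk.cons h (Walk.cons hyv Walk.nil))).support.toFinset.card = 4
    from List.toFinset_card_of_nodup hnd]
  refine Finset.card_le_card fun w hw => hS w ?_
  simp only [Walk.support_cons, Walk.support_nil, List.mem_toFinset, List.mem_cons,
    List.not_mem_nil, or_false] at hw
  rcases hw with rfl | rfl | rfl | rfl
  · exact hxu.reachable
  · exact Reachable.refl _
  · exact h.reachable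
  · exact h.reachable.trans hyv.reachable

end SimpleGraph

/-! ### Owners, edges and choices in each component. -/

namespace RainbowMatching

open SimpleGraph

section Graph

variable {n : ℕ} {G : SimpleGraph (Fin n)} (φ : G.EdgeLabeling ℕ) (L : EdgeList G)

theorem exists_edge_eq {v w : Fin n} (h : G.Adj v w) : ∃ i : Fin L.m,
    (L.edge i : Sym2 (Fin n)) = s(v, w) :=
  ⟨L.edge.symm ⟨s(v, w), h⟩, by simp⟩

/-- The bridge from counters in memory to the form of `Nonleaf` and `Branching`: distinct edges at
`v` have distinct other ends. -/
theorem one_lt_incident_iff (p : ℕ → Prop) (v : Fin n) :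
    1 < (edgeArrays φ L).incident p L.m v ↔
      ∀ u, ∃ w, w ≠ u ∧ ∃ i : Fin L.m, (L.edge i : Sym2 (Fin n)) = s(v, w) ∧ p i := by
  classical
  have hend : ∀ i : Fin L.m, ((edgeArrays φ L).src i = v ∨ (edgeArrays φ L).dst i = v) ↔
      ∃ w, (L.edge i : Sym2 (Fin n)) = s(v, w) := by
    intro i
    rw [← Nat.add_sub_cancel (i : ℕ) 1, ← EdgeArrays.endOf_inst, endOf_succ]
    rfl
  constructor
  · intro h u
    obtain ⟨i, hi, j, hj, hij⟩ := Finset.one_lt_card.1 h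
    simp only [Finset.mem_filter, Finset.mem_range] at hi hj
    obtain ⟨w, hw⟩ := (hend ⟨i, hi.1⟩).1 hi.2.2
    obtain ⟨w', hw'⟩ := (hend ⟨j, hj.1⟩).1 hj.2.2
    have hne : w ≠ w' := by
      rintro rfl
      have := L.edge.injective (Subtype.ext (hw.trans hw'.symm))
      exact hij (by simpa using this)
    by_cases hwu : w = u
    · exact ⟨w', fun h => hne (hwu.trans h.symm), _, hw', hj.2.1⟩
    · exact ⟨w, hwu, _, hw, hi.2.1⟩
  · intro h
    obtain ⟨w, -, i, hi, hpi⟩ := h v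
    obtain ⟨w', hne, j, hj, hpj⟩ := h w
    refine EdgeArrays.one_lt_incident i.2 j.2 (fun hij => hne ?_) hpi hpj
      ((hend i).2 ⟨w, hi⟩) ((hend j).2 ⟨w', hj⟩)
    rw [Fin.ext hij, hj] at hi
    exact Sym2.congr_right.1 hi

theorem one_lt_deg_iff (v : Fin n) : 1 < (edgeArrays φ L).deg v ↔ G.Nonleaf v := by
  refine (one_lt_incident_iff φ L _ v).trans (forall_congr' fun u => exists_congr fun w =>
    and_congr_right fun _ => ⟨?_, fun h => ?_⟩)
  · rintro ⟨i, hi, -⟩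
    rw [← SimpleGraph.mem_edgeSet, ← hi]
    exact (L.edge i).2
  · obtain ⟨i, hi⟩ := exists_edge_eq L h
    exact ⟨i, hi, trivial⟩

theorem isInner_iff {i : Fin L.m} {v w : Fin n} (h : (L.edge i : Sym2 (Fin n)) = s(v, w)) :
    (edgeArrays φ L).IsInner i ↔ G.Nonleaf v ∧ G.Nonleaf w := by
  rw [EdgeArrays.IsInner, edgeArrays_src, edgeArrays_dst, one_lt_deg_iff, one_lt_deg_iff]
  rw [L.edge_eq, Sym2.eq_iff] at h
  rcases h with ⟨rfl, rfl⟩ | ⟨rfl, rfl⟩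
  · rfl
  · exact and_comm

theorem one_lt_innerDeg_iff (v : Fin n) : 1 < (edgeArrays φ L).innerDeg v ↔
    ∀ u, ∃ w, w ≠ u ∧ G.Adj v w ∧ G.Nonleaf v ∧ G.Nonleaf w := by
  refine (one_lt_incident_iff φ L _ v).trans (forall_congr' fun u => exists_congr fun w =>
    and_congr_right fun _ => ⟨?_, fun h => ?_⟩)
  · rintro ⟨i, hi, hin⟩
    refine ⟨?_, (isInner_iff φ L hi).1 hin⟩
    rw [← SimpleGraph.mem_edgeSet, ← hi]
    exact (L.edge i).2
  · obtain ⟨i, hi⟩ := exists_edge_eq L h.1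
    exact ⟨i, hi, (isInner_iff φ L hi).2 h.2⟩

open Classical in
-- The second end owns an inner edge only if the first has no other nonleaf neighbor. So either the
-- owner is branching, or each end is the only nonleaf neighbor of the other.
theorem central_of_innerAt {i : Fin L.m} {v : Fin n}
    (h : (edgeArrays φ L).inst.InnerAt v (i + 1)) :
    G.Central v ∧ G.Nonleaf v ∧ ∃ w, G.Nonleaf w ∧ (L.edge i : Sym2 (Fin n)) = s(v, w) := by
  have hin : (edgeArrays φ L).IsInner i := h.1
  have hown : (if (edgeArrays φ L).Swapped i then (edgeArrays φ L).dst i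
    else (edgeArrays φ L).src i) = v := h.2
  obtain ⟨hs, hd⟩ := (isInner_iff φ L (L.edge_eq i)).1 hin
  have hadj := L.adj i
  have hsw : (edgeArrays φ L).Swapped i ↔ ¬ 1 < (edgeArrays φ L).innerDeg (L.src i) := by
    rw [EdgeArrays.Swapped, edgeArrays_src]
    simp [hin]
  have hbr : ∀ u : Fin n, 1 < (edgeArrays φ L).innerDeg u → G.Branching u := fun u hu x => by
    obtain ⟨w, h1, h2, -, h3⟩ := (one_lt_innerDeg_iff φ L u).1 hu x
    exact ⟨w, h1, h2, h3⟩
  have huniq : ∀ u w : Fin n, ¬ 1 < (edgeArrays φ L).innerDeg u → G.Adj u w → G.Nonleaf u →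
      G.Nonleaf w → ∀ x, G.Adj u x → G.Nonleaf x → x = w := by
    intro u w hu huw hu' hw x hx hx'
    rw [one_lt_innerDeg_iff] at hu
    push Not at hu
    obtain ⟨y, hy⟩ := hu
    have key : ∀ z, G.Adj u z → G.Nonleaf z → z = y := fun z h1 h2 => by
      by_contra hne
      exact hy z hne h1 hu' h2
    rw [key x hx hx', key w huw hw]
  by_cases hS : (edgeArrays φ L).Swapped i
  · rw [if_pos hS, edgeArrays_dst] at hown
    obtain rfl := Fin.ext hown
    refine ⟨⟨hd, ?_⟩, hd, L.src i, hs, by rw [L.edge_eq, Sym2.eq_swap]⟩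
    by_cases hb : 1 < (edgeArrays φ L).innerDeg (L.dst i)
    · exact Or.inl (hbr _ hb)
    · exact Or.inr ⟨L.src i, huniq _ _ hb hadj.symm hd hs, huniq _ _ (hsw.1 hS) hadj hs hd⟩
  · rw [if_neg hS, edgeArrays_src] at hown
    obtain rfl := Fin.ext hown
    rw [hsw, not_not] at hS
    exact ⟨⟨hs, Or.inl (hbr _ hS)⟩, hs, L.dst i, hd, L.edge_eq i⟩

open Classical in
/-- The owners of inner edges in a component. -/
noncomputable def ownersIn (C : G.ConnectedComponent) : Finset (Fin n) :=
  Finset.univ.filter fun v => G.connectedComponentMk v = C ∧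
    ∃ i : Fin L.m, (edgeArrays φ L).inst.InnerAt v (i + 1)

open Classical in
/-- The number of vertices of a component. -/
noncomputable def order (C : G.ConnectedComponent) : ℕ :=
  (Finset.univ.filter fun v => G.connectedComponentMk v = C).card

/-- Three owners in a component would be pairwise adjacent central vertices, a triangle. -/
theorem card_ownersIn_le (hG : G.IsAcyclic) (hP : (pathGraph 7).Free G)
    (C : G.ConnectedComponent) : (ownersIn φ L C).card ≤ 2 := by
  by_contra! h
  obtain ⟨u, hu, v, hv, w, hw, huv, huw, hvw⟩ := Finset.two_lt_card.1 h
  simp only [ownersIn, Finset.mem_filter, Finset.mem_univ, true_and] at hu hv hw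
  obtain ⟨hu, i, hi⟩ := hu
  obtain ⟨hv, j, hj⟩ := hv
  obtain ⟨hw, k, hk⟩ := hw
  have ci := (central_of_innerAt φ L hi).1
  have cj := (central_of_innerAt φ L hj).1
  have ck := (central_of_innerAt φ L hk).1
  exact hG.not_triangle
    (hG.adj_of_central hP ci cj huv (ConnectedComponent.exact (hu.trans hv.symm)))
    (hG.adj_of_central hP cj ck hvw (ConnectedComponent.exact (hv.trans hw.symm)))
    (hG.adj_of_central hP ci ck huw (ConnectedComponent.exact (hu.trans hw.symm)))

theorem four_le_order (hG : G.IsAcyclic) {C : G.ConnectedComponent}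
    (h : (ownersIn φ L C).Nonempty) : 4 ≤ order C := by
  obtain ⟨v, hv⟩ := h
  simp only [ownersIn, Finset.mem_filter, Finset.mem_univ, true_and] at hv
  obtain ⟨rfl, i, hi⟩ := hv
  obtain ⟨-, hnl, w, hw, hvw⟩ := central_of_innerAt φ L hi
  have hadj : G.Adj v w := by
    rw [← SimpleGraph.mem_edgeSet, ← hvw]
    exact (L.edge i).2
  refine hG.four_le_card hadj hnl hw fun x hx => ?_
  simpa using (ConnectedComponent.sound hx).symm

open Classical in
/-- The edges in a component. -/
noncomputable def edgesIn (C : G.ConnectedComponent) : Finset (Fin L.m) :=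
  Finset.univ.filter fun i => G.connectedComponentMk (L.src i) = C

theorem card_edgesIn (hG : G.IsAcyclic) (C : G.ConnectedComponent) :
    (edgesIn L C).card + 1 ≤ order C := by
  classical
  have hT := hG.isTree_connectedComponent C
  have hcard : Fintype.card C = order C := Fintype.card_subtype _
  rw [← hcard, ← hT.card_edgeFinset, Nat.add_le_add_iff_right]
  have hdst : ∀ i ∈ edgesIn L C, L.src i ∈ C ∧ L.dst i ∈ C := fun i hi => by
    have hi : G.connectedComponentMk (L.src i) = C := by simpa [edgesIn] using hi
    exact ⟨hi, (ConnectedComponent.sound (L.adj i).symm.reachable).trans hi⟩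
  rw [← Finset.card_attach]
  refine Finset.card_le_card_of_injOn (fun i : { x // x ∈ edgesIn L C } =>
    s((⟨L.src i, (hdst i i.2).1⟩ : C), ⟨L.dst i, (hdst i i.2).2⟩)) (fun i _ => ?_)
    (fun i _ j _ hij => ?_)
  · rw [Finset.mem_coe, mem_edgeFinset, SimpleGraph.mem_edgeSet]
    exact L.adj i
  · have h := congrArg (Sym2.map Subtype.val) hij
    simp only [Sym2.map_mk] at h
    rw [← L.edge_eq, ← L.edge_eq] at h
    exact Subtype.ext (L.edge.injective (Subtype.ext h))

theorem sum_order [Fintype G.ConnectedComponent] : ∑ C : G.ConnectedComponent, order C = n := by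
  classical
  have := Finset.card_eq_sum_card_fiberwise (s := (Finset.univ : Finset (Fin n)))
    (t := Finset.univ) (f := G.connectedComponentMk) (fun _ _ => by simp)
  rw [Finset.card_univ, Fintype.card_fin] at this
  exact this.symm

theorem m_le (hG : G.IsAcyclic) : L.m ≤ n := by
  classical
  have := Fintype.ofFinite G.ConnectedComponent
  have := Finset.card_eq_sum_card_fiberwise (s := (Finset.univ : Finset (Fin L.m)))
    (t := Finset.univ) (f := fun i => G.connectedComponentMk (L.src i)) (fun _ _ => by simp)
  rw [Finset.card_univ, Fintype.card_fin] at this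
  rw [this]
  conv_rhs => rw [← sum_order (G := G)]
  refine Finset.sum_le_sum fun C _ => ?_
  exact (Nat.le_succ _).trans (card_edgesIn L hG C)

theorem card_options_le (v : Fin n) : ((edgeArrays φ L).inst.options v).card ≤
    1 + {i : Fin L.m | (edgeArrays φ L).inst.InnerAt v (i + 1)}.ncard := by
  classical
  rw [← card_numbers]
  refine (Finset.card_le_card (t := insert 0 (numbers L _)) fun e he => ?_).trans
    ((Finset.card_insert_le _ _).trans (by rw [add_comm]))
  rw [Finset.mem_insert]
  rcases Instance.mem_options.1 he with rfl | ⟨hm, hin⟩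
  · exact Or.inl rfl
  · refine or_iff_not_imp_left.2 fun h0 => (mem_numbers L).2 ?_
    have hm' : e ≤ L.m := hm
    have he : e - 1 + 1 = e := by omega
    exact ⟨⟨e - 1, by omega⟩, by simpa [he] using hin, he⟩

theorem sum_ncard_le (C : G.ConnectedComponent) :
    ∑ v ∈ ownersIn φ L C, {i : Fin L.m | (edgeArrays φ L).inst.InnerAt v (i + 1)}.ncard ≤
      (edgesIn L C).card := by
  classical
  have hn : ∀ v : Fin n, {i : Fin L.m | (edgeArrays φ L).inst.InnerAt v (i + 1)}.ncard =
      (Finset.univ.filter fun i : Fin L.m => (edgeArrays φ L).inst.InnerAt v (i + 1)).card := by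
    intro v
    rw [Set.ncard_eq_toFinset_card']
    congr 1
    ext i
    simp
  simp only [hn]
  rw [← Finset.card_biUnion]
  · refine Finset.card_le_card fun i hi => ?_
    simp only [Finset.mem_biUnion, ownersIn, Finset.mem_filter, Finset.mem_univ, true_and] at hi
    obtain ⟨v, ⟨hv, -⟩, hi⟩ := hi
    simp only [edgesIn, Finset.mem_filter, Finset.mem_univ, true_and]
    obtain ⟨-, -, w, -, hw⟩ := central_of_innerAt φ L hi
    rw [L.edge_eq, Sym2.eq_iff] at hw
    rcases hw with ⟨rfl, -⟩ | ⟨-, rfl⟩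
    · exact hv
    · exact (ConnectedComponent.sound (L.adj i).reachable).trans hv
  · intro v _ w _ hvw
    simp only [Finset.disjoint_left, Finset.mem_filter, Finset.mem_univ, true_and]
    exact fun i hi hi' => hvw (Fin.ext (hi.2.symm.trans hi'.2))

open Classical in
/-- The number of choices of inner edges in a component. -/
noncomputable def choicesIn (C : G.ConnectedComponent) : ℕ :=
  ∏ v : Fin n with G.connectedComponentMk v = C, ((edgeArrays φ L).inst.options v).card

/-- A vertex that owns no inner edge has the single option `0`. -/
theorem choicesIn_eq (C : G.ConnectedComponent) :
    choicesIn φ L C = ∏ v ∈ ownersIn φ L C, ((edgeArrays φ L).inst.options v).card := by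
  classical
  refine (Finset.prod_subset (fun v hv => ?_) fun v hv hv' => ?_).symm
  · simp only [ownersIn, Finset.mem_filter, Finset.mem_univ, true_and] at hv ⊢
    exact hv.1
  · have h0 : {i : Fin L.m | (edgeArrays φ L).inst.InnerAt v (i + 1)} = ∅ := by
      ext i
      simp only [Set.mem_ofPred_eq, Set.mem_empty_iff_false, iff_false]
      intro hi
      exact hv' (Finset.mem_filter.2 ⟨Finset.mem_univ _, (Finset.mem_filter.1 hv).2, i, hi⟩)
    have h1 := card_options_le φ L v
    rw [h0, Set.ncard_empty] at h1
    have h2 : 0 < ((edgeArrays φ L).inst.options v).card :=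
      Finset.card_pos.2 ⟨0, Instance.mem_options.2 (Or.inl rfl)⟩
    omega

theorem choicesIn_eq_one {C : G.ConnectedComponent} (h : ¬ (ownersIn φ L C).Nonempty) :
    choicesIn φ L C = 1 := by
  rw [choicesIn_eq, Finset.not_nonempty_iff_eq_empty.1 h, Finset.prod_empty]

/-- AM-GM: `4 * (1 + a) * (1 + b) ≤ (a + b + 2) ^ 2`, and `a + b + 2 ≤ o + 1`. -/
theorem four_mul_prod_le {ι : Type*} {S : Finset ι} {d : ι → ℕ} {o : ℕ} (h1 : S.card ≤ 2)
    (h2 : ∑ v ∈ S, d v + 1 ≤ o) : 4 * ∏ v ∈ S, (1 + d v) ≤ (o + 1) ^ 2 := by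
  classical
  obtain h | h | h : S.card = 0 ∨ S.card = 1 ∨ S.card = 2 := by omega
  · obtain rfl := Finset.card_eq_zero.1 h
    simp only [Finset.sum_empty, Finset.prod_empty] at h2 ⊢
    nlinarith
  · obtain ⟨v, rfl⟩ := Finset.card_eq_one.1 h
    simp only [Finset.sum_singleton, Finset.prod_singleton] at h2 ⊢
    nlinarith
  · obtain ⟨v, w, hvw, rfl⟩ := Finset.card_eq_two.1 h
    simp only [Finset.sum_pair hvw, Finset.prod_pair hvw] at h2 ⊢
    zify at h2 ⊢
    nlinarith [sq_nonneg ((d v : ℤ) - d w)]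

theorem four_mul_choicesIn_le (hG : G.IsAcyclic) (hP : (pathGraph 7).Free G)
    (C : G.ConnectedComponent) : 4 * choicesIn φ L C ≤ (order C + 1) ^ 2 := by
  classical
  have h1 := card_ownersIn_le φ L hG hP C
  have h2 := (Nat.add_le_add_right (sum_ncard_le φ L C) 1).trans (card_edgesIn L hG C)
  have h3 : choicesIn φ L C ≤ ∏ v ∈ ownersIn φ L C,
      (1 + {i : Fin L.m | (edgeArrays φ L).inst.InnerAt v (i + 1)}.ncard) := by
    rw [choicesIn_eq]
    exact Finset.prod_le_prod' fun v _ => card_options_le φ L v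
  exact (Nat.mul_le_mul_left 4 h3).trans (four_mul_prod_le h1 h2)

theorem card_choices [Fintype G.ConnectedComponent] : (edgeArrays φ L).inst.choices.card = ∏ C, choicesIn φ L C := by
  classical
  rw [Instance.choices, Fintype.card_piFinset]
  exact (Finset.prod_fiberwise (Finset.univ : Finset (Fin n)) G.connectedComponentMk
    fun v : Fin n => ((edgeArrays φ L).inst.options v).card).symm

theorem card_innerOwners [Fintype G.ConnectedComponent] : (edgeArrays φ L).inst.innerOwners.card ≤
    ∑ C : G.ConnectedComponent, (ownersIn φ L C).card := by
  classical
  have hsub : (edgeArrays φ L).inst.innerOwners ⊆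
      (Finset.univ.biUnion fun C : G.ConnectedComponent => ownersIn φ L C).image Fin.val := by
    intro v hv
    simp only [Instance.innerOwners, Finset.mem_filter, Finset.mem_range] at hv
    obtain ⟨hv, e, h1, h2, h3⟩ := hv
    have hv' : v < n := hv
    have h2' : e ≤ L.m := h2
    simp only [Finset.mem_image, Finset.mem_biUnion, Finset.mem_univ, true_and, ownersIn,
      Finset.mem_filter]
    refine ⟨⟨v, hv'⟩, ⟨_, rfl, ⟨e - 1, by omega⟩, ?_⟩, rfl⟩
    simpa [Nat.sub_add_cancel h1] using h3
  exact (Finset.card_le_card hsub).trans (Finset.card_image_le.trans Finset.card_biUnion_le)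

end Graph

end RainbowMatching


/-! ### Estimates for products over the components. -/

namespace RainbowMatching

open SimpleGraph

section Estimates

/-- An upper bound for the number of choices in a component with `m` vertices. -/
noncomputable def weight (m : ℕ) : ℝ := if 4 ≤ m then (m : ℝ) ^ 2 / 2 else 1

theorem one_le_weight (m : ℕ) : 1 ≤ weight m := by
  unfold weight
  split_ifs with h
  · have : (4 : ℝ) ≤ m := by exact_mod_cast h
    nlinarith
  · exact le_rfl

theorem weight_le_sq {m : ℕ} (hm : 1 ≤ m) : weight m ≤ (m : ℝ) ^ 2 := by
  have : (1 : ℝ) ≤ m := by exact_mod_cast hm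
  unfold weight
  split_ifs with h <;> nlinarith

theorem sq_le_two_pow {m : ℕ} (hm : 4 ≤ m) : m ^ 2 ≤ 2 ^ m := by
  induction m, hm using Nat.le_induction with
  | base => norm_num
  | succ m hm ih =>
    rw [pow_succ 2]
    nlinarith

theorem weight_le_two_rpow {m : ℕ} (hm : 1 ≤ m) : weight m ≤ 2 ^ ((m : ℝ) - 1) := by
  unfold weight
  split_ifs with h
  · rw [Real.rpow_sub_one two_ne_zero, Real.rpow_natCast]
    have : (m : ℝ) ^ 2 ≤ 2 ^ m := by exact_mod_cast sq_le_two_pow h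
    linarith
  · exact Real.one_le_rpow one_le_two (by simpa using hm)

/-- The two sides agree at 2 and 4, and by concavity `log x` lies above the chord `x / 2 * log 2` in
between. -/
theorem two_rpow_le_sq {x : ℝ} (h2 : 2 ≤ x) (h4 : x ≤ 4) : (2 : ℝ) ^ x ≤ x ^ 2 := by
  have hlog : x / 2 * Real.log 2 ≤ Real.log x := by
    have h := strictConcaveOn_log_Ioi.concaveOn.2 (Set.mem_Ioi.2 two_pos)
      (Set.mem_Ioi.2 four_pos) (show 0 ≤ (4 - x) / 2 by linarith)
      (show 0 ≤ (x - 2) / 2 by linarith) (by ring)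
    have hl : Real.log 4 = 2 * Real.log 2 := by
      rw [show (4 : ℝ) = 2 ^ 2 by norm_num, Real.log_pow]
      norm_num
    simp only [smul_eq_mul, hl] at h
    rw [show (4 - x) / 2 * 2 + (x - 2) / 2 * 4 = x by ring] at h
    linarith
  rw [← Real.log_le_log_iff (by positivity) (by positivity), Real.log_rpow two_pos, Real.log_pow]
  push_cast
  linarith

/-- `log r` is the slope of a line above `log ∘ weight` that has height `log (x ^ 2 / 2)` at `x`. Up
to `x = 4` the slope `log 2` works, because `weight m ≤ 2 ^ (m - 1)` and `2 ^ x ≤ x ^ 2`; the latter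
is where `2 ≤ x` is needed. -/
theorem exists_weight_le {x : ℝ} (hx : 2 ≤ x) :
    ∃ r : ℝ, 0 < r ∧ ∀ m : ℕ, 1 ≤ m → weight m ≤ x ^ 2 / 2 * r ^ ((m : ℝ) - x) := by
  rcases le_total x 4 with h4 | h4
  · refine ⟨2, two_pos, fun m hm => (weight_le_two_rpow hm).trans ?_⟩
    rw [show (m : ℝ) - 1 = (x - 1) + (m - x) by ring, Real.rpow_add two_pos,
      Real.rpow_sub_one two_ne_zero]
    gcongr
    exact two_rpow_le_sq hx h4
  -- From 4 on, `2 / x` is the slope of the tangent to `log (m ^ 2 / 2)` at `x`. For the small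
  -- orders of weight 1 it suffices that `x ^ 2 / 2 ≥ 8 ≥ exp 2`.
  · refine ⟨Real.exp (2 / x), Real.exp_pos _, fun m hm => ?_⟩
    have hx0 : 0 < x := by linarith
    rw [← Real.exp_mul]
    unfold weight
    split_ifs with h
    · have h1 : (m : ℝ) / x ≤ Real.exp (m / x - 1) := by
        simpa using Real.add_one_le_exp ((m : ℝ) / x - 1)
      have h2 : ((m : ℝ) / x) ^ 2 ≤ Real.exp (2 / x * (m - x)) := by
        have : Real.exp (2 / x * (m - x)) = Real.exp (m / x - 1) ^ 2 := by
          rw [← Real.exp_nat_mul]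
          congr 1
          push_cast
          field_simp
        rw [this]
        gcongr
      calc (m : ℝ) ^ 2 / 2 = x ^ 2 / 2 * (m / x) ^ 2 := by field_simp
        _ ≤ _ := by gcongr
    · have h1 : Real.exp (-2) ≤ Real.exp (2 / x * (m - x)) := by
        apply Real.exp_le_exp.2
        rw [mul_sub, div_mul_cancel₀ _ hx0.ne']
        have : 0 ≤ 2 / x * m := by positivity
        linarith
      have h2 : Real.exp 2 ≤ 8 := by
        rw [show (2 : ℝ) = 1 + 1 by norm_num, Real.exp_add]
        nlinarith [Real.exp_one_lt_d9, Real.exp_pos 1]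
      have h3 : (1 : ℝ) / 8 ≤ Real.exp (-2) := by
        rw [Real.exp_neg, ← one_div]
        exact one_div_le_one_div_of_le (Real.exp_pos _) h2
      nlinarith

variable {ι : Type*} [Fintype ι] {o : ι → ℕ} {n : ℕ}

/-- With the average order as `x`, the exponents of `r` add up to zero. -/
theorem prod_weight_le_pow (ho : ∀ i, 1 ≤ o i) (hn : ∑ i, o i = n) (hk : 0 < Fintype.card ι)
    (h2 : 2 * Fintype.card ι ≤ n) :
    ∏ i, weight (o i) ≤ (((n : ℝ) / Fintype.card ι) ^ 2 / 2) ^ Fintype.card ι := by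
  set k := Fintype.card ι with hkd
  have hk' : (0 : ℝ) < k := by exact_mod_cast hk
  have hx : 2 ≤ (n : ℝ) / k := by
    rw [le_div_iff₀ hk']
    exact_mod_cast h2
  obtain ⟨r, hr, h⟩ := exists_weight_le hx
  calc ∏ i, weight (o i) ≤ ∏ i, (((n : ℝ) / k) ^ 2 / 2 * r ^ ((o i : ℝ) - n / k)) :=
        Finset.prod_le_prod (fun i _ => zero_le_one.trans (one_le_weight _)) fun i _ => h _ (ho i)
    _ = (((n : ℝ) / k) ^ 2 / 2) ^ k := by
        rw [Finset.prod_mul_distrib, Finset.prod_const, Finset.card_univ, ← hkd,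
          ← Real.rpow_sum_of_pos hr, Finset.sum_sub_distrib, Finset.sum_const, Finset.card_univ,
          ← hkd, ← Nat.cast_sum, hn, nsmul_eq_mul, mul_div_cancel₀ _ hk'.ne', sub_self,
          Real.rpow_zero, mul_one]

theorem prod_weight_le (ho : ∀ i, 1 ≤ o i) (hn : ∑ i, o i = n) :
    ∏ i, weight (o i) ≤ (n : ℝ) ^ (2 * Fintype.card ι) := by
  rw [pow_mul, ← Finset.card_univ, ← Finset.prod_const]
  refine Finset.prod_le_prod (fun i _ => zero_le_one.trans (one_le_weight _)) fun i _ =>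
    (weight_le_sq (ho i)).trans ?_
  gcongr
  exact hn ▸ Finset.single_le_sum (fun _ _ => Nat.zero_le _) (Finset.mem_univ i)

theorem one_add_sum_div_le_prod {t : ι → ℝ} (ht : ∀ i, 0 ≤ t i) :
    1 + ∑ i, t i ≤ ∏ i, (1 + t i) := by
  classical
  suffices ∀ s : Finset ι, 1 + ∑ i ∈ s, t i ≤ ∏ i ∈ s, (1 + t i) from this _
  intro s
  induction s using Finset.induction_on with
  | empty => simp
  | insert i s hi ih =>
    rw [Finset.sum_insert hi, Finset.prod_insert hi]
    have := Finset.sum_nonneg fun j (_ : j ∈ s) => ht j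
    nlinarith [ht i]

/-- The number of owners is spread over the components by `1 + ∑ w ≤ 8 * ∏ (1 + w / 8)`. A component
with owners then contributes at most `5 / 4 * (o + 1) ^ 2 / 4 ≤ o ^ 2 / 2`, valid from `o = 4` on; 8
is the least integer denominator that works at `o = 4`, `w = 2`. The `+ 1` after the product of the
`c i` doubles 8 to 16. -/
theorem prod_add_one_mul_le {c w : ι → ℕ} (hw : ∀ i, w i ≤ 2) (h4 : ∀ i, w i ≠ 0 → 4 ≤ o i)
    (hc : ∀ i, 4 * c i ≤ (o i + 1) ^ 2) (h1 : ∀ i, w i = 0 → c i = 1) :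
    (((∏ i, c i + 1) * (∑ i, w i + 1) : ℕ) : ℝ) ≤ 16 * ∏ i, weight (o i) := by
  have hsum : ((∑ i, w i + 1 : ℕ) : ℝ) ≤ 8 * ∏ i, (1 + (w i : ℝ) / 8) := by
    have := one_add_sum_div_le_prod (t := fun i => (w i : ℝ) / 8) fun i => by positivity
    rw [← Finset.sum_div] at this
    push_cast
    linarith
  have hwt : ∀ i, (1 + (w i : ℝ) / 8) ≤ weight (o i) ∧
      (c i : ℝ) * (1 + (w i : ℝ) / 8) ≤ weight (o i) := by
    intro i
    by_cases h : w i = 0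
    · simpa [h, h1 i h] using one_le_weight _
    · have ho : (4 : ℝ) ≤ o i := by exact_mod_cast h4 i h
      have hw' : (w i : ℝ) ≤ 2 := by exact_mod_cast hw i
      have hc' : 4 * (c i : ℝ) ≤ (o i + 1) ^ 2 := by exact_mod_cast hc i
      rw [weight, if_pos (h4 i h)]
      refine ⟨by nlinarith, ?_⟩
      have : (c i : ℝ) * (1 + (w i : ℝ) / 8) ≤ c i * (5 / 4) := by gcongr; linarith
      nlinarith
  have hP : ∏ i, (1 + (w i : ℝ) / 8) ≤ ∏ i, weight (o i) :=
    Finset.prod_le_prod (fun i _ => by positivity) fun i _ => (hwt i).1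
  have hQ : (∏ i, (c i : ℝ)) * ∏ i, (1 + (w i : ℝ) / 8) ≤ ∏ i, weight (o i) := by
    rw [← Finset.prod_mul_distrib]
    exact Finset.prod_le_prod (fun i _ => by positivity) fun i _ => (hwt i).2
  have hc0 : (0 : ℝ) ≤ ∏ i, (c i : ℝ) := by positivity
  rw [Nat.cast_mul]
  calc ((∏ i, c i + 1 : ℕ) : ℝ) * ((∑ i, w i + 1 : ℕ) : ℝ)
      ≤ ((∏ i, c i + 1 : ℕ) : ℝ) * (8 * ∏ i, (1 + (w i : ℝ) / 8)) := by gcongr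
    _ ≤ _ := by
      push_cast
      linarith

/-- With `x = n / k ≥ 2` one has `k ≤ 2 ^ (k - 1) ≤ x ^ (k - 1)`, hence `n = k * x ≤ x ^ k ≤ (x ^ 2
/ 2) ^ k`. This absorbs the quadratic term of `stepBound`. -/
theorem le_pow_div_two {k : ℕ} (hk : 0 < k) (h2 : 2 * k ≤ n) :
    (n : ℝ) ≤ (((n : ℝ) / k) ^ 2 / 2) ^ k := by
  have hk' : (0 : ℝ) < k := by exact_mod_cast hk
  have hx : 2 ≤ (n : ℝ) / k := by
    rw [le_div_iff₀ hk']
    exact_mod_cast h2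
  set x := (n : ℝ) / k with hxd
  have hn : (n : ℝ) = k * x := by rw [hxd, mul_div_cancel₀ _ hk'.ne']
  obtain ⟨j, rfl⟩ : ∃ j, k = j + 1 := ⟨k - 1, by omega⟩
  have hj : ((j + 1 : ℕ) : ℝ) ≤ 2 ^ j := by exact_mod_cast Nat.succ_le_of_lt Nat.lt_two_pow_self
  calc (n : ℝ) = (j + 1 : ℕ) * x := hn
    _ ≤ 2 ^ j * x := by gcongr
    _ ≤ x ^ j * x := by gcongr
    _ = x ^ (j + 1) := (pow_succ x j).symm
    _ ≤ (x ^ 2 / 2) ^ (j + 1) := by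
      gcongr
      nlinarith

theorem rpow_div_eq {k : ℕ} (hk : 0 < k) (hn : 0 < n) :
    (n : ℝ) ^ ((4 * (k : ℝ) + 3) / 2) / (2 ^ k * (k : ℝ) ^ (2 * k)) =
      (n : ℝ) ^ ((3 : ℝ) / 2) * (((n : ℝ) / k) ^ 2 / 2) ^ k := by
  have hn' : (0 : ℝ) < n := by exact_mod_cast hn
  have hk' : (0 : ℝ) < k := by exact_mod_cast hk
  rw [show (4 * (k : ℝ) + 3) / 2 = 3 / 2 + (2 * k : ℕ) by push_cast; ring, Real.rpow_add hn',
    Real.rpow_natCast, div_pow, div_pow, div_pow, ← pow_mul, ← pow_mul]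
  field_simp

end Estimates

theorem SolvesWithin.mono {p : RAM.Prog} {n : ℕ} {G : SimpleGraph (Fin n)} {φ : G.EdgeLabeling ℕ}
    {L : EdgeList G} {b c : ℝ} (h : SolvesWithin p φ L b) (hbc : b ≤ c) : SolvesWithin p φ L c := by
  obtain ⟨t, s, M, h1, h2, h3⟩ := h
  exact ⟨t, s, M, h1, h2.trans hbc, h3⟩

/-! ### The time bounds on forests. -/

section Graph

variable {n : ℕ} {G : SimpleGraph (Fin n)} (φ : G.EdgeLabeling ℕ) (L : EdgeList G)

/-- A forest has at most `n` edges, so `n + L.m + 1 ≤ 3 * n`; this gives `9 = 3 ^ 2` and `48 = 16 *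
3`, and then `228000 = 4000 * (9 + 48)` in the final bounds. -/
theorem stepBound_le [Fintype G.ConnectedComponent] (hn : 0 < n) (hG : G.IsAcyclic)
    (hP : (pathGraph 7).Free G) : (stepBound φ L : ℝ) ≤
      9 * (n : ℝ) ^ 2 + 48 * (n * ∏ C : G.ConnectedComponent, weight (order C)) := by
  have hmain := prod_add_one_mul_le (o := order (G := G)) (c := choicesIn φ L)
    (w := fun C => (ownersIn φ L C).card) (card_ownersIn_le φ L hG hP)
    (fun C hC => four_le_order φ L hG (Finset.card_ne_zero.1 hC))
    (four_mul_choicesIn_le φ L hG hP)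
    (fun C hC => choicesIn_eq_one φ L fun h => h.card_pos.ne' hC)
  have hnat : stepBound φ L ≤ (3 * n) ^ 2 + ((∏ C, choicesIn φ L C + 1) *
      (∑ C : G.ConnectedComponent, (ownersIn φ L C).card + 1)) * (3 * n) := by
    have h3 : n + L.m + 1 ≤ 3 * n := by
      have := m_le L hG
      omega
    rw [stepBound, card_choices, mul_assoc]
    gcongr
    exact card_innerOwners φ L
  calc (stepBound φ L : ℝ) ≤ _ := Nat.cast_le.2 hnat
    _ = (3 * n) ^ 2 + (((∏ C, choicesIn φ L C + 1) *
      (∑ C : G.ConnectedComponent, (ownersIn φ L C).card + 1) : ℕ) : ℝ) * (3 * n) := by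
        push_cast
        ring
    _ ≤ (3 * n) ^ 2 + 16 * (∏ C : G.ConnectedComponent, weight (order C)) * (3 * n) := by gcongr
    _ = _ := by ring

theorem solvesWithin_of_two_mul_card_le {k : ℕ} (hn : 0 < n) (hG : G.IsAcyclic)
    (hP : (pathGraph 7).Free G) (hk : Nat.card G.ConnectedComponent = k) (h2 : 2 * k ≤ n) :
    SolvesWithin Algorithm.main φ L
      (228000 * ((n : ℝ) ^ ((4 * (k : ℝ) + 3) / 2) / (2 ^ k * (k : ℝ) ^ (2 * k)))) := by
  have := Fintype.ofFinite G.ConnectedComponent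
  rw [Nat.card_eq_fintype_card] at hk
  subst hk
  set k := Fintype.card G.ConnectedComponent with hk
  have hk0 : 0 < k := Fintype.card_pos_iff.2 ⟨G.connectedComponentMk ⟨0, hn⟩⟩
  refine (solvesWithin_main φ L).mono ?_
  rw [rpow_div_eq hk0 hn]
  have h := stepBound_le φ L hn hG hP
  have hprod := prod_weight_le_pow (o := order (G := G))
    (fun C => (Nat.le_add_left _ _).trans (card_edgesIn L hG C)) sum_order hk0 h2
  have hB := le_pow_div_two hk0 h2
  rw [← hk] at hprod
  set B := (((n : ℝ) / k) ^ 2 / 2) ^ k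
  have hn1 : (1 : ℝ) ≤ n := by exact_mod_cast hn
  -- The estimates give a multiple of `n * B`; the factor `n ^ (3 / 2)` of the claim leaves room.
  have hn32 : (n : ℝ) ≤ (n : ℝ) ^ ((3 : ℝ) / 2) := by
    conv_lhs => rw [← Real.rpow_one (n : ℝ)]
    exact Real.rpow_le_rpow_of_exponent_le hn1 (by norm_num)
  have h3 : (n : ℝ) * B ≤ (n : ℝ) ^ ((3 : ℝ) / 2) * B := by gcongr
  have h4 : (n : ℝ) * n ≤ n * B := by gcongr
  have h5 : (n : ℝ) * ∏ C : G.ConnectedComponent, weight (order C) ≤ n * B := by gcongr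
  push_cast
  linarith [sq (n : ℝ)]

theorem solvesWithin_of_card_le {K : ℕ} (hn : 0 < n) (hG : G.IsAcyclic)
    (hP : (pathGraph 7).Free G) (hK : Nat.card G.ConnectedComponent ≤ K) :
    SolvesWithin Algorithm.main φ L (228000 * (n : ℝ) ^ ((4 * (K : ℝ) + 3) / 2)) := by
  have := Fintype.ofFinite G.ConnectedComponent
  rw [Nat.card_eq_fintype_card] at hK
  have hk0 : 0 < Fintype.card G.ConnectedComponent :=
    Fintype.card_pos_iff.2 ⟨G.connectedComponentMk ⟨0, hn⟩⟩
  refine (solvesWithin_main φ L).mono ?_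
  have h := stepBound_le φ L hn hG hP
  have hprod := prod_weight_le (o := order (G := G))
    (fun C => (Nat.le_add_left _ _).trans (card_edgesIn L hG C)) sum_order
  have hn1 : (1 : ℝ) ≤ n := by exact_mod_cast hn
  have hpow : (n : ℝ) ^ (2 * K + 1) ≤ (n : ℝ) ^ ((4 * (K : ℝ) + 3) / 2) := by
    rw [← Real.rpow_natCast]
    refine Real.rpow_le_rpow_of_exponent_le hn1 ?_
    push_cast
    linarith
  -- Here `K ≥ 1` is used, which holds because a non-empty forest has a component.
  have h4 : (n : ℝ) ^ 2 ≤ (n : ℝ) ^ (2 * K + 1) := pow_le_pow_right₀ hn1 (by omega)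
  have h5 : (n : ℝ) * ∏ C : G.ConnectedComponent, weight (order C) ≤ (n : ℝ) ^ (2 * K + 1) := by
    rw [pow_succ']
    gcongr
    exact hprod.trans (pow_le_pow_right₀ hn1 (by omega))
  push_cast
  linarith

end Graph

end RainbowMatching

theorem theorem4p3 :
    ∃ p : RAM.Prog,
      -- the time bound, with one constant for all `n` and `k`
      (∃ C : ℝ, ∀ (n k : ℕ) (G : SimpleGraph (Fin n)) (φ : G.EdgeLabeling ℕ)
        (L : RainbowMatching.EdgeList G),
        0 < n → G.IsAcyclic → (SimpleGraph.pathGraph 7).Free G →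
        Nat.card G.ConnectedComponent = k → 2 * k ≤ n →
        RainbowMatching.SolvesWithin p φ L
          (C * ((n : ℝ) ^ ((4 * (k : ℝ) + 3) / 2) / (2 ^ k * (k : ℝ) ^ (2 * k))))) ∧
      -- a polynomial bound for boundedly many components
      (∀ K : ℕ, ∃ C : ℝ, ∀ (n : ℕ) (G : SimpleGraph (Fin n)) (φ : G.EdgeLabeling ℕ)
        (L : RainbowMatching.EdgeList G),
        0 < n → G.IsAcyclic → (SimpleGraph.pathGraph 7).Free G →
        Nat.card G.ConnectedComponent ≤ K →
        RainbowMatching.SolvesWithin p φ L (C * (n : ℝ) ^ ((4 * (K : ℝ) + 3) / 2))) ∧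
      -- trees
      (∃ C : ℝ, ∀ (n : ℕ) (G : SimpleGraph (Fin n)) (φ : G.EdgeLabeling ℕ)
        (L : RainbowMatching.EdgeList G),
        G.IsTree → (SimpleGraph.pathGraph 7).Free G →
        RainbowMatching.SolvesWithin p φ L (C * (n : ℝ) ^ ((7 : ℝ) / 2))) := by
  refine ⟨RainbowMatching.Algorithm.main, ⟨228000, fun n k G φ L hn hG hP hk h2 =>
    RainbowMatching.solvesWithin_of_two_mul_card_le φ L hn hG hP hk h2⟩,
    fun K => ⟨228000, fun n G φ L hn hG hP hK =>
      RainbowMatching.solvesWithin_of_card_le φ L hn hG hP hK⟩,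
    ⟨228000, fun n G φ L hG hP => ?_⟩⟩
  have : Nonempty (Fin n) := hG.connected.nonempty
  -- The bound for `K = 1` is used, as the tree with a single vertex violates `2 * k ≤ n`.
  have hcard : Nat.card G.ConnectedComponent ≤ 1 := by
    have := hG.connected.preconnected.subsingleton_connectedComponent
    exact Finite.card_le_one_iff_subsingleton.2 this
  have h := RainbowMatching.solvesWithin_of_card_le φ L (Fin.pos_iff_nonempty.2 this) hG.isAcyclic
    hP hcard
  norm_num at h ⊢
  exact h
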